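/- **Theorem E.1 (posterior with latent states).** *Setting.* Let $\Omega\subset\mathbb R^D$ be a half-open box containing $n\ge 1$ distinct training locations $x_1,\dots,x_n$, and let $\mu=\sum_i m_i\delta_{x_i}$ with $m_i>0$ (e.g. the empirical measure); write $|A|=\mu(A)$. Nodes are half-open boxes $A$. For $\ell\in[0,1]$, $A_l^{(d,\ell)}$ and $A_r^{(d,\ell)}$ are the lower and upper parts of $A$ when its marginal interval in dimension $d$ is cut at relative location $\ell$. A node is *atomic* if it contains exactly one training location. The wavelet coefficient of the data $y\in\mathbb R^n$ at a split is $$w_{d,\ell}(A)=\sqrt{\tfrac{|A_l||A_r|}{|A|}}\Bigl(\tfrac1{|A_l|}\int_{A_l}y\,d\mu-\tfrac1{|A_r|}\int_{A_r}y\,d\mu\Bigr).$$ *Prior.* The tree $T$ has a random unbalanced Haar wavelet tree prior: starting with $\Omega$, each non-atomic node $A$ draws a split dimension $d$ with probability $\lambda_d(A)$ and then a split location $\ell\sim B_{A,d}$ on $[0,1]$, and its two children are grown independently; the probability of creating a child with no training locations is zero ($\lambda_d(A)$ and $B_{A,d}$ depend measurably on $A$). Given $T$, the nodes of $T$ (atomic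 ones included) carry latent states $S(A)\in\{1,\dots,K\}$ forming a top-down Markov tree: a node at depth $j$ whose parent has state $s$ has state $s'$ with probability $\rho_j(s,s')$. The root is given a virtual parent in a fixed state $s_0$, so that $\rho_0(s_0,\cdot)$ is the initial distribution. *Data.* Given $(T,S)$, the pairs $(w_A,z_A)$ of wavelet coefficient and local latent variable at the internal nodes $A$ of $T$ are independent, $(w_A,z_A)$ having density $p_A^{(S(A))}(w,z)$ with respect to $dw\,dz$ (hyperparameters fixed; $p_A^{(s)}$ may depend on the depth of $A$ and is jointly measurable in $(A,w,z)$), and they are independent of the $\mu$-average of $y$, whose law does not depend on $(T,S)$. Put $M^{(s)}_{d,\ell}(A)=\int p^{(s)}_A(w_{d,\ell}(A),z)\,dz$. *Marginal likelihoods.* For a node $A$ at depth $j$ let $\Phi_s(A)$ be the marginal likelihood of the coefficients below $A$ given that the parent of $A$ has state $s$, i.e. the product of the $M^{(S(A'))}$ over the internal nodes $A'$ of the subtree rooted at $A$, averaged over the prior of that subtree and of its states. (For a given box it may depend on $j$.) *Conclusion.* First, $\Phi_s(A)=1$ if $A$ is atomic, and for every node $A$ at depth $j$ with at least two training locations $$\Phi_s(A)=\sum_{s'}\rho_j(s,s')\sum_d\lambda_d(A)\int_0^1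 M^{(s')}_{d,\ell}(A)\,\Phi_{s'}(A_l^{(d,\ell)})\,\Phi_{s'}(A_r^{(d,\ell)})\,dB_{A,d}(\ell).$$ Second, there is a regular conditional distribution of $(T,S)$ given the data $y$ (with the $z$'s integrated out) such that for almost every $y$ (with respect to the law of the data) $0<\Phi_{s_0}(\Omega)<\infty$ and the following sequential description holds for every measurable rule that selects, from a partially grown tree with partially generated states, a node whose state has not yet been generated (breadth-first, depth-first, etc.). Begin with $T^{(0)}=\{\Omega\}$ and no state generated. Given $T^{(k)}$ with the states generated so far, let $A$ be the selected node, $j$ its depth and $s$ the state of its parent. * If $A$ is not atomic, its state is $s'$ with probability $$\rho_j(s,s')\sum_d\lambda_d(A)\int_0^1M^{(s')}_{d,\ell}(A)\frac{\Phi_{s'}(A_l^{(d,\ell)})\Phi_{s'}(A_r^{(d,\ell)})}{\Phi_s(A)}\,dB_{A,d}(\ell).$$ Given $S(A)=s'$, the node is split in dimension $d$ with probability proportional (in $d$) to $\lambda_d(A)\int_0^1M^{(s')}_{d,\ell}(A)\Phi_{s'}(A_l^{(d,\ell)})\Phi_{s'}(A_r^{(d,\ell)})\,dB_{A,d}(\ell)$,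 and, given also $d$, at a location drawn from the distribution proportional to $M^{(s')}_{d,\ell}(A)\Phi_{s'}(A_l^{(d,\ell)})\Phi_{s'}(A_r^{(d,\ell)})\,dB_{A,d}(\ell)$. * If $A$ is atomic, its state is $s'$ with probability $\rho_j(s,s')$ and $A$ is not split. That is, these are, under the posterior, the conditional distributions of the $(k+1)$-st revealed part of $(T,S)$ given the first $k$ revealed parts, for every $k$; and the law of the result of this procedure after any number $N\ge 2n-1$ of steps (a step changing nothing once all states are generated) is the posterior distribution of $(T,S)$ given $y$. -/

import Mathlib

open MeasureTheory ProbabilityTheory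
open scoped ENNReal unitInterval

noncomputable section

namespace UHWT

/-! ### The sigma-algebra on `Option α` (one isolated point added to `α`) -/

instance instMeasurableSpaceOption {α : Type*} [MeasurableSpace α] : MeasurableSpace (Option α) :=
  MeasurableSpace.map (some : α → Option α) inferInstance

/-! ### Nodes (axis-aligned boxes), splits, training locations -/

/-- A box with lower corner `A.1` and upper corner `A.2`; it stands for the set
`∏ k, (A.1 k, A.2 k]`. -/
abbrev Box (D : ℕ) := (Fin D → ℝ) × (Fin D → ℝ)

/-- Membership of a point in the half-open box. -/
def InBox {D : ℕ} (A : Box D) (v : Fin D → ℝ) : Prop := ∀ k, A.1 k < v k ∧ v k ≤ A.2 k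

/-- The child of `A` after bisecting it along dimension `d` at relative location `ℓ ∈ [0,1]` of its
marginal interval: `false` is the left (lower) child, `true` the right (upper) child. -/
def child {D : ℕ} (A : Box D) (d : Fin D) (l : I) (b : Bool) : Box D :=
  if b then (Function.update A.1 d (A.1 d + (l : ℝ) * (A.2 d - A.1 d)), A.2)
  else (A.1, Function.update A.2 d (A.1 d + (l : ℝ) * (A.2 d - A.1 d)))

open Classical in
/-- The number of training locations in `A`. A node is atomic when this number is `1`. -/
def numTrain {D n : ℕ} (x : Fin n → Fin D → ℝ) (A : Box D) : ℕ :=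
  (Finset.univ.filter fun i => InBox A (x i)).card

open Classical in
/-- `|A| = μ(A)` for the base measure `μ = ∑ i, m i • δ_{x i}`. -/
def mass {D n : ℕ} (x : Fin n → Fin D → ℝ) (m : Fin n → ℝ) (A : Box D) : ℝ :=
  ∑ i, if InBox A (x i) then m i else 0

open Classical in
/-- The unbalanced Haar wavelet `ψ_{A,d,ℓ}`. -/
def psi {D n : ℕ} (x : Fin n → Fin D → ℝ) (m : Fin n → ℝ) (A : Box D) (d : Fin D) (l : I)
    (v : Fin D → ℝ) : ℝ :=
  Real.sqrt (mass x m (child A d l false) * mass x m (child A d l true) / mass x m A) *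
    ((if InBox (child A d l false) v then 1 else 0) / mass x m (child A d l false) -
      (if InBox (child A d l true) v then 1 else 0) / mass x m (child A d l true))

/-- The wavelet coefficient `w_{d,ℓ}(A) = ⟨ψ_{A,d,ℓ}, y⟩` in `L²(μ)`. -/
def coef {D n : ℕ} (x : Fin n → Fin D → ℝ) (m : Fin n → ℝ) (A : Box D) (d : Fin D) (l : I)
    (y : Fin n → ℝ) : ℝ :=
  ∑ i, m i * (psi x m A d l (x i) * y i)

/-- The scaling coefficient: the `μ`-average of the data. -/
def average {n : ℕ} (m : Fin n → ℝ) (y : Fin n → ℝ) : ℝ := (∑ i, m i * y i) / ∑ i, m i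

/-! ### Trees and latent states -/

/-- Addresses of nodes of a binary tree, read from the root: `false` = left, `true` = right. The
depth of a node is the length of its address. -/
abbrev Addr := List Bool

/-- A (possibly partially grown) partition tree: `T a = some (d, ℓ)` when the node with address `a`
belongs to the tree and is split at `(d, ℓ)`; otherwise `T a = none`. -/
abbrev Tree (D : ℕ) := Addr → Option (Fin D × I)

/-- Latent states: `S a = some s` when the node with address `a` has been given state `s`, and
`S a = none` when `a` is not a node of the tree or its state has not been generated yet. -/
abbrev States (K : ℕ) := Addr → Option (Fin K)

/-- The subtree below the child `b` of the root. -/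
def sub {α : Type*} (T : Addr → α) (b : Bool) : Addr → α := fun a => T (b :: a)

/-- The labelling with root label `c`, left branch `Tl` and right branch `Tr`. -/
def graft {α : Type*} (c : α) (Tl Tr : Addr → α) : Addr → α
  | [] => c
  | false :: a => Tl a
  | true :: a => Tr a

/-- The tree with unsplit root (as a tree), or no state generated (as states). -/
def blank {α : Type*} : Addr → Option α := fun _ => none

/-- `a` is the address of a node of the tree: all its proper ancestors are split. -/
def IsNode {D : ℕ} : Tree D → Addr → Prop
  | _, [] => True
  | T, b :: a => T [] ≠ none ∧ IsNode (sub T b) a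

/-- The box at address `a` when the root of the tree is the box `A`. -/
def region {D : ℕ} : Box D → Tree D → Addr → Box D
  | A, _, [] => A
  | A, T, b :: a =>
    match T [] with
    | none => A
    | some (d, l) => region (child A d l b) (sub T b) a

/-- All addresses of length less than `k`. -/
def addrs (k : ℕ) : Finset Addr := (List.finite_length_lt Bool k).toFinset

/-- The internal nodes, at depth less than `k`, of the tree. -/
def internal {D : ℕ} (k : ℕ) (T : Tree D) : Finset Addr := (addrs k).filter fun a => (T a).isSome

/-! ### The prior -/

/-- The random UHWT started at the box `A`, with split dimension probabilities `lam` and split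
location distributions `B`: a node with at least two training locations draws its dimension, then
its location, and its two children are then grown independently. The first argument bounds the
number of levels of splits; every split strictly decreases the number of training locations of a
node, so with `n` training locations the bound `n` is never active. -/
def ruhwt {D n : ℕ} (x : Fin n → Fin D → ℝ) (lam : Box D → Fin D → ℝ≥0∞)
    (B : Fin D → Kernel (Box D) I) : ℕ → Box D → Measure (Tree D)
  | 0, _ => Measure.dirac blank
  | k + 1, A =>
    if 2 ≤ numTrain x A then
      ∑ d, lam A d • (B d A).bind fun l =>
        ((ruhwt x lam B k (child A d l false)).prod (ruhwt x lam B k (child A d l true))).map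
          fun q => graft (some (d, l)) q.1 q.2
    else Measure.dirac blank

/-- The top-down Markov tree of states on the tree `T`, whose root is at depth `j` and has a parent
in state `s`: the root draws `s'` from `ρ j s`, and given `s'` the states in the two subtrees are
independent. The first argument bounds the number of levels of nodes, as in `ruhwt`. -/
def markovTree {D K : ℕ} (ρ : ℕ → Fin K → PMF (Fin K)) :
    ℕ → ℕ → Fin K → Tree D → Measure (States K)
  | 0, _, _, _ => Measure.dirac blank
  | k + 1, j, s, T =>
    ∑ s', ρ j s s' •
      if (T []).isSome then
        ((markovTree ρ k (j + 1) s' (sub T false)).prod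
          (markovTree ρ k (j + 1) s' (sub T true))).map fun q => graft (some s') q.1 q.2
      else Measure.dirac (graft (some s') blank blank)

/-! ### The wavelet model -/

/-- The wavelet coefficient at the node with address `a` of the tree `T` with root box `Om`. -/
def coefAt {D n : ℕ} (x : Fin n → Fin D → ℝ) (m : Fin n → ℝ) (Om : Box D) (T : Tree D)
    (y : Fin n → ℝ) (a : Addr) : ℝ :=
  match T a with
  | none => 0
  | some (d, l) => coef x m (region Om T a) d l y

/-- From data `y` and local latent variables `z` to the scaling coefficient and the family
`(w_a, z_a)`, `a` ranging over the internal nodes of `T`. -/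
def analysis {D n : ℕ} {Z : Type*} (x : Fin n → Fin D → ℝ) (m : Fin n → ℝ) (Om : Box D)
    (T : Tree D) (q : (Fin n → ℝ) × (Addr → Z)) :
    ℝ × ({a // a ∈ internal n T} → ℝ × Z) :=
  (average m q.1, fun a => (coefAt x m Om T q.1 a, q.2 a))

/-- The law of scaling coefficient, wavelet coefficients and local latent variables given the tree
and the states: all independent, the pair `(w_a, z_a)` with density `p_a^{(s)}` with respect to
`dw dz` where `s` is the state of `a`, and the scaling coefficient with law `ν`. -/
def coefLaw {D K : ℕ} {Z : Type*} [MeasurableSpace Z] (n : ℕ) (Om : Box D) (ν : Measure ℝ)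
    (ζ : Measure Z) (p : ℕ → Fin K → Box D → ℝ → Z → ℝ≥0∞) (s₀ : Fin K) (T : Tree D)
    (S : States K) : Measure (ℝ × ({a // a ∈ internal n T} → ℝ × Z)) :=
  ν.prod (Measure.pi fun a : {a // a ∈ internal n T} =>
    (volume.prod ζ).withDensity fun q =>
      p a.1.length ((S a.1).getD s₀) (region Om T a.1) q.1 q.2)

/-- `M_{d,ℓ}^{(s)}(A) = ∫ p_A^{(s)}(w_{d,ℓ}(A), z) dz`, for a node `A` at depth `j`. -/
def localLik {D n K : ℕ} {Z : Type*} [MeasurableSpace Z] (x : Fin n → Fin D → ℝ) (m : Fin n → ℝ)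
    (ζ : Measure Z) (p : ℕ → Fin K → Box D → ℝ → Z → ℝ≥0∞) (y : Fin n → ℝ)
    (j : ℕ) (s : Fin K) (A : Box D) (d : Fin D) (l : I) : ℝ≥0∞ :=
  ∫⁻ z, p j s A (coef x m A d l y) z ∂ζ

/-- The product of the local likelihoods `M` over the internal nodes of a tree `T` with states `S`
whose root is the box `A` at depth `j`. -/
def treeLik {D K : ℕ} (n : ℕ) (M : ℕ → Fin K → Box D → Fin D → I → ℝ≥0∞) (j : ℕ) (A : Box D)
    (T : Tree D) (S : States K) : ℝ≥0∞ :=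
  ∏ a ∈ addrs n,
    match T a, S a with
    | some (d, l), some s => M (j + a.length) s (region A T a) d l
    | _, _ => 1

/-- The state-specific marginal likelihood `Φ_s(A)`: the likelihood of the coefficients below the
node `A` at depth `j` whose parent is in state `s`, averaged over the prior of the subtree and of
the states below `A`. -/
def margLik {D n K : ℕ} (x : Fin n → Fin D → ℝ) (lam : Box D → Fin D → ℝ≥0∞)
    (B : Fin D → Kernel (Box D) I) (ρ : ℕ → Fin K → PMF (Fin K))
    (M : ℕ → Fin K → Box D → Fin D → I → ℝ≥0∞) (j : ℕ) (s : Fin K) (A : Box D) : ℝ≥0∞ :=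
  ∫⁻ T, ∫⁻ S, treeLik n M j A T S ∂(markovTree ρ n j s T) ∂(ruhwt x lam B n A)

/-! ### The posterior transition, dimension and location distributions

Here `Phi j s A` stands for `Φ_s(A)` when `A` is at depth `j`. -/

/-- `∫ M_{d,ℓ}^{(s')}(A) Φ_{s'}(A_l) Φ_{s'}(A_r) dB_{A,d}(ℓ)`. -/
def splitMass {D K : ℕ} (B : Fin D → Kernel (Box D) I)
    (M : ℕ → Fin K → Box D → Fin D → I → ℝ≥0∞) (Phi : ℕ → Fin K → Box D → ℝ≥0∞)
    (j : ℕ) (s' : Fin K) (A : Box D) (d : Fin D) : ℝ≥0∞ :=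
  ∫⁻ l, M j s' A d l * (Phi (j + 1) s' (child A d l false) * Phi (j + 1) s' (child A d l true))
    ∂(B d A)

/-- The posterior probability that `A` (at depth `j`) has state `s'` when its parent has state `s`.
An atomic node carries no coefficient, and its state keeps the prior transition probability. -/
def postState {D n K : ℕ} (x : Fin n → Fin D → ℝ) (lam : Box D → Fin D → ℝ≥0∞)
    (B : Fin D → Kernel (Box D) I) (ρ : ℕ → Fin K → PMF (Fin K))
    (M : ℕ → Fin K → Box D → Fin D → I → ℝ≥0∞) (Phi : ℕ → Fin K → Box D → ℝ≥0∞)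
    (j : ℕ) (s : Fin K) (A : Box D) (s' : Fin K) : ℝ≥0∞ :=
  if 2 ≤ numTrain x A then
    ρ j s s' * ∑ d, lam A d * ∫⁻ l, M j s' A d l *
      (Phi (j + 1) s' (child A d l false) * Phi (j + 1) s' (child A d l true) / Phi j s A)
      ∂(B d A)
  else ρ j s s'

/-- The posterior probability of splitting `A` along `d`, given that its state is `s'`. -/
def postDim {D K : ℕ} (lam : Box D → Fin D → ℝ≥0∞) (B : Fin D → Kernel (Box D) I)
    (M : ℕ → Fin K → Box D → Fin D → I → ℝ≥0∞) (Phi : ℕ → Fin K → Box D → ℝ≥0∞)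
    (j : ℕ) (s' : Fin K) (A : Box D) (d : Fin D) : ℝ≥0∞ :=
  lam A d * splitMass B M Phi j s' A d / ∑ d', lam A d' * splitMass B M Phi j s' A d'

/-- The posterior distribution of the split location of `A`, given its state `s'` and its split
dimension `d`. -/
def postLoc {D K : ℕ} (B : Fin D → Kernel (Box D) I)
    (M : ℕ → Fin K → Box D → Fin D → I → ℝ≥0∞) (Phi : ℕ → Fin K → Box D → ℝ≥0∞)
    (j : ℕ) (s' : Fin K) (A : Box D) (d : Fin D) : Measure I :=
  (splitMass B M Phi j s' A d)⁻¹ • (B d A).withDensity fun l =>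
    M j s' A d l * (Phi (j + 1) s' (child A d l false) * Phi (j + 1) s' (child A d l true))

/-! ### Sequential generation -/

/-- `a` is a node of the partially grown tree whose latent state has not yet been generated. -/
def Pending {D K : ℕ} (c : Tree D × States K) (a : Addr) : Prop := IsNode c.1 a ∧ c.2 a = none

/-- The order in which nodes are processed (breadth-first, depth-first, ...): a measurable rule that
selects, in each partially grown tree, a node whose state has not yet been generated, and returns
`none` only when there is no such node. -/
structure IsSchedule {D K : ℕ} (next : Tree D × States K → Option Addr) : Prop where
  measurable : ∀ o, MeasurableSet {c | next c = o}
  pending : ∀ c a, next c = some a → Pending c a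
  exhausted : ∀ c, next c = none → ∀ a, ¬ Pending c a

/-- The state of the parent of `a`; the root is treated as having a virtual parent in state
`s₀`. -/
def parentState {K : ℕ} (s₀ : Fin K) (S : States K) (a : Addr) : Fin K :=
  if a = [] then s₀ else (S a.dropLast).getD s₀

/-- One step of sequential generation from the partially grown tree `c`: at the selected node, the
state is drawn from `qState`, and then, unless the node is atomic, the split dimension is drawn from
`qDim` and the split location from `qLoc`. -/
def stepLaw {D n K : ℕ} (x : Fin n → Fin D → ℝ) (Om : Box D) (s₀ : Fin K)
    (qState : ℕ → Fin K → Box D → Fin K → ℝ≥0∞) (qDim : ℕ → Fin K → Box D → Fin D → ℝ≥0∞)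
    (qLoc : ℕ → Fin K → Box D → Fin D → Measure I) (next : Tree D × States K → Option Addr)
    (c : Tree D × States K) : Measure (Tree D × States K) :=
  match next c with
  | none => Measure.dirac c
  | some a =>
    ∑ s', qState a.length (parentState s₀ c.2 a) (region Om c.1 a) s' •
      if 2 ≤ numTrain x (region Om c.1 a) then
        ∑ d, qDim a.length s' (region Om c.1 a) d •
          (qLoc a.length s' (region Om c.1 a) d).map fun l =>
            (Function.update c.1 a (some (d, l)), Function.update c.2 a (some s'))
      else Measure.dirac (c.1, Function.update c.2 a (some s'))

/-- The law of the partially grown tree after `k` steps, started from the tree `{Ω}` with no state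
generated. -/
def growLaw {D K : ℕ} (step : Tree D × States K → Measure (Tree D × States K)) :
    ℕ → Measure (Tree D × States K)
  | 0 => Measure.dirac (blank, blank)
  | k + 1 => (growLaw step k).bind step

/-- The partially grown tree `T^{(k)}`, with its states, that has been revealed after processing `k`
nodes of the tree with states `c` in the order `next`. -/
def reveal {D K : ℕ} (next : Tree D × States K → Option Addr) (c : Tree D × States K) :
    ℕ → Tree D × States K
  | 0 => (blank, blank)
  | k + 1 =>
    match next (reveal next c k) with
    | none => reveal next c k
    | some a => (Function.update (reveal next c k).1 a (c.1 a),
        Function.update (reveal next c k).2 a (c.2 a))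

/-- One step of sequential generation under the posterior given the data `y`. -/
def postStep {D n K : ℕ} {Z : Type*} [MeasurableSpace Z] (x : Fin n → Fin D → ℝ) (m : Fin n → ℝ)
    (Om : Box D) (lam : Box D → Fin D → ℝ≥0∞) (B : Fin D → Kernel (Box D) I)
    (ρ : ℕ → Fin K → PMF (Fin K)) (s₀ : Fin K) (ζ : Measure Z)
    (p : ℕ → Fin K → Box D → ℝ → Z → ℝ≥0∞) (next : Tree D × States K → Option Addr)
    (y : Fin n → ℝ) : Tree D × States K → Measure (Tree D × States K) :=
  stepLaw x Om s₀
    (postState x lam B ρ (localLik x m ζ p y) (margLik x lam B ρ (localLik x m ζ p y)))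
    (postDim lam B (localLik x m ζ p y) (margLik x lam B ρ (localLik x m ζ p y)))
    (postLoc B (localLik x m ζ p y) (margLik x lam B ρ (localLik x m ζ p y)))
    next

end UHWT

end

/-!
A tree with latent states is encoded by the mark of each node: its state and, if it is split, its
dimension and location. Both prior and posterior are branching processes of marks: the mark of a
node depends on the past only through the box of the node, its depth and the state of its parent,
and the parts of the tree in the two children are independent given that mark.

*Prior and posterior are branching processes.* `fill q k j s A c` completes a partially generated
configuration `c` top-down with node laws `q`, and `branch` is the case where nothing has been
generated. Multiplying the prior process by the likelihood, which is a product over internal nodes,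
gives finite or infinite measures `weighted` satisfying the same kind of recursion
(`IsSplitPrior.lintegral_weighted_of_two_le`). Their total masses are the marginal likelihoods
`Φ_s(A)`, whence the recursion for `Φ` (`IsSplitPrior.margLik_of_two_le`), and a Doob transform
identifies `weighted` with `Φ_s(A)` times the branching process whose node laws are the posterior
ones (`IsSplitPrior.weighted_eq_smul_branch`). Since almost surely both children of a split contain
training locations, the numbers of training locations decrease strictly down the tree, and the bound
on the number of levels is immaterial (`IsSplitPrior.weighted_eq_of_le`).

*Any order of generation.* Completing `c` is the same as drawing the mark of any one pending node
and then completing the result (`IsMarkLaw.fill_step`). By induction on the number of steps, generating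
nodes in the order given by a schedule and then completing always gives the law of the branching
process, and the marks already drawn are the revealed part of the completed tree
(`reveal_law_of_fill_eq`). A completely grown tree has `n` leaves and `n - 1` internal nodes, so
everything is revealed after `2 n - 1` steps (`reveal_eq_self`).

*The law of the data.* For a completely grown tree the unbalanced Haar wavelets are an orthonormal
basis of the mean-zero functions in `L²(μ)` (`Full.parseval` and a dimension count). Hence the map
from the data to their average and wavelet coefficients carries one and the same reference measure
`refMeasure` to the product of `ν` and Lebesgue measure, whatever the tree (`coeffs_refMeasure`).
With respect to this measure the data have, given tree and states, the likelihood as density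
(`data_law_eq`), and Bayes' theorem for dominated models (`hasCondDistrib_bayesKernel`) gives the
posterior as the prior reweighted by the likelihood.
-/

noncomputable section

namespace UHWT

/-! ### Measurability in `Option α` and on countable partitions -/

section Measurability

variable {X α β ι : Type*} [MeasurableSpace X] [MeasurableSpace α] [MeasurableSpace β]

lemma measurableSet_option {s : Set (Option α)} :
    MeasurableSet s ↔ MeasurableSet ((some : α → Option α) ⁻¹' s) := Iff.rfl

lemma measurable_some : Measurable (some : α → Option α) := fun _ hs => hs

lemma measurable_of_option {f : Option α → β} (h : Measurable fun a => f (some a)) :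
    Measurable f := fun _ hs => h hs

instance [MeasurableSingletonClass α] : MeasurableSingletonClass (Option α) where
  measurableSet_singleton o := by
    rw [measurableSet_option]
    refine Set.Subsingleton.measurableSet fun a ha b hb => ?_
    exact Option.some_injective _ (ha.trans hb.symm)

lemma measurableSet_eq_none {f : X → Option α} (hf : Measurable f) :
    MeasurableSet {z | f z = none} := by
  refine hf (t := {none}) ?_
  rw [measurableSet_option]
  convert MeasurableSet.empty
  ext; simp

/-- Case analysis on a measurable `Option`-valued function is measurable. -/
lemma measurable_option_cases {f : X → Option α} (hf : Measurable f) {g₀ : X → β}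
    (h₀ : Measurable g₀) {g : X → α → β} (hg : Measurable fun q : X × α => g q.1 q.2) {F : X → β}
    (hnone : ∀ z, f z = none → F z = g₀ z) (hsome : ∀ z a, f z = some a → F z = g z a) :
    Measurable F := by
  rcases isEmpty_or_nonempty α with hα | ⟨⟨a₀⟩⟩
  · convert h₀ using 1
    funext z
    cases h : f z with
    | none => exact hnone z h
    | some a => exact hα.elim a
  · have hd : Measurable fun o : Option α => o.getD a₀ := measurable_of_option measurable_id
    classical
    have key : Measurable fun z => if f z = none then g₀ z else g z ((f z).getD a₀) :=
      Measurable.ite (measurableSet_eq_none hf) h₀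
        (hg.comp (measurable_id.prodMk (hd.comp hf)))
    convert key using 1
    funext z
    cases h : f z with
    | none => simpa using hnone z h
    | some a => simpa using hsome z a h

lemma measurable_of_countable_fibers [Countable ι] {g : X → ι}
    (hg : ∀ i, MeasurableSet {z | g z = i}) {F : ι → X → β} (hF : ∀ i, Measurable (F i)) :
    Measurable fun z => F (g z) z := by
  intro s hs
  have : (fun z => F (g z) z) ⁻¹' s = ⋃ i, {z | g z = i} ∩ F i ⁻¹' s := by
    ext z; simp
  rw [this]
  exact MeasurableSet.iUnion fun i => (hg i).inter (hF i hs)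

/-- Mixing a parametrised finite kernel over another one is measurable in the parameter. -/
lemma measurable_bind_param {κ : X → Measure α} (hκ : Measurable κ)
    (hκ1 : ∀ z, κ z Set.univ ≤ 1) {g : X × α → Measure β} (hg : Measurable g) :
    Measurable fun z => (κ z).bind fun a => g (z, a) := by
  refine Measure.measurable_of_measurable_coe _ fun s hs => ?_
  have h1 : ∀ z, ((κ z).bind fun a => g (z, a)) s = ∫⁻ a, g (z, a) s ∂κ z := fun z =>
    Measure.bind_apply hs (hg.comp measurable_prodMk_left).aemeasurable
  simp_rw [h1]
  let κ' : Kernel X α := ⟨κ, hκ⟩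
  have : IsFiniteKernel κ' := ⟨1, ENNReal.one_lt_top, hκ1⟩
  exact Measurable.lintegral_kernel_prod_right' (κ := κ') ((Measure.measurable_coe hs).comp hg)

lemma measurable_prod_param {κ : X → Measure α} (hκ : Measurable κ)
    (hκ1 : ∀ z, κ z Set.univ ≤ 1) {η : X → Measure β} (hη : Measurable η)
    (hη1 : ∀ z, η z Set.univ ≤ 1) : Measurable fun z => (κ z).prod (η z) := by
  let κ' : Kernel X α := ⟨κ, hκ⟩
  have : IsFiniteKernel κ' := ⟨1, ENNReal.one_lt_top, hκ1⟩
  let η' : Kernel X β := ⟨η, hη⟩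
  have : IsFiniteKernel η' := ⟨1, ENNReal.one_lt_top, hη1⟩
  have h : (fun z => (κ z).prod (η z)) = fun z => (κ' ×ₖ η') z := by
    ext1 z; rw [Kernel.prod_apply]; rfl
  rw [h]
  exact Kernel.measurable _

lemma measurable_lintegral_param {κ : X → Measure α} (hκ : Measurable κ)
    (hκ1 : ∀ z, κ z Set.univ ≤ 1) {f : X × α → ℝ≥0∞} (hf : Measurable f) :
    Measurable fun z => ∫⁻ a, f (z, a) ∂κ z := by
  let κ' : Kernel X α := ⟨κ, hκ⟩
  have : IsFiniteKernel κ' := ⟨1, ENNReal.one_lt_top, hκ1⟩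
  exact Measurable.lintegral_kernel_prod_right' (κ := κ') hf

lemma measurable_map_param {κ : X → Measure α} (hκ : Measurable κ)
    (hκ1 : ∀ z, κ z Set.univ ≤ 1) {f : X × α → β} (hf : Measurable f) :
    Measurable fun z => (κ z).map fun a => f (z, a) := by
  have h := measurable_bind_param hκ hκ1 (Measure.measurable_dirac.comp hf)
  convert h using 2 with z
  exact (Measure.bind_dirac_eq_map _ (hf.comp measurable_prodMk_left)).symm

lemma isFiniteMeasure_of_le_one {μ : Measure α} (h : μ Set.univ ≤ 1) : IsFiniteMeasure μ :=
  ⟨h.trans_lt ENNReal.one_lt_top⟩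

lemma bind_univ_le_one {μ : Measure α} (h : μ Set.univ ≤ 1) {g : α → Measure β}
    (hg : Measurable g) (hg1 : ∀ a, g a Set.univ ≤ 1) : μ.bind g Set.univ ≤ 1 := by
  rw [Measure.bind_apply MeasurableSet.univ hg.aemeasurable]
  calc ∫⁻ a, g a Set.univ ∂μ ≤ ∫⁻ _, 1 ∂μ := lintegral_mono hg1
    _ ≤ 1 := by simpa using h

lemma map_univ_le_one {μ : Measure α} (h : μ Set.univ ≤ 1) {f : α → β} (hf : Measurable f) :
    μ.map f Set.univ ≤ 1 := by
  rwa [Measure.map_apply hf MeasurableSet.univ, Set.preimage_univ]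

lemma prod_univ_le_one {μ : Measure α} (hμ : μ Set.univ ≤ 1) {ν : Measure β}
    (hν : ν Set.univ ≤ 1) : μ.prod ν Set.univ ≤ 1 := by
  have := isFiniteMeasure_of_le_one hν
  rw [← Set.univ_prod_univ, Measure.prod_prod]
  exact mul_le_one' hμ hν

end Measurability

/-! ### Partially grown trees with states -/

/-- A (partially grown) tree together with its (partially generated) states. -/
abbrev Config (D K : ℕ) := Tree D × States K

/-- What is generated at one node: its state, and its split unless it is not split. -/
abbrev Mark (D K : ℕ) := Fin K × Option (Fin D × I)

section Config

variable {D K : ℕ}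

/-- The part of a configuration below the child `b` of the root. -/
def csub (c : Config D K) (b : Bool) : Config D K := (sub c.1 b, sub c.2 b)

/-- The configuration with root mark `e` and given left and right parts. -/
def glue (e : Mark D K) (q : Config D K × Config D K) : Config D K :=
  (graft e.2 q.1.1 q.2.1, graft (some e.1) q.1.2 q.2.2)

/-- The configuration `c` after the mark `e` has been entered at the address `a`. -/
def upd (c : Config D K) (a : Addr) (e : Mark D K) : Config D K :=
  (Function.update c.1 a e.2, Function.update c.2 a (some e.1))

@[simp] lemma glue_fst_nil (e : Mark D K) (q : Config D K × Config D K) :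
    (glue e q).1 [] = e.2 := rfl

@[simp] lemma glue_snd_nil (e : Mark D K) (q : Config D K × Config D K) :
    (glue e q).2 [] = some e.1 := rfl

@[simp] lemma csub_upd_nil (c : Config D K) (e : Mark D K) (b : Bool) :
    csub (upd c [] e) b = csub c b := by
  ext <;> simp [csub, upd, sub]

@[simp] lemma csub_upd_cons_self (c : Config D K) (e : Mark D K) (b : Bool) (a : Addr) :
    csub (upd c (b :: a) e) b = upd (csub c b) a e := by
  refine Prod.ext ?_ ?_ <;> funext a' <;> simp [csub, upd, sub, Function.update_apply]

lemma csub_upd_cons_ne (c : Config D K) (e : Mark D K) {b b' : Bool} (h : b' ≠ b) (a : Addr) :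
    csub (upd c (b :: a) e) b' = csub c b' := by
  refine Prod.ext ?_ ?_ <;> funext a' <;> simp [csub, upd, sub, h]

lemma measurable_sub {α : Type*} [MeasurableSpace α] (b : Bool) :
    Measurable fun T : Addr → α => sub T b :=
  measurable_pi_lambda _ fun a => measurable_pi_apply (b :: a)

lemma measurable_graft {X α : Type*} [MeasurableSpace X] [MeasurableSpace α] {f : X → α}
    {g h : X → Addr → α} (hf : Measurable f) (hg : Measurable g) (hh : Measurable h) :
    Measurable fun z => graft (f z) (g z) (h z) := by
  refine measurable_pi_lambda _ fun a => ?_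
  match a with
  | [] => exact hf
  | false :: a => exact (measurable_pi_apply a).comp hg
  | true :: a => exact (measurable_pi_apply a).comp hh

lemma measurable_csub (b : Bool) : Measurable fun c : Config D K => csub c b :=
  ((measurable_sub b).comp measurable_fst).prodMk ((measurable_sub b).comp measurable_snd)

lemma measurable_glue :
    Measurable fun q : Mark D K × (Config D K × Config D K) => glue q.1 q.2 :=
  (measurable_graft (by fun_prop) (by fun_prop) (by fun_prop)).prodMk
    (measurable_graft (measurable_some.comp (by fun_prop)) (by fun_prop) (by fun_prop))

lemma measurable_glue_right (e : Mark D K) :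
    Measurable fun q : Config D K × Config D K => glue e q :=
  measurable_glue.comp measurable_prodMk_left

lemma measurable_upd (a : Addr) : Measurable fun q : Config D K × Mark D K => upd q.1 a q.2 := by
  refine (measurable_pi_lambda _ fun a' => ?_).prodMk (measurable_pi_lambda _ fun a' => ?_)
  · by_cases h : a' = a
    · subst h; simpa [upd] using measurable_snd.snd
    · simp only [Function.update_apply, h, if_false]
      exact (measurable_pi_apply a').comp measurable_fst.fst
  · by_cases h : a' = a
    · subst h
      simp only [Function.update_self]
      exact measurable_some.comp (measurable_fst.comp measurable_snd)
    · simp only [Function.update_apply, h, if_false]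
      exact (measurable_pi_apply a').comp measurable_fst.snd

lemma measurable_child (d : Fin D) (b : Bool) :
    Measurable fun q : Box D × I => child q.1 d q.2 b := by
  have h1 : Measurable fun q : Box D × I => q.1.1 d + (q.2 : ℝ) * (q.1.2 d - q.1.1 d) := by
    fun_prop
  cases b
  · refine measurable_fst.fst.prodMk (measurable_pi_lambda _ fun a' => ?_)
    by_cases h : a' = d
    · subst h; simpa using h1
    · simp only [Function.update_apply, h, if_false]; fun_prop
  · refine (measurable_pi_lambda _ fun a' => ?_).prodMk measurable_fst.snd
    by_cases h : a' = d
    · subst h; simpa using h1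
    · simp only [Function.update_apply, h, if_false]; fun_prop

lemma measurable_child' {X : Type*} [MeasurableSpace X] {f : X → Box D} {g : X → Fin D × I}
    (hf : Measurable f) (hg : Measurable g) (b : Bool) :
    Measurable fun z => child (f z) (g z).1 (g z).2 b := by
  refine measurable_of_countable_fibers (g := fun z => (g z).1)
    (F := fun d z => child (f z) d (g z).2 b)
    (fun d => measurable_fst.comp hg (measurableSet_singleton d)) fun d => ?_
  exact (measurable_child d b).comp (hf.prodMk (measurable_snd.comp hg))

lemma measurable_region (a : Addr) :
    Measurable fun q : Box D × Tree D => region q.1 q.2 a := by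
  induction a with
  | nil => exact measurable_fst
  | cons b a ih =>
    exact measurable_option_cases (f := fun q : Box D × Tree D => q.2 []) (by fun_prop)
      (g₀ := fun q => q.1) measurable_fst
      (g := fun q e => region (child q.1 e.1 e.2 b) (sub q.2 b) a)
      (ih.comp ((measurable_child' (by fun_prop) (by fun_prop) b).prodMk
        ((measurable_sub b).comp (by fun_prop))))
      (fun q h => by simp only [region, h]) (fun q e h => by simp only [region, h])

lemma measurableSet_isNode (a : Addr) : MeasurableSet {T : Tree D | IsNode T a} := by
  induction a with
  | nil => exact MeasurableSet.univ
  | cons b a ih =>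
    exact (measurableSet_eq_none (measurable_pi_apply [])).compl.inter (measurable_sub b ih)

lemma measurableSet_inBox (v : Fin D → ℝ) : MeasurableSet {A : Box D | InBox A v} := by
  simp only [InBox, Set.ofPred_forall]
  refine MeasurableSet.iInter fun k => ?_
  exact (measurableSet_lt (f := fun A : Box D => A.1 k) (by fun_prop) measurable_const).inter
    (measurableSet_le (g := fun A : Box D => A.2 k) measurable_const (by fun_prop))

open Classical in
lemma numTrain_eq_sum {n : ℕ} (x : Fin n → Fin D → ℝ) (A : Box D) :
    numTrain x A = ∑ i, if InBox A (x i) then 1 else 0 := by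
  rw [numTrain, Finset.card_filter]

lemma measurable_numTrain {n : ℕ} (x : Fin n → Fin D → ℝ) :
    Measurable fun A : Box D => numTrain x A := by
  classical
  simp only [numTrain_eq_sum]
  exact Finset.measurable_sum _ fun i _ =>
    Measurable.ite (measurableSet_inBox _) measurable_const measurable_const

end Config

/-! ### Composition of measures with measurable families -/

section BindLemmas

variable {α β γ : Type*} [MeasurableSpace α] [MeasurableSpace β] [MeasurableSpace γ]

lemma bind_prod {μ : Measure α} [SFinite μ] {f : α → Measure β} (hf : Measurable f)
    (hf1 : ∀ a, f a Set.univ ≤ 1) {ν : Measure γ} (hν : ν Set.univ ≤ 1) :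
    (μ.bind f).prod ν = μ.bind fun a => (f a).prod ν := by
  have := isFiniteMeasure_of_le_one hν
  have hm : Measurable fun a => (f a).prod ν :=
    measurable_prod_param hf hf1 measurable_const fun _ => hν
  refine Measure.ext_of_lintegral _ fun g hg => ?_
  rw [lintegral_prod _ hg.aemeasurable, Measure.lintegral_bind hf.aemeasurable
      (Measurable.lintegral_prod_right' hg).aemeasurable,
    Measure.lintegral_bind hm.aemeasurable hg.aemeasurable]
  refine lintegral_congr fun a => ?_
  have := isFiniteMeasure_of_le_one (hf1 a)
  rw [lintegral_prod _ hg.aemeasurable]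

lemma map_bind {μ : Measure α} {f : α → Measure β} (hf : Measurable f) {g : β → γ}
    (hg : Measurable g) : (μ.bind f).map g = μ.bind fun a => (f a).map g := by
  have h := Measure.bind_bind (m := μ) hf.aemeasurable
    (Measure.measurable_dirac.comp hg).aemeasurable
  simp only [Function.comp_def, Measure.bind_dirac_eq_map _ hg] at h
  exact h

lemma prod_bind {μ : Measure α} (hμ : μ Set.univ ≤ 1) {f : α → Measure β} (hf : Measurable f)
    (hf1 : ∀ a, f a Set.univ ≤ 1) {ν : Measure γ} (hν : ν Set.univ ≤ 1) :
    ν.prod (μ.bind f) = μ.bind fun a => ν.prod (f a) := by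
  have := isFiniteMeasure_of_le_one hν
  have := isFiniteMeasure_of_le_one hμ
  have := isFiniteMeasure_of_le_one (bind_univ_le_one hμ hf hf1)
  have hm : Measurable fun a => (f a).prod ν :=
    measurable_prod_param hf hf1 measurable_const fun _ => hν
  rw [← Measure.prod_swap, bind_prod hf hf1 hν, map_bind hm measurable_swap]
  congr 1
  funext a
  have := isFiniteMeasure_of_le_one (hf1 a)
  rw [Measure.prod_swap]

lemma ae_bind_of_ae_ae {μ : Measure α} {f : α → Measure β} (hf : AEMeasurable f μ) {p : β → Prop}
    (hp : MeasurableSet {b | p b}) (h : ∀ᵐ a ∂μ, ∀ᵐ b ∂f a, p b) : ∀ᵐ b ∂μ.bind f, p b := by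
  rw [ae_iff, ← Set.compl_ofPred, Measure.bind_apply hp.compl hf, lintegral_congr_ae (g := 0) ?_]
  · simp
  · filter_upwards [h] with a ha
    exact ae_iff.1 ha

end BindLemmas

/-! ### Completing a partially grown tree -/

section Fill

variable {D K : ℕ}

/-- The law of the mark of a node, depending on its depth, its parent's state and its box: a
measurable family of sub-probability measures. Total mass less than one is allowed because the
posterior step degenerates at nodes of zero or infinite marginal likelihood. -/
structure IsMarkLaw (q : ℕ → Fin K → Box D → Measure (Mark D K)) : Prop where
  measurable : ∀ j s, Measurable (q j s)
  le_one : ∀ j s A, q j s A Set.univ ≤ 1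

/-- The law of the root mark, which is kept if it has been generated already. -/
def rootMark (q : ℕ → Fin K → Box D → Measure (Mark D K)) (j : ℕ) (s : Fin K) (A : Box D)
    (c : Config D K) : Measure (Mark D K) :=
  match c.2 [] with
  | none => q j s A
  | some s' => Measure.dirac (s', c.1 [])

/-- The law of a configuration with root mark `e`, when the two parts below the root are
independent with laws given by `F`, which may depend on the parts of `c`. -/
def after (F : ℕ → Fin K → Box D → Config D K → Measure (Config D K)) (j : ℕ) (A : Box D)
    (c : Config D K) (e : Mark D K) : Measure (Config D K) :=
  match e.2 with
  | none => Measure.dirac (glue e ((blank, blank), (blank, blank)))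
  | some r => ((F (j + 1) e.1 (child A r.1 r.2 false) (csub c false)).prod
      (F (j + 1) e.1 (child A r.1 r.2 true) (csub c true))).map (glue e)

/-- The law of the full configuration obtained from the partially grown configuration `c` with root
box `A` at depth `j` and parent state `s`, when marks already present are kept and the missing ones
are drawn from `q` from the top down, independently in disjoint subtrees. The first argument bounds
the number of levels of nodes. At `c = (blank, blank)` this is the law of the whole branching
process. -/
def fill (q : ℕ → Fin K → Box D → Measure (Mark D K)) :
    ℕ → ℕ → Fin K → Box D → Config D K → Measure (Config D K)
  | 0, _, _, _, _ => Measure.dirac (blank, blank)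
  | k + 1, j, s, A, c => (rootMark q j s A c).bind (after (fill q k) j A c)

variable {q : ℕ → Fin K → Box D → Measure (Mark D K)}

lemma IsMarkLaw.measurable_rootMark (hq : IsMarkLaw q) (j : ℕ) (s : Fin K) :
    Measurable fun z : Box D × Config D K => rootMark q j s z.1 z.2 :=
  measurable_option_cases (f := fun z : Box D × Config D K => z.2.2 [])
    ((measurable_pi_apply []).comp measurable_snd.snd) ((hq.measurable j s).comp measurable_fst)
    (g := fun z s' => Measure.dirac (s', z.2.1 []))
    (Measure.measurable_dirac.comp (measurable_snd.prodMk
      ((measurable_pi_apply []).comp measurable_fst.snd.fst)))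
    (fun z h => by simp only [rootMark, h, Function.comp])
    (fun z s' h => by simp only [rootMark, h])

lemma IsMarkLaw.rootMark_le_one (hq : IsMarkLaw q) (j : ℕ) (s : Fin K) (A : Box D)
    (c : Config D K) : rootMark q j s A c Set.univ ≤ 1 := by
  unfold rootMark
  split
  · exact hq.le_one j s A
  · simp

lemma after_le_one {F : ℕ → Fin K → Box D → Config D K → Measure (Config D K)}
    (hF : ∀ j s A c, F j s A c Set.univ ≤ 1) (j : ℕ) (A : Box D) (c : Config D K)
    (e : Mark D K) : after F j A c e Set.univ ≤ 1 := by
  unfold after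
  split
  · simp
  · exact map_univ_le_one (prod_univ_le_one (hF _ _ _ _) (hF _ _ _ _)) (measurable_glue_right e)

lemma measurable_after {F : ℕ → Fin K → Box D → Config D K → Measure (Config D K)}
    (hF : ∀ j s A c, F j s A c Set.univ ≤ 1)
    (hFm : ∀ j s, Measurable fun z : Box D × Config D K => F j s z.1 z.2) (j : ℕ) :
    Measurable fun z : (Box D × Config D K) × Mark D K => after F j z.1.1 z.1.2 z.2 := by
  refine measurable_of_countable_fibers
    (g := fun z : (Box D × Config D K) × Mark D K => z.2.1)
    (F := fun s' z => after (fun j _ => F j s') j z.1.1 z.1.2 z.2)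
    (fun s' => measurable_snd.fst (measurableSet_singleton s')) fun s' => ?_
  refine measurable_option_cases (f := fun z : (Box D × Config D K) × Mark D K => z.2.2)
    measurable_snd.snd
    (Measure.measurable_dirac.comp (measurable_glue.comp (measurable_snd.prodMk
      (measurable_const (a := ((blank, blank), (blank, blank)))))))
    (g := fun z r => ((F (j + 1) s' (child z.1.1 r.1 r.2 false) (csub z.1.2 false)).prod
        (F (j + 1) s' (child z.1.1 r.1 r.2 true) (csub z.1.2 true))).map (glue z.2)) ?_
    (fun z h => by simp only [after, h, Function.comp]) (fun z r h => by simp only [after, h])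
  have hb : ∀ b, Measurable fun z : ((Box D × Config D K) × Mark D K) × (Fin D × I) =>
      F (j + 1) s' (child z.1.1.1 z.2.1 z.2.2 b) (csub z.1.1.2 b) := fun b =>
    (hFm (j + 1) s').comp ((measurable_child' (by fun_prop) (by fun_prop) b).prodMk
      ((measurable_csub b).comp (by fun_prop)))
  refine measurable_map_param (f := fun w : (((Box D × Config D K) × Mark D K) × (Fin D × I)) ×
      (Config D K × Config D K) => glue w.1.1.2 w.2)
    (measurable_prod_param (hb false) (fun _ => hF _ _ _ _) (hb true) fun _ => hF _ _ _ _)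
    (fun _ => prod_univ_le_one (hF _ _ _ _) (hF _ _ _ _))
    (measurable_glue.comp (measurable_fst.fst.snd.prodMk measurable_snd))

lemma IsMarkLaw.fill_aux (hq : IsMarkLaw q) (k : ℕ) :
    (∀ j s A c, fill q k j s A c Set.univ ≤ 1) ∧
      ∀ j s, Measurable fun z : Box D × Config D K => fill q k j s z.1 z.2 := by
  induction k with
  | zero => exact ⟨fun _ _ _ _ => by simp [fill], fun _ _ => measurable_const⟩
  | succ k ih =>
    have hm := fun j => measurable_after ih.1 ih.2 j
    refine ⟨fun j s A c => ?_, fun j s => ?_⟩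
    · rw [fill]
      exact bind_univ_le_one (hq.rootMark_le_one j s A c)
        ((hm j).comp (measurable_prodMk_left (x := (A, c)))) (after_le_one ih.1 j A c)
    · simp only [fill]
      exact measurable_bind_param (κ := fun z : Box D × Config D K => rootMark q j s z.1 z.2)
        (hq.measurable_rootMark j s) (fun z => hq.rootMark_le_one j s z.1 z.2)
        (g := fun z => after (fill q k) j z.1.1 z.1.2 z.2) (hm j)

lemma IsMarkLaw.fill_le_one (hq : IsMarkLaw q) (k j : ℕ) (s : Fin K) (A : Box D)
    (c : Config D K) : fill q k j s A c Set.univ ≤ 1 := (hq.fill_aux k).1 j s A c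

lemma IsMarkLaw.isFiniteMeasure_fill (hq : IsMarkLaw q) (k j : ℕ) (s : Fin K) (A : Box D)
    (c : Config D K) : IsFiniteMeasure (fill q k j s A c) :=
  isFiniteMeasure_of_le_one (hq.fill_le_one k j s A c)

lemma IsMarkLaw.measurable_fill (hq : IsMarkLaw q) (k j : ℕ) (s : Fin K) :
    Measurable fun z : Box D × Config D K => fill q k j s z.1 z.2 := (hq.fill_aux k).2 j s

lemma IsMarkLaw.measurable_after_fill (hq : IsMarkLaw q) (k j : ℕ) (A : Box D) (c : Config D K) :
    Measurable (after (fill q k) j A c) :=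
  (measurable_after (hq.fill_aux k).1 (hq.fill_aux k).2 j).comp
    (measurable_prodMk_left (x := (A, c)))

lemma IsMarkLaw.fill_succ_of_some (hq : IsMarkLaw q) (k j : ℕ) (s : Fin K) (A : Box D)
    {c : Config D K} {s' : Fin K} (h : c.2 [] = some s') :
    fill q (k + 1) j s A c = after (fill q k) j A c (s', c.1 []) := by
  rw [fill, rootMark, h]
  exact Measure.dirac_bind (hq.measurable_after_fill k j A c) _

lemma IsMarkLaw.lintegral_fill_blank (hq : IsMarkLaw q) (k j : ℕ) (s : Fin K) (A : Box D)
    {f : Config D K → ℝ≥0∞} (hf : Measurable f) :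
    ∫⁻ c, f c ∂fill q (k + 1) j s A (blank, blank) =
      ∫⁻ e, ∫⁻ c, f c ∂after (fill q k) j A (blank, blank) e ∂q j s A := by
  rw [fill, Measure.lintegral_bind (hq.measurable_after_fill k j A _).aemeasurable hf.aemeasurable]
  rfl

lemma IsMarkLaw.lintegral_after_some (hq : IsMarkLaw q) (k j : ℕ) (A : Box D) (c : Config D K)
    (s' : Fin K) (d : Fin D) (l : I) {f : Config D K → ℝ≥0∞} (hf : Measurable f) :
    ∫⁻ c', f c' ∂after (fill q k) j A c (s', some (d, l)) =
      ∫⁻ cl, ∫⁻ cr, f (glue (s', some (d, l)) (cl, cr))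
        ∂fill q k (j + 1) s' (child A d l true) (csub c true)
        ∂fill q k (j + 1) s' (child A d l false) (csub c false) := by
  have := hq.isFiniteMeasure_fill k (j + 1) s' (child A d l true) (csub c true)
  have hg := hf.comp (measurable_glue_right (D := D) (K := K) (s', some (d, l)))
  rw [after, lintegral_map hf (measurable_glue_right _)]
  exact lintegral_prod _ hg.aemeasurable

lemma lintegral_after_none (F : ℕ → Fin K → Box D → Config D K → Measure (Config D K))
    (j : ℕ) (A : Box D) (c : Config D K) (s' : Fin K) {f : Config D K → ℝ≥0∞}
    (hf : Measurable f) :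
    ∫⁻ c', f c' ∂after F j A c (s', none) =
      f (glue (s', none) ((blank, blank), (blank, blank))) := by
  rw [after, lintegral_dirac' _ hf]

/-- The state of the parent of `a` when the parent of the root has state `s`. -/
def pstate (s : Fin K) (S : States K) : Addr → Fin K
  | [] => s
  | b :: a => pstate ((S []).getD s) (sub S b) a

/-- The law of the mark at the address `a` of the configuration `c`. -/
def nodeMark (q : ℕ → Fin K → Box D → Measure (Mark D K)) (j : ℕ) (s : Fin K) (A : Box D)
    (c : Config D K) (a : Addr) : Measure (Mark D K) :=
  q (j + a.length) (pstate s c.2 a) (region A c.1 a)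

lemma nodeMark_cons {j : ℕ} {s s' : Fin K} {A : Box D} {c : Config D K} {b : Bool} {a : Addr}
    {d : Fin D} {l : I} (h1 : c.1 [] = some (d, l)) (h2 : c.2 [] = some s') :
    nodeMark q j s A c (b :: a) = nodeMark q (j + 1) s' (child A d l b) (csub c b) a := by
  simp only [nodeMark, pstate, region, h1, h2, List.length_cons, csub, Option.getD_some]
  congr 1
  ring

/-- Completing `c` amounts to drawing the mark of any one pending node and completing the result:
the branching property behind the freedom to choose the order of generation. -/
lemma IsMarkLaw.fill_step (hq : IsMarkLaw q) {k j : ℕ} {s : Fin K} {A : Box D} {c : Config D K}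
    {a : Addr} (ha : IsNode c.1 a) (ha' : c.2 a = none)
    (hc : ∀ a', c.1 a' ≠ none → c.2 a' ≠ none) (hk : a.length < k) :
    fill q k j s A c =
      (nodeMark q j s A c a).bind fun e => fill q k j s A (upd c a e) := by
  induction a generalizing k j s A c with
  | nil =>
    obtain ⟨k, rfl⟩ : ∃ k', k = k' + 1 := ⟨k - 1, by simp at hk; omega⟩
    rw [fill, rootMark, ha']
    simp only [nodeMark, List.length_nil, Nat.add_zero, pstate, region]
    congr 1
    funext e
    rw [hq.fill_succ_of_some k j s A (c := upd c [] e) (s' := e.1) (by simp [upd])]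
    simp only [after, csub_upd_nil]
    rfl
  | cons b a ih =>
    obtain ⟨k, rfl⟩ : ∃ k', k = k' + 1 := ⟨k - 1, by simp at hk; omega⟩
    obtain ⟨h1, ha⟩ := ha
    obtain ⟨s', h2⟩ := Option.ne_none_iff_exists'.1 (hc [] h1)
    obtain ⟨⟨d, l⟩, h1⟩ := Option.ne_none_iff_exists'.1 h1
    have hstep := ih (c := csub c b) (k := k) (j := j + 1) (s := s') (A := child A d l b) ha ha'
      (fun a' => hc (b :: a')) (by simpa using hk)
    have hroot : ∀ e, fill q (k + 1) j s A (upd c (b :: a) e) =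
        after (fill q k) j A (upd c (b :: a) e) (s', some (d, l)) := fun e => by
      rw [hq.fill_succ_of_some k j s A (c := upd c (b :: a) e) (s' := s') (by simpa [upd] using h2)]
      simp [upd, h1]
    simp_rw [hroot, hq.fill_succ_of_some k j s A h2, h1, nodeMark_cons (q := q) h1 h2]
    have hN : nodeMark q (j + 1) s' (child A d l b) (csub c b) a Set.univ ≤ 1 := hq.le_one _ _ _
    have := isFiniteMeasure_of_le_one hN
    have hm : Measurable fun e => fill q k (j + 1) s' (child A d l b) (upd (csub c b) a e) :=
      (hq.measurable_fill k (j + 1) s').comp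
        (measurable_const.prodMk ((measurable_upd a).comp measurable_prodMk_left))
    have hg := measurable_glue_right (D := D) (K := K) (s', some (d, l))
    cases b
    · simp only [after, csub_upd_cons_self, csub_upd_cons_ne c _ (show true ≠ false by simp) a]
      rw [hstep, bind_prod hm (fun _ => hq.fill_le_one _ _ _ _ _) (hq.fill_le_one _ _ _ _ _),
        map_bind (measurable_prod_param hm (fun _ => hq.fill_le_one _ _ _ _ _) measurable_const
          fun _ => hq.fill_le_one _ _ _ _ _) hg]
    · simp only [after, csub_upd_cons_self, csub_upd_cons_ne c _ (show false ≠ true by simp) a]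
      rw [hstep, prod_bind hN hm (fun _ => hq.fill_le_one _ _ _ _ _) (hq.fill_le_one _ _ _ _ _),
        map_bind (measurable_prod_param measurable_const (fun _ => hq.fill_le_one _ _ _ _ _) hm
          fun _ => hq.fill_le_one _ _ _ _ _) hg]

lemma measurableSet_marks_eq (a : Addr) (o : Option (Fin D × I)) (t : Option (Fin K)) :
    MeasurableSet {c : Config D K | c.1 a = o ∧ c.2 a = t} := by
  have h1 : Measurable fun c : Config D K => c.1 a := (measurable_pi_apply a).comp measurable_fst
  have h2 : Measurable fun c : Config D K => c.2 a := (measurable_pi_apply a).comp measurable_snd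
  exact (h1 (measurableSet_singleton o)).inter (h2 (measurableSet_singleton t))

/-- Marks that are already present survive completion. -/
lemma IsMarkLaw.ae_fill_eq (hq : IsMarkLaw q) {k j : ℕ} {s : Fin K} {A : Box D} {c : Config D K}
    {a : Addr} (ha : IsNode c.1 a) (ha' : c.2 a ≠ none)
    (hc : ∀ a', c.1 a' ≠ none → c.2 a' ≠ none) (hk : a.length < k) :
    ∀ᵐ c' ∂fill q k j s A c, c'.1 a = c.1 a ∧ c'.2 a = c.2 a := by
  induction a generalizing k j s A c with
  | nil =>
    obtain ⟨k, rfl⟩ : ∃ k', k = k' + 1 := ⟨k - 1, by simp at hk; omega⟩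
    obtain ⟨s', h2⟩ := Option.ne_none_iff_exists'.1 ha'
    rw [hq.fill_succ_of_some k j s A h2, h2, after]
    split
    · rw [ae_dirac_iff (measurableSet_marks_eq _ _ _)]
      exact ⟨rfl, rfl⟩
    · rw [ae_map_iff (measurable_glue_right _).aemeasurable (measurableSet_marks_eq _ _ _)]
      exact ae_of_all _ fun _ => ⟨rfl, rfl⟩
  | cons b a ih =>
    obtain ⟨k, rfl⟩ : ∃ k', k = k' + 1 := ⟨k - 1, by simp at hk; omega⟩
    obtain ⟨h1, ha⟩ := ha
    obtain ⟨s', h2⟩ := Option.ne_none_iff_exists'.1 (hc [] h1)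
    obtain ⟨⟨d, l⟩, h1⟩ := Option.ne_none_iff_exists'.1 h1
    have hstep := ih (c := csub c b) (k := k) (j := j + 1) (s := s') (A := child A d l b) ha ha'
      (fun a' => hc (b :: a')) (by simpa using hk)
    have := fun b => hq.isFiniteMeasure_fill k (j + 1) s' (child A d l b) (csub c b)
    rw [hq.fill_succ_of_some k j s A h2, h1, after,
      ae_map_iff (measurable_glue_right _).aemeasurable (measurableSet_marks_eq _ _ _)]
    cases b
    · filter_upwards [Measure.quasiMeasurePreserving_fst.ae hstep] with p hp using hp
    · filter_upwards [Measure.quasiMeasurePreserving_snd.ae hstep] with p hp using hp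

end Fill

/-! ### Sequential generation in an arbitrary order -/

section Sequential

variable {D K : ℕ}

/-- A configuration in which only nodes with a state are split and only addresses of length less
than `k` carry a state. -/
def Valid (k : ℕ) (c : Config D K) : Prop :=
  ∀ a, (c.1 a ≠ none → c.2 a ≠ none) ∧ (c.2 a ≠ none → a.length < k)

lemma measurable_tree_apply (a : Addr) : Measurable fun c : Config D K => c.1 a :=
  (measurable_pi_apply a).comp measurable_fst

lemma measurable_state_apply (a : Addr) : Measurable fun c : Config D K => c.2 a :=
  (measurable_pi_apply a).comp measurable_snd

lemma measurableSet_valid (k : ℕ) : MeasurableSet {c : Config D K | Valid k c} := by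
  simp only [Valid, Set.ofPred_forall]
  refine MeasurableSet.iInter fun a => ?_
  have h1 := measurableSet_eq_none (measurable_tree_apply (D := D) (K := K) a)
  have h2 := measurableSet_eq_none (measurable_state_apply (D := D) (K := K) a)
  have h3 : MeasurableSet {c : Config D K | c.1 a ≠ none → c.2 a ≠ none} := by
    convert h1.union h2.compl using 1
    ext c; simp [imp_iff_or_not]; tauto
  have h4 : MeasurableSet {c : Config D K | c.2 a ≠ none → a.length < k} := by
    convert h2.union (MeasurableSet.const (a.length < k)) using 1
    ext c; simp; tauto
  exact h3.inter h4

lemma isNode_mono {T T' : Tree D} (h : ∀ a, T a ≠ none → T' a ≠ none) {a : Addr}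
    (ha : IsNode T a) : IsNode T' a := by
  induction a generalizing T T' with
  | nil => trivial
  | cons b a ih => exact ⟨h [] ha.1, ih (fun a' => h (b :: a')) ha.2⟩

lemma isNode_dropLast {T : Tree D} {a : Addr} (ha : IsNode T a) (hne : a ≠ []) :
    T a.dropLast ≠ none := by
  induction a generalizing T with
  | nil => exact absurd rfl hne
  | cons b a ih =>
    cases a with
    | nil => exact ha.1
    | cons b' a => exact ih ha.2 (by simp)

/-- When states are generated only at depths less than `k`, all nodes lie at depth at most `k`. -/
lemma Valid.length_le {k : ℕ} {c : Config D K} (hc : Valid k c) {a : Addr} (ha : IsNode c.1 a) :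
    a.length ≤ k := by
  rcases eq_or_ne a [] with rfl | hne
  · simp
  · have h := (hc a.dropLast).2 ((hc _).1 (isNode_dropLast ha hne))
    have : 0 < a.length := List.length_pos_iff.2 hne
    rw [List.length_dropLast] at h
    omega

lemma pstate_eq_parentState {c : Config D K} (hc : ∀ a, c.1 a ≠ none → c.2 a ≠ none)
    (s : Fin K) {a : Addr} (ha : IsNode c.1 a) : pstate s c.2 a = parentState s c.2 a := by
  induction a generalizing c s with
  | nil => rfl
  | cons b a ih =>
    have hr := ih (c := csub c b) (fun a' => hc (b :: a')) ((c.2 []).getD s) ha.2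
    rw [pstate]
    refine hr.trans ?_
    cases a with
    | nil => rfl
    | cons b' a =>
      obtain ⟨t, ht⟩ := Option.ne_none_iff_exists'.1 (hc _ (isNode_dropLast ha (by simp)))
      have ht' : (csub c b).2 (b' :: a).dropLast = some t := by
        simpa [csub, sub, List.dropLast] using ht
      simp only [parentState, reduceCtorEq, if_false, ht, ht', Option.getD_some]

variable {q : ℕ → Fin K → Box D → Measure (Mark D K)} {next : Config D K → Option Addr}

/-- One step of sequential generation with node mark laws `q`. -/
def markStep (q : ℕ → Fin K → Box D → Measure (Mark D K)) (s₀ : Fin K) (Om : Box D)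
    (next : Config D K → Option Addr) (c : Config D K) : Measure (Config D K) :=
  match next c with
  | none => Measure.dirac c
  | some a => (nodeMark q 0 s₀ Om c a).map (upd c a)

/-- The partially grown configuration `c'`, with the selected mark of `c` added to it. -/
def revealStep (next : Config D K → Option Addr) (c' c : Config D K) : Config D K :=
  match next c' with
  | none => c'
  | some a => (Function.update c'.1 a (c.1 a), Function.update c'.2 a (c.2 a))

lemma reveal_succ (c : Config D K) (k : ℕ) :
    reveal next c (k + 1) = revealStep next (reveal next c k) c := rfl

lemma measurable_update_apply {X α : Type*} [MeasurableSpace X] [MeasurableSpace α]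
    {f g : X → Addr → α} (hf : Measurable f) (hg : Measurable g) (a : Addr) :
    Measurable fun z => Function.update (f z) a (g z a) := by
  refine measurable_pi_lambda _ fun a' => ?_
  by_cases h : a' = a
  · subst h
    simpa [Function.comp_def] using (measurable_pi_apply a').comp hg
  · simpa [Function.update_apply, h, Function.comp_def] using (measurable_pi_apply a').comp hf

lemma measurable_revealStep (hnext : IsSchedule next) :
    Measurable fun z : Config D K × Config D K => revealStep next z.1 z.2 := by
  refine measurable_of_countable_fibers (g := fun z : Config D K × Config D K => next z.1)
    (F := fun o z => revealStep (fun _ => o) z.1 z.2)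
    (fun o => measurable_fst (hnext.measurable o)) fun o => ?_
  cases o with
  | none => exact measurable_fst
  | some a =>
    exact (measurable_update_apply measurable_fst.fst measurable_snd.fst a).prodMk
      (measurable_update_apply measurable_fst.snd measurable_snd.snd a)

lemma measurable_reveal (hnext : IsSchedule next) (k : ℕ) :
    Measurable fun c : Config D K => reveal next c k := by
  induction k with
  | zero => exact measurable_const
  | succ k ih => exact (measurable_revealStep hnext).comp (ih.prodMk measurable_id)

lemma measurable_pstate (s : Fin K) (a : Addr) : Measurable fun S : States K => pstate s S a := by
  induction a generalizing s with
  | nil => exact measurable_const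
  | cons b a ih =>
    refine measurable_of_countable_fibers (g := fun S : States K => (S []).getD s)
      (F := fun s' S => pstate s' (sub S b) a) (fun s' => ?_)
      fun s' => (ih s').comp (measurable_sub b)
    have h : Measurable fun S : States K => (S []).getD s :=
      (measurable_of_option (f := fun o => o.getD s) measurable_id).comp (measurable_pi_apply [])
    exact h (measurableSet_singleton s')

lemma IsMarkLaw.measurable_nodeMark (hq : IsMarkLaw q) (j : ℕ) (s : Fin K) (A : Box D)
    (a : Addr) : Measurable fun c : Config D K => nodeMark q j s A c a := by
  refine measurable_of_countable_fibers (g := fun c : Config D K => pstate s c.2 a)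
    (F := fun s' c => q (j + a.length) s' (region A c.1 a))
    (fun s' => ((measurable_pstate s a).comp measurable_snd) (measurableSet_singleton s'))
    fun s' => ?_
  exact (hq.measurable _ s').comp
    ((measurable_region a).comp (measurable_const.prodMk measurable_fst))

lemma IsMarkLaw.measurable_markStep (hq : IsMarkLaw q) (s₀ : Fin K) (Om : Box D)
    (hnext : IsSchedule next) : Measurable (markStep q s₀ Om next) := by
  refine measurable_of_countable_fibers (g := next)
    (F := fun o => markStep q s₀ Om (fun _ => o)) hnext.measurable fun o => ?_
  cases o with
  | none => exact Measure.measurable_dirac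
  | some a =>
    exact measurable_map_param (hq.measurable_nodeMark 0 s₀ Om a) (fun c => hq.le_one _ _ _)
      (f := fun z => upd z.1 a z.2) (measurable_upd a)

lemma IsMarkLaw.markStep_le_one (hq : IsMarkLaw q) (s₀ : Fin K) (Om : Box D) (c : Config D K) :
    markStep q s₀ Om next c Set.univ ≤ 1 := by
  unfold markStep
  split
  · simp
  · exact map_univ_le_one (hq.le_one _ _ _) ((measurable_upd _).comp measurable_prodMk_left)

lemma valid_upd {k : ℕ} {c : Config D K} (hc : Valid k c) {a : Addr} (ha : IsNode c.1 a)
    (e : Mark D K) : Valid (k + 1) (upd c a e) := by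
  intro a'
  by_cases h : a' = a
  · subst h
    exact ⟨fun _ => by simp [upd], fun _ => Nat.lt_succ_of_le (hc.length_le ha)⟩
  · simp only [upd, Function.update_apply, h, if_false]
    exact ⟨(hc a').1, fun h' => Nat.lt_succ_of_lt ((hc a').2 h')⟩

lemma ae_valid_markStep (s₀ : Fin K) (Om : Box D)
    (hnext : IsSchedule next) {k : ℕ} {c : Config D K} (hc : Valid k c) :
    ∀ᵐ c' ∂markStep q s₀ Om next c, Valid (k + 1) c' := by
  unfold markStep
  split
  · rw [ae_dirac_iff (measurableSet_valid _)]
    exact fun a => ⟨(hc a).1, fun h => Nat.lt_succ_of_lt ((hc a).2 h)⟩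
  · rename_i a ha
    have hu : Measurable (upd c a) := (measurable_upd a).comp measurable_prodMk_left
    rw [ae_map_iff hu.aemeasurable (measurableSet_valid _)]
    exact ae_of_all _ fun e => valid_upd hc (hnext.pending _ _ ha).1 e

lemma IsMarkLaw.ae_valid_growLaw (hq : IsMarkLaw q) (s₀ : Fin K) (Om : Box D)
    (hnext : IsSchedule next) (k : ℕ) :
    ∀ᵐ c ∂growLaw (markStep q s₀ Om next) k, Valid k c := by
  induction k with
  | zero =>
    rw [growLaw, ae_dirac_iff (measurableSet_valid _)]
    exact fun a => ⟨fun h => absurd rfl h, fun h => absurd rfl h⟩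
  | succ k ih =>
    refine ae_bind_of_ae_ae (hq.measurable_markStep s₀ Om hnext).aemeasurable
      (measurableSet_valid _) ?_
    filter_upwards [ih] with c hc using ae_valid_markStep s₀ Om hnext hc

lemma IsMarkLaw.growLaw_le_one (hq : IsMarkLaw q) (s₀ : Fin K) (Om : Box D)
    (hnext : IsSchedule next) (k : ℕ) : growLaw (markStep q s₀ Om next) k Set.univ ≤ 1 := by
  induction k with
  | zero => simp [growLaw]
  | succ k ih =>
    exact bind_univ_le_one ih (hq.measurable_markStep s₀ Om hnext) (hq.markStep_le_one s₀ Om)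

lemma IsMarkLaw.measurable_fill_config (hq : IsMarkLaw q) (k j : ℕ) (s : Fin K) (A : Box D) :
    Measurable (fill q k j s A) :=
  (hq.measurable_fill k j s).comp (measurable_prodMk_left (x := A))

/-- Revealing the selected mark of a random completion of `c` is the same as drawing this mark
by one step of sequential generation and completing the result afterwards. -/
lemma IsMarkLaw.lintegral_fill_revealStep (hq : IsMarkLaw q) (s₀ : Fin K) (Om : Box D)
    (hnext : IsSchedule next) {k N : ℕ} (hk : k < N) {c : Config D K} (hc : Valid k c)
    {f : Config D K × Config D K → ℝ≥0∞} (hf : Measurable f) :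
    ∫⁻ c', f (revealStep next c c', c') ∂fill q N 0 s₀ Om c =
      ∫⁻ c'', ∫⁻ c', f (c'', c') ∂fill q N 0 s₀ Om c'' ∂markStep q s₀ Om next c := by
  have hR : Measurable fun c' => f (revealStep next c c', c') :=
    hf.comp (((measurable_revealStep hnext).comp measurable_prodMk_left).prodMk measurable_id)
  have hI : Measurable fun c'' => ∫⁻ c', f (c'', c') ∂fill q N 0 s₀ Om c'' :=
    measurable_lintegral_param (hq.measurable_fill_config N 0 s₀ Om)
      (fun _ => hq.fill_le_one _ _ _ _ _) hf
  cases h : next c with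
  | none => simp only [revealStep, markStep, h, lintegral_dirac' _ hI]
  | some a =>
    have hu : Measurable (upd c a) := (measurable_upd a).comp measurable_prodMk_left
    obtain ⟨hnode, hnone⟩ := hnext.pending _ _ h
    have hlen : a.length < N := (hc.length_le hnode).trans_lt hk
    have hFu : Measurable fun e => fill q N 0 s₀ Om (upd c a e) :=
      (hq.measurable_fill_config N 0 s₀ Om).comp hu
    rw [hq.fill_step hnode hnone (fun a' => (hc a').1) hlen,
      Measure.lintegral_bind hFu.aemeasurable hR.aemeasurable]
    simp only [markStep, h]
    rw [lintegral_map hI hu]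
    refine lintegral_congr fun e => lintegral_congr_ae ?_
    have hkeep := hq.ae_fill_eq (k := N) (j := 0) (s := s₀) (A := Om) (c := upd c a e) (a := a)
      (isNode_mono (fun a' h' => ?_) hnode) (by simp [upd])
      (fun a' => (valid_upd hc hnode e a').1) hlen
    · filter_upwards [hkeep] with c' hc'
      have : revealStep next c c' = upd c a e := by
        simp only [revealStep, h, hc'.1, hc'.2]
        simp [upd]
      rw [this]
    · have : a' ≠ a := fun h2 => (hc a).1 (h2 ▸ h') hnone
      simpa [upd, this] using h'

/-- The joint law of what is revealed after `k` steps and the full configuration: the former has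
the law of sequential generation, and the latter is its random completion. -/
lemma IsMarkLaw.lintegral_reveal (hq : IsMarkLaw q) (s₀ : Fin K) (Om : Box D)
    (hnext : IsSchedule next) {k N : ℕ} (hk : k ≤ N)
    {f : Config D K × Config D K → ℝ≥0∞} (hf : Measurable f) :
    ∫⁻ c, f (reveal next c k, c) ∂fill q N 0 s₀ Om (blank, blank) =
      ∫⁻ c', ∫⁻ c, f (c', c) ∂fill q N 0 s₀ Om c' ∂growLaw (markStep q s₀ Om next) k := by
  have hI : ∀ {f : Config D K × Config D K → ℝ≥0∞}, Measurable f →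
      Measurable fun c'' => ∫⁻ c', f (c'', c') ∂fill q N 0 s₀ Om c'' := fun hf =>
    measurable_lintegral_param (hq.measurable_fill_config N 0 s₀ Om)
      (fun _ => hq.fill_le_one _ _ _ _ _) hf
  induction k generalizing f with
  | zero => rw [growLaw, lintegral_dirac' _ (hI hf)]; rfl
  | succ k ih =>
    have hf' : Measurable fun z : Config D K × Config D K => f (revealStep next z.1 z.2, z.2) :=
      hf.comp ((measurable_revealStep hnext).prodMk measurable_snd)
    simp only [reveal_succ]
    rw [ih (by omega) hf', growLaw,
      Measure.lintegral_bind (hq.measurable_markStep s₀ Om hnext).aemeasurable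
        (hI hf).aemeasurable]
    refine lintegral_congr_ae ?_
    filter_upwards [hq.ae_valid_growLaw s₀ Om hnext k] with c hc
    exact hq.lintegral_fill_revealStep s₀ Om hnext (by omega) hc hf

/-- Completions are proper probability measures almost surely, although mark laws may have total
mass less than one: no mass is missing in the end. -/
lemma IsMarkLaw.ae_fill_univ (hq : IsMarkLaw q) (s₀ : Fin K) (Om : Box D)
    (hnext : IsSchedule next) {k N : ℕ} (hk : k ≤ N)
    (hone : fill q N 0 s₀ Om (blank, blank) Set.univ = 1) :
    ∀ᵐ c ∂growLaw (markStep q s₀ Om next) k, fill q N 0 s₀ Om c Set.univ = 1 := by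
  have h := hq.lintegral_reveal s₀ Om hnext hk (f := fun _ => 1) measurable_const
  simp only [lintegral_one, hone] at h
  have hG := hq.growLaw_le_one s₀ Om hnext k
  have := isFiniteMeasure_of_le_one hG
  have hm : Measurable fun c => fill q N 0 s₀ Om c Set.univ :=
    (Measure.measurable_coe MeasurableSet.univ).comp (hq.measurable_fill_config N 0 s₀ Om)
  have hsub : ∫⁻ c, (1 - fill q N 0 s₀ Om c Set.univ) ∂growLaw (markStep q s₀ Om next) k = 0 := by
    rw [lintegral_sub hm (by rw [← h]; simp) (ae_of_all _ fun _ => hq.fill_le_one _ _ _ _ _), ← h,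
      lintegral_one]
    exact tsub_eq_zero_of_le hG
  have hm' : Measurable fun c => 1 - fill q N 0 s₀ Om c Set.univ := measurable_const.sub hm
  rw [lintegral_eq_zero_iff hm'] at hsub
  filter_upwards [hsub] with c hc
  exact le_antisymm (hq.fill_le_one _ _ _ _ _) (tsub_eq_zero_iff_le.1 hc)

/-- The law of the mark of a node whose state has law `qS` and which, if it has at least two
training locations, is split along a dimension with law `qD` at a location with law `qL`. -/
def nodeLaw {n : ℕ} (x : Fin n → Fin D → ℝ) (qS : ℕ → Fin K → Box D → Fin K → ℝ≥0∞)
    (qD : ℕ → Fin K → Box D → Fin D → ℝ≥0∞) (qL : ℕ → Fin K → Box D → Fin D → Measure I)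
    (j : ℕ) (s : Fin K) (A : Box D) : Measure (Mark D K) :=
  ∑ s', qS j s A s' •
    if 2 ≤ numTrain x A then ∑ d, qD j s' A d • (qL j s' A d).map fun l => (s', some (d, l))
    else Measure.dirac (s', none)

lemma measurable_mark (s' : Fin K) (d : Fin D) :
    Measurable fun l : I => ((s', some (d, l)) : Mark D K) :=
  measurable_const.prodMk (measurable_some.comp measurable_prodMk_left)

/-- On valid configurations the pending node is unsplit and its ancestors all have states, so that
the step of sequential generation enters just one new mark. -/
lemma stepLaw_eq_markStep {n : ℕ} {x : Fin n → Fin D → ℝ}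
    {qS : ℕ → Fin K → Box D → Fin K → ℝ≥0∞} {qD : ℕ → Fin K → Box D → Fin D → ℝ≥0∞}
    {qL : ℕ → Fin K → Box D → Fin D → Measure I} {s₀ : Fin K} {Om : Box D}
    (hnext : IsSchedule next) {k : ℕ} {c : Config D K} (hc : Valid k c) :
    stepLaw x Om s₀ qS qD qL next c = markStep (nodeLaw x qS qD qL) s₀ Om next c := by
  unfold stepLaw markStep
  cases h : next c with
  | none => rfl
  | some a =>
    obtain ⟨hnode, hnone⟩ := hnext.pending _ _ h
    have hu : Measurable (upd c a) := (measurable_upd a).comp measurable_prodMk_left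
    simp only [nodeMark, Nat.zero_add, nodeLaw, pstate_eq_parentState (fun a => (hc a).1) s₀ hnode]
    rw [Measure.map_finset_sum hu.aemeasurable]
    refine Finset.sum_congr rfl fun s' _ => ?_
    rw [Measure.map_smul]
    congr 1
    split
    · rw [Measure.map_finset_sum hu.aemeasurable]
      refine Finset.sum_congr rfl fun d _ => ?_
      rw [Measure.map_smul, Measure.map_map hu (measurable_mark s' d)]
      rfl
    · rw [Measure.map_dirac' hu, upd]
      congr 2
      have : c.1 a = none := by
        by_contra h'
        exact (hc a).1 h' hnone
      simp [← this]

/-- If a probability measure on configurations is the law of a branching process whose node marks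
are drawn from `qS`, `qD` and `qL`, then in whichever order its nodes are revealed, what is revealed
next is distributed according to one step of sequential generation given what has been revealed. -/
theorem reveal_law_of_fill_eq {n : ℕ} {x : Fin n → Fin D → ℝ}
    {qS : ℕ → Fin K → Box D → Fin K → ℝ≥0∞} {qD : ℕ → Fin K → Box D → Fin D → ℝ≥0∞}
    {qL : ℕ → Fin K → Box D → Fin D → Measure I} {s₀ : Fin K} {Om : Box D}
    (hq : IsMarkLaw (nodeLaw x qS qD qL)) (hnext : IsSchedule next) {μ : Measure (Config D K)}
    [IsProbabilityMeasure μ] {N₀ : ℕ}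
    (hμ : ∀ N, N₀ ≤ N → fill (nodeLaw x qS qD qL) N 0 s₀ Om (blank, blank) = μ) (k : ℕ) :
    (μ.map fun c => (reveal next c k, reveal next c (k + 1))) =
        (μ.map fun c => reveal next c k).bind
          (fun c => (stepLaw x Om s₀ qS qD qL next c).map (Prod.mk c)) ∧
      growLaw (stepLaw x Om s₀ qS qD qL next) k = μ.map fun c => reveal next c k := by
  set q := nodeLaw x qS qD qL with hqdef
  set st := markStep q s₀ Om next with hst
  have hstm : Measurable st := hq.measurable_markStep s₀ Om hnext
  -- any number of levels exceeding both `N₀` and the number of steps will do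
  have hone : ∀ k, fill q (max N₀ (k + 1)) 0 s₀ Om (blank, blank) = μ := fun k =>
    hμ _ (le_max_left _ _)
  have hstep : ∀ k, stepLaw x Om s₀ qS qD qL next =ᵐ[growLaw st k] st := fun k => by
    filter_upwards [hq.ae_valid_growLaw s₀ Om hnext k] with c hc
    exact stepLaw_eq_markStep hnext hc
  have hgrow : ∀ k, growLaw (stepLaw x Om s₀ qS qD qL next) k = growLaw st k := fun k => by
    induction k with
    | zero => rfl
    | succ k ih => rw [growLaw, ih, Measure.bind_congr_right (hstep k), growLaw]
  have hlaw : ∀ k, growLaw st k = μ.map fun c => reveal next c k := fun k => by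
    refine Measure.ext_of_lintegral _ fun f hf => ?_
    have h := hq.lintegral_reveal s₀ Om hnext (k := k) (N := max N₀ (k + 1)) (by omega)
      (f := fun z => f z.1) (hf.comp measurable_fst)
    rw [lintegral_map hf (measurable_reveal hnext k), ← hone k, h]
    refine lintegral_congr_ae ?_
    filter_upwards [hq.ae_fill_univ s₀ Om hnext (k := k) (N := max N₀ (k + 1)) (by omega)
      (by rw [hone]; exact measure_univ)] with c hc
    rw [lintegral_const, hc, mul_one]
  refine ⟨?_, (hgrow k).trans (hlaw k)⟩
  rw [← hlaw k]
  have hmk : Measurable fun c => (st c).map (Prod.mk c) :=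
    measurable_map_param hstm (fun c => hq.markStep_le_one s₀ Om c) measurable_id
  rw [Measure.bind_congr_right (g := fun c => (st c).map (Prod.mk c)) ?_]
  · refine Measure.ext_of_lintegral _ fun f hf => ?_
    have hR : Measurable fun z : Config D K × Config D K => f (z.1, revealStep next z.1 z.2) :=
      hf.comp (measurable_fst.prodMk (measurable_revealStep hnext))
    have h := hq.lintegral_reveal s₀ Om hnext (k := k) (N := max N₀ (k + 1)) (by omega) hR
    rw [lintegral_map hf ((measurable_reveal hnext k).prodMk (measurable_reveal hnext (k + 1))),
      Measure.lintegral_bind hmk.aemeasurable hf.aemeasurable]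
    simp only [reveal_succ]
    rw [← hone k, h]
    have hmass := hq.ae_fill_univ s₀ Om hnext (k := k + 1) (N := max N₀ (k + 1)) (by omega)
      (by rw [hone]; exact measure_univ)
    rw [growLaw] at hmass
    refine lintegral_congr_ae ?_
    filter_upwards [hq.ae_valid_growLaw s₀ Om hnext k,
      Measure.ae_ae_of_ae_bind hstm.aemeasurable hmass] with c hc hmass
    rw [hq.lintegral_fill_revealStep s₀ Om hnext (by omega) hc (f := fun z => f (c, z.1))
      (hf.comp (measurable_const.prodMk measurable_fst)), lintegral_map hf measurable_prodMk_left]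
    refine lintegral_congr_ae ?_
    filter_upwards [hmass] with c' hc'
    rw [lintegral_const, hc', mul_one]
  · filter_upwards [hstep k] with c hc
    rw [hc]

end Sequential

/-! ### The two children of a box -/

section Geometry

variable {D n : ℕ}

lemma child_threshold_mem {A : Box D} {d : Fin D} {l : I} (h : A.1 d ≤ A.2 d) :
    A.1 d ≤ A.1 d + (l : ℝ) * (A.2 d - A.1 d) ∧ A.1 d + (l : ℝ) * (A.2 d - A.1 d) ≤ A.2 d := by
  have h0 := l.2.1
  have h1 := l.2.2
  constructor <;> nlinarith

lemma inBox_child_false {A : Box D} {d : Fin D} {l : I} {v : Fin D → ℝ} :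
    InBox (child A d l false) v ↔
      InBox A v ∧ v d ≤ A.1 d + (l : ℝ) * (A.2 d - A.1 d) := by
  simp only [InBox, child, Bool.false_eq_true, if_false]
  constructor
  · intro h
    have hd : v d ≤ A.1 d + (l : ℝ) * (A.2 d - A.1 d) := by simpa using (h d).2
    refine ⟨fun k => ⟨(h k).1, ?_⟩, hd⟩
    by_cases hk : k = d
    · subst hk
      have hlt := (h k).1
      have hle : A.1 k ≤ A.2 k := by
        by_contra! hlt'
        have := l.2.1
        nlinarith
      exact hd.trans (child_threshold_mem hle).2
    · simpa [Function.update_apply, hk] using (h k).2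
  · rintro ⟨h, hd⟩ k
    refine ⟨(h k).1, ?_⟩
    by_cases hk : k = d
    · subst hk; simpa using hd
    · simpa [Function.update_apply, hk] using (h k).2

lemma inBox_child_true {A : Box D} {d : Fin D} {l : I} {v : Fin D → ℝ} :
    InBox (child A d l true) v ↔
      InBox A v ∧ A.1 d + (l : ℝ) * (A.2 d - A.1 d) < v d := by
  simp only [InBox, child, if_true]
  constructor
  · intro h
    have hd : A.1 d + (l : ℝ) * (A.2 d - A.1 d) < v d := by simpa using (h d).1
    refine ⟨fun k => ⟨?_, (h k).2⟩, hd⟩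
    by_cases hk : k = d
    · subst hk
      have hlt := (h k).2
      have hle : A.1 k ≤ A.2 k := by
        by_contra! hlt'
        have := l.2.2
        nlinarith
      exact (child_threshold_mem hle).1.trans_lt hd
    · simpa [Function.update_apply, hk] using (h k).1
  · rintro ⟨h, hd⟩ k
    refine ⟨?_, (h k).2⟩
    by_cases hk : k = d
    · subst hk; simpa using hd
    · simpa [Function.update_apply, hk] using (h k).1

open Classical in
lemma ite_inBox_child_add {R : Type*} [AddZeroClass R] (A : Box D) (d : Fin D) (l : I)
    (v : Fin D → ℝ) (r : R) :
    ((if InBox (child A d l false) v then r else 0) +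
      if InBox (child A d l true) v then r else 0) = if InBox A v then r else 0 := by
  simp only [inBox_child_false, inBox_child_true]
  by_cases hA : InBox A v
  · by_cases hd : v d ≤ A.1 d + (l : ℝ) * (A.2 d - A.1 d)
    · simp [hA, hd, not_lt.2 hd]
    · simp [hA, hd, lt_of_not_ge hd]
  · simp [hA]

lemma numTrain_child_add (x : Fin n → Fin D → ℝ) (A : Box D) (d : Fin D) (l : I) :
    numTrain x (child A d l false) + numTrain x (child A d l true) = numTrain x A := by
  classical
  simp only [numTrain_eq_sum, ← Finset.sum_add_distrib]
  exact Finset.sum_congr rfl fun i _ => ite_inBox_child_add A d l (x i) 1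

lemma numTrain_le (x : Fin n → Fin D → ℝ) (A : Box D) : numTrain x A ≤ n := by
  classical
  rw [numTrain]
  exact (Finset.card_filter_le _ _).trans (by simp)

end Geometry

/-! ### The branching process with given node laws -/

section NodeLaw

variable {D n K : ℕ} {x : Fin n → Fin D → ℝ}

lemma measurable_sum_smul {X α ι : Type*} [MeasurableSpace X] [MeasurableSpace α] (t : Finset ι)
    {w : ι → X → ℝ≥0∞} {μ : ι → X → Measure α} (hw : ∀ i, Measurable (w i))
    (hμ : ∀ i, Measurable (μ i)) : Measurable fun z => ∑ i ∈ t, w i z • μ i z := by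
  refine Measure.measurable_of_measurable_coe _ fun s hs => ?_
  simp only [Measure.finsetSum_apply, Measure.smul_apply, smul_eq_mul]
  exact Finset.measurable_sum _ fun i _ => (hw i).mul ((Measure.measurable_coe hs).comp (hμ i))

lemma sum_smul_univ_le_one {α ι : Type*} [MeasurableSpace α] (t : Finset ι) {w : ι → ℝ≥0∞}
    {μ : ι → Measure α} (hw : ∑ i ∈ t, w i ≤ 1) (hμ : ∀ i, μ i Set.univ ≤ 1) :
    (∑ i ∈ t, w i • μ i) Set.univ ≤ 1 := by
  simp only [Measure.finsetSum_apply, Measure.smul_apply, smul_eq_mul]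
  exact (Finset.sum_le_sum fun i _ => mul_le_of_le_one_right' (hμ i)).trans hw

lemma measurableSet_two_le_numTrain (x : Fin n → Fin D → ℝ) :
    MeasurableSet {A : Box D | 2 ≤ numTrain x A} :=
  measurable_numTrain x measurableSet_Ici

variable {qS : ℕ → Fin K → Box D → Fin K → ℝ≥0∞} {qD : ℕ → Fin K → Box D → Fin D → ℝ≥0∞}
  {qL : ℕ → Fin K → Box D → Fin D → Measure I}

lemma isMarkLaw_nodeLaw (hS : ∀ j s s', Measurable fun A => qS j s A s')
    (hS1 : ∀ j s A, ∑ s', qS j s A s' ≤ 1) (hD : ∀ j s d, Measurable fun A => qD j s A d)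
    (hD1 : ∀ j s A, 2 ≤ numTrain x A → ∑ d, qD j s A d ≤ 1)
    (hL : ∀ j s d, Measurable fun A => qL j s A d) (hL1 : ∀ j s A d, qL j s A d Set.univ ≤ 1) :
    IsMarkLaw (nodeLaw x qS qD qL) where
  measurable j s := by
    refine measurable_sum_smul _ (fun s' => hS j s s') fun s' => ?_
    refine Measurable.ite (measurableSet_two_le_numTrain x) ?_ measurable_const
    refine measurable_sum_smul _ (fun d => hD j s' d) fun d => ?_
    exact (Measure.measurable_map _ (measurable_mark s' d)).comp (hL j s' d)
  le_one j s A := by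
    refine sum_smul_univ_le_one _ (hS1 j s A) fun s' => ?_
    split_ifs with h
    · exact sum_smul_univ_le_one _ (hD1 j s' A h) fun d =>
        map_univ_le_one (hL1 j s' A d) (measurable_mark s' d)
    · simp

lemma lintegral_nodeLaw (j : ℕ) (s : Fin K) (A : Box D) {g : Mark D K → ℝ≥0∞}
    (hg : Measurable g) :
    ∫⁻ e, g e ∂nodeLaw x qS qD qL j s A = ∑ s', qS j s A s' *
      if 2 ≤ numTrain x A then ∑ d, qD j s' A d * ∫⁻ l, g (s', some (d, l)) ∂qL j s' A d
      else g (s', none) := by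
  rw [nodeLaw, lintegral_finsetSum_measure]
  refine Finset.sum_congr rfl fun s' _ => ?_
  rw [lintegral_smul_measure, smul_eq_mul]
  congr 1
  split_ifs with h
  · rw [lintegral_finsetSum_measure]
    refine Finset.sum_congr rfl fun d _ => ?_
    rw [lintegral_smul_measure, smul_eq_mul, lintegral_map hg (measurable_mark s' d)]
  · rw [lintegral_dirac' _ hg]

/-- The branching process: everything is still to be generated. -/
def branch (q : ℕ → Fin K → Box D → Measure (Mark D K)) (k j : ℕ) (s : Fin K) (A : Box D) :
    Measure (Config D K) :=
  fill q k j s A (blank, blank)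

variable {q : ℕ → Fin K → Box D → Measure (Mark D K)}

lemma IsMarkLaw.branch_le_one (hq : IsMarkLaw q) (k j : ℕ) (s : Fin K) (A : Box D) :
    branch q k j s A Set.univ ≤ 1 := hq.fill_le_one _ _ _ _ _

lemma IsMarkLaw.isFiniteMeasure_branch (hq : IsMarkLaw q) (k j : ℕ) (s : Fin K) (A : Box D) :
    IsFiniteMeasure (branch q k j s A) := isFiniteMeasure_of_le_one (hq.branch_le_one k j s A)

lemma IsMarkLaw.measurable_branch (hq : IsMarkLaw q) (k j : ℕ) (s : Fin K) :
    Measurable (branch q k j s) :=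
  (hq.measurable_fill k j s).comp (measurable_id.prodMk measurable_const)

lemma lintegral_branch_of_two_le (hq : IsMarkLaw (nodeLaw x qS qD qL)) (k j : ℕ) (s : Fin K)
    {A : Box D} (hA : 2 ≤ numTrain x A) {f : Config D K → ℝ≥0∞} (hf : Measurable f) :
    ∫⁻ c, f c ∂branch (nodeLaw x qS qD qL) (k + 1) j s A =
      ∑ s', qS j s A s' * ∑ d, qD j s' A d * ∫⁻ l, ∫⁻ cl, ∫⁻ cr, f (glue (s', some (d, l)) (cl, cr))
        ∂branch (nodeLaw x qS qD qL) k (j + 1) s' (child A d l true)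
        ∂branch (nodeLaw x qS qD qL) k (j + 1) s' (child A d l false) ∂qL j s' A d := by
  have hg : Measurable fun e =>
      ∫⁻ c, f c ∂after (fill (nodeLaw x qS qD qL) k) j A (blank, blank) e :=
    (Measure.measurable_lintegral hf).comp (hq.measurable_after_fill k j A _)
  rw [branch, hq.lintegral_fill_blank k j s A hf, lintegral_nodeLaw j s A hg]
  simp only [hA, if_true, hq.lintegral_after_some _ _ _ _ _ _ _ hf]
  rfl

lemma lintegral_branch_of_lt_two (hq : IsMarkLaw (nodeLaw x qS qD qL)) (k j : ℕ) (s : Fin K)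
    {A : Box D} (hA : ¬ 2 ≤ numTrain x A) {f : Config D K → ℝ≥0∞} (hf : Measurable f) :
    ∫⁻ c, f c ∂branch (nodeLaw x qS qD qL) (k + 1) j s A =
      ∑ s', qS j s A s' * f (glue (s', none) ((blank, blank), (blank, blank))) := by
  have hg : Measurable fun e =>
      ∫⁻ c, f c ∂after (fill (nodeLaw x qS qD qL) k) j A (blank, blank) e :=
    (Measure.measurable_lintegral hf).comp (hq.measurable_after_fill k j A _)
  rw [branch, hq.lintegral_fill_blank k j s A hf, lintegral_nodeLaw j s A hg]
  simp only [hA, if_false, lintegral_after_none _ _ _ _ _ hf]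

end NodeLaw

/-! ### The prior as a branching process -/

section Prior

variable {D n K : ℕ}

/-- The assumptions on the prior of the tree: split dimensions have a probability vector depending
measurably on the box, and almost no split creates a child without training locations. -/
structure IsSplitPrior (x : Fin n → Fin D → ℝ) (lam : Box D → Fin D → ℝ≥0∞)
    (B : Fin D → Kernel (Box D) I) : Prop where
  measurable : ∀ d, Measurable fun A => lam A d
  sum_eq_one : ∀ A, 2 ≤ numTrain x A → ∑ d, lam A d = 1
  ae_pos : ∀ A, 2 ≤ numTrain x A → ∀ d, lam A d ≠ 0 →
    ∀ᵐ l ∂B d A, ∀ b, 0 < numTrain x (child A d l b)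

/-- The law of a node's mark under the prior. -/
def priorMark (x : Fin n → Fin D → ℝ) (lam : Box D → Fin D → ℝ≥0∞)
    (B : Fin D → Kernel (Box D) I) (ρ : ℕ → Fin K → PMF (Fin K)) :
    ℕ → Fin K → Box D → Measure (Mark D K) :=
  nodeLaw x (fun j s _ s' => ρ j s s') (fun _ _ A d => lam A d) (fun _ _ A d => B d A)

lemma sum_pmf {ι : Type*} [Fintype ι] (μ : PMF ι) : ∑ i, μ i = 1 := by
  rw [← μ.tsum_coe, tsum_fintype]

variable {x : Fin n → Fin D → ℝ} {lam : Box D → Fin D → ℝ≥0∞}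
  {B : Fin D → Kernel (Box D) I} [∀ d, IsMarkovKernel (B d)] {ρ : ℕ → Fin K → PMF (Fin K)}

lemma IsSplitPrior.isMarkLaw (h : IsSplitPrior x lam B) (ρ : ℕ → Fin K → PMF (Fin K)) :
    IsMarkLaw (priorMark x lam B ρ) :=
  isMarkLaw_nodeLaw (fun _ _ _ => measurable_const) (fun j s _ => (sum_pmf (ρ j s)).le)
    (fun _ _ d => h.measurable d) (fun _ _ A hA => (h.sum_eq_one A hA).le)
    (fun _ _ d => (B d).measurable) (fun _ _ _ _ => by simp)

lemma IsSplitPrior.ruhwt_aux (h : IsSplitPrior x lam B) (k : ℕ) :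
    (∀ A, ruhwt x lam B k A Set.univ ≤ 1) ∧ Measurable (ruhwt x lam B k) := by
  induction k with
  | zero => exact ⟨fun A => by simp [ruhwt], measurable_const⟩
  | succ k ih =>
    have hp : ∀ d, Measurable fun z : Box D × I =>
        ((ruhwt x lam B k (child z.1 d z.2 false)).prod
          (ruhwt x lam B k (child z.1 d z.2 true))).map
          fun q => graft (some (d, z.2)) q.1 q.2 := fun d => by
      have hb := fun b => ih.2.comp (measurable_child (D := D) d b)
      refine measurable_map_param (f := fun w : (Box D × I) × (Tree D × Tree D) =>
        graft (some (d, w.1.2)) w.2.1 w.2.2)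
        (measurable_prod_param (hb false) (fun _ => ih.1 _) (hb true) fun _ => ih.1 _)
        (fun _ => prod_univ_le_one (ih.1 _) (ih.1 _)) ?_
      exact measurable_graft (measurable_some.comp (by fun_prop)) (by fun_prop) (by fun_prop)
    constructor
    · intro A
      rw [ruhwt]
      split_ifs with hA
      · refine sum_smul_univ_le_one _ (h.sum_eq_one A hA).le fun d => ?_
        refine bind_univ_le_one (by simp)
          ((hp d).comp (measurable_prodMk_left (x := A))) fun l => ?_
        exact map_univ_le_one (prod_univ_le_one (ih.1 _) (ih.1 _))
          (measurable_graft measurable_const (by fun_prop) (by fun_prop))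
      · simp
    · have : ruhwt x lam B (k + 1) = fun A => ruhwt x lam B (k + 1) A := rfl
      rw [this]
      simp only [ruhwt]
      generalize ruhwt x lam B k = R at hp ih ⊢
      refine Measurable.ite (measurableSet_two_le_numTrain x) ?_ measurable_const
      refine measurable_sum_smul _ (fun d => h.measurable d) fun d => ?_
      have h1 : ∀ A, B d A Set.univ ≤ 1 := fun A => prob_le_one
      have h2 := measurable_bind_param (B d).measurable h1 (hp d)
      exact h2

lemma IsSplitPrior.lintegral_ruhwt (h : IsSplitPrior x lam B) (k : ℕ) {A : Box D}
    (hA : 2 ≤ numTrain x A) {f : Tree D → ℝ≥0∞} (hf : Measurable f) :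
    ∫⁻ T, f T ∂ruhwt x lam B (k + 1) A = ∑ d, lam A d * ∫⁻ l, ∫⁻ Tl, ∫⁻ Tr,
      f (graft (some (d, l)) Tl Tr) ∂ruhwt x lam B k (child A d l true)
        ∂ruhwt x lam B k (child A d l false) ∂B d A := by
  obtain ⟨h1, h2⟩ := h.ruhwt_aux k
  rw [ruhwt, if_pos hA, lintegral_finsetSum_measure]
  refine Finset.sum_congr rfl fun d _ => ?_
  have hg : ∀ l : I, Measurable fun q : Tree D × Tree D => graft (some (d, l)) q.1 q.2 := fun l =>
    measurable_graft measurable_const measurable_fst measurable_snd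
  have hm : Measurable fun l : I => ((ruhwt x lam B k (child A d l false)).prod
      (ruhwt x lam B k (child A d l true))).map fun q => graft (some (d, l)) q.1 q.2 := by
    have hb := fun b => h2.comp ((measurable_child d b).comp (measurable_prodMk_left (x := A)))
    refine measurable_map_param (f := fun w : I × (Tree D × Tree D) =>
      graft (some (d, w.1)) w.2.1 w.2.2)
      (measurable_prod_param (hb false) (fun _ => h1 _) (hb true) fun _ => h1 _)
      (fun _ => prod_univ_le_one (h1 _) (h1 _)) ?_
    exact measurable_graft (measurable_some.comp (by fun_prop)) (by fun_prop) (by fun_prop)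
  rw [lintegral_smul_measure, smul_eq_mul, Measure.lintegral_bind hm.aemeasurable hf.aemeasurable]
  congr 1
  refine lintegral_congr fun l => ?_
  have := isFiniteMeasure_of_le_one (h1 (child A d l true))
  rw [lintegral_map hf (hg l)]
  exact lintegral_prod _ (hf.comp (hg l)).aemeasurable

/-- The law of the states on `T` when the root has state `s'`. -/
def stateBranch (ρ : ℕ → Fin K → PMF (Fin K)) (k j : ℕ) (s' : Fin K) (T : Tree D) :
    Measure (States K) :=
  if (T []).isSome then
    ((markovTree ρ k (j + 1) s' (sub T false)).prod
      (markovTree ρ k (j + 1) s' (sub T true))).map fun q => graft (some s') q.1 q.2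
  else Measure.dirac (graft (some s') blank blank)

lemma stateBranch_aux {ρ : ℕ → Fin K → PMF (Fin K)} {k : ℕ}
    (h1 : ∀ j s (T : Tree D), markovTree ρ k j s T Set.univ = 1)
    (h2 : ∀ j s, Measurable (markovTree (D := D) ρ k j s)) (j : ℕ) (s' : Fin K) :
    (∀ T : Tree D, stateBranch ρ k j s' T Set.univ = 1) ∧
      Measurable (stateBranch (D := D) ρ k j s') := by
  have hg : Measurable fun q : States K × States K => graft (some s') q.1 q.2 :=
    measurable_graft measurable_const (by fun_prop) (by fun_prop)
  constructor
  · intro T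
    unfold stateBranch
    split
    · rw [Measure.map_apply hg MeasurableSet.univ, Set.preimage_univ]
      have := isFiniteMeasure_of_le_one (h1 (j + 1) s' (sub T true)).le
      rw [← Set.univ_prod_univ, Measure.prod_prod, h1, h1, one_mul]
    · simp
  · have hs : MeasurableSet {T : Tree D | (T []).isSome = true} := by
      convert (measurableSet_eq_none (measurable_pi_apply (X := fun _ => Option (Fin D × I))
        ([] : Addr))).compl using 1
      ext T; simp [Option.isSome_iff_ne_none]
    refine Measurable.ite hs ?_ measurable_const
    have hb := fun b => (h2 (j + 1) s').comp (measurable_sub (α := Option (Fin D × I)) b)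
    exact (Measure.measurable_map _ hg).comp
      (measurable_prod_param (hb false) (fun _ => (h1 _ _ _).le) (hb true) fun _ => (h1 _ _ _).le)

lemma markovTree_aux (ρ : ℕ → Fin K → PMF (Fin K)) (k : ℕ) :
    (∀ j s (T : Tree D), markovTree ρ k j s T Set.univ = 1) ∧
      ∀ j s, Measurable (markovTree (D := D) ρ k j s) := by
  induction k with
  | zero => exact ⟨fun _ _ _ => by simp [markovTree], fun _ _ => measurable_const⟩
  | succ k ih =>
    have hb := stateBranch_aux ih.1 ih.2
    constructor
    · intro j s T
      change (∑ s', ρ j s s' • stateBranch ρ k j s' T) Set.univ = 1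
      simp only [Measure.finsetSum_apply, Measure.smul_apply, smul_eq_mul, (hb _ _).1, mul_one]
      exact sum_pmf _
    · intro j s
      change Measurable fun T => ∑ s', ρ j s s' • stateBranch ρ k j s' T
      exact measurable_sum_smul _ (fun _ => measurable_const) fun s' => (hb j s').2

lemma markovTree_univ (ρ : ℕ → Fin K → PMF (Fin K)) (k j : ℕ) (s : Fin K) (T : Tree D) :
    markovTree ρ k j s T Set.univ = 1 := (markovTree_aux ρ k).1 j s T

lemma measurable_markovTree (ρ : ℕ → Fin K → PMF (Fin K)) (k j : ℕ) (s : Fin K) :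
    Measurable (markovTree (D := D) ρ k j s) := (markovTree_aux ρ k).2 j s

instance (ρ : ℕ → Fin K → PMF (Fin K)) (k j : ℕ) (s : Fin K) (T : Tree D) :
    IsProbabilityMeasure (markovTree ρ k j s T) := ⟨markovTree_univ ρ k j s T⟩

lemma lintegral_stateBranch_graft (ρ : ℕ → Fin K → PMF (Fin K)) (k j : ℕ) (s' : Fin K)
    (e : Fin D × I) (Tl Tr : Tree D) {f : States K → ℝ≥0∞} (hf : Measurable f) :
    ∫⁻ S, f S ∂stateBranch ρ k j s' (graft (some e) Tl Tr) =
      ∫⁻ Sl, ∫⁻ Sr, f (graft (some s') Sl Sr) ∂markovTree ρ k (j + 1) s' Tr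
        ∂markovTree ρ k (j + 1) s' Tl := by
  have hg : Measurable fun q : States K × States K => graft (some s') q.1 q.2 :=
    measurable_graft measurable_const (by fun_prop) (by fun_prop)
  have : stateBranch ρ k j s' (graft (some e) Tl Tr) =
      ((markovTree ρ k (j + 1) s' Tl).prod (markovTree ρ k (j + 1) s' Tr)).map
        fun q => graft (some s') q.1 q.2 := by
    rw [stateBranch, if_pos (by rfl)]
    rfl
  rw [this, lintegral_map hf hg]
  exact lintegral_prod _ (hf.comp hg).aemeasurable

/-- Drawing the tree first and then its states is the same as growing both together. -/
lemma IsSplitPrior.lintegral_branch (h : IsSplitPrior x lam B) (ρ : ℕ → Fin K → PMF (Fin K))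
    (k j : ℕ) (s : Fin K) (A : Box D) {f : Config D K → ℝ≥0∞} (hf : Measurable f) :
    ∫⁻ c, f c ∂branch (priorMark x lam B ρ) k j s A =
      ∫⁻ T, ∫⁻ S, f (T, S) ∂markovTree ρ k j s T ∂ruhwt x lam B k A := by
  induction k generalizing j s A f with
  | zero =>
    simp [branch, fill, ruhwt, markovTree, lintegral_dirac' _ hf]
  | succ k ih =>
    have hq := h.isMarkLaw ρ
    obtain ⟨hr1, hr2⟩ := h.ruhwt_aux k
    have hb := stateBranch_aux (D := D) (markovTree_univ ρ k) (measurable_markovTree ρ k) j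
    -- average over the root state first
    have hgm : ∀ s', Measurable fun T => ∫⁻ S, f (T, S) ∂stateBranch ρ k j s' T := fun s' =>
      measurable_lintegral_param (hb s').2 (fun T => ((hb s').1 T).le) hf
    have hroot : ∀ T, ∫⁻ S, f (T, S) ∂markovTree ρ (k + 1) j s T =
        ∑ s', ρ j s s' * ∫⁻ S, f (T, S) ∂stateBranch ρ k j s' T := fun T => by
      change ∫⁻ S, f (T, S) ∂(∑ s', ρ j s s' • stateBranch ρ k j s' T) = _
      rw [lintegral_finsetSum_measure]
      simp only [lintegral_smul_measure, smul_eq_mul]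
    simp only [hroot]
    rw [lintegral_finsetSum _ fun s' _ => (hgm s').const_mul _]
    simp only [lintegral_const_mul _ (hgm _)]
    by_cases hA : 2 ≤ numTrain x A
    · rw [priorMark, lintegral_branch_of_two_le hq k j s hA hf]
      refine Finset.sum_congr rfl fun s' _ => ?_
      rw [h.lintegral_ruhwt k hA (hgm s')]
      congr 1
      refine Finset.sum_congr rfl fun d _ => ?_
      congr 1
      refine lintegral_congr fun l => ?_
      have hF : Measurable fun z : Config D K × Config D K => f (glue (s', some (d, l)) z) :=
        hf.comp (measurable_glue_right _)
      change ∫⁻ cl, ∫⁻ cr, f (glue (s', some (d, l)) (cl, cr))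
        ∂branch (priorMark x lam B ρ) k (j + 1) s' (child A d l true)
        ∂branch (priorMark x lam B ρ) k (j + 1) s' (child A d l false) = _
      have hfin := hq.isFiniteMeasure_branch k (j + 1) s' (child A d l true)
      have := isFiniteMeasure_of_le_one (hr1 (child A d l true))
      rw [ih (j + 1) s' _ (Measurable.lintegral_prod_right' hF)]
      refine lintegral_congr fun Tl => ?_
      have hFl : Measurable fun z : (States K × Tree D) × States K =>
          f (glue (s', some (d, l)) ((Tl, z.1.1), (z.1.2, z.2))) :=
        hF.comp ((measurable_const.prodMk measurable_fst.fst).prodMk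
          (measurable_fst.snd.prodMk measurable_snd))
      calc ∫⁻ Sl, ∫⁻ cr, f (glue (s', some (d, l)) ((Tl, Sl), cr))
              ∂branch (priorMark x lam B ρ) k (j + 1) s' (child A d l true)
              ∂markovTree ρ k (j + 1) s' Tl
          = ∫⁻ Sl, ∫⁻ Tr, ∫⁻ Sr, f (glue (s', some (d, l)) ((Tl, Sl), (Tr, Sr)))
              ∂markovTree ρ k (j + 1) s' Tr ∂ruhwt x lam B k (child A d l true)
              ∂markovTree ρ k (j + 1) s' Tl :=
            lintegral_congr fun Sl => ih (j + 1) s' _ (hF.comp measurable_prodMk_left)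
        _ = ∫⁻ Tr, ∫⁻ Sl, ∫⁻ Sr, f (glue (s', some (d, l)) ((Tl, Sl), (Tr, Sr)))
              ∂markovTree ρ k (j + 1) s' Tr ∂markovTree ρ k (j + 1) s' Tl
              ∂ruhwt x lam B k (child A d l true) := by
            refine lintegral_lintegral_swap (Measurable.aemeasurable ?_)
            exact measurable_lintegral_param
              (κ := fun z : States K × Tree D => markovTree ρ k (j + 1) s' z.2)
              ((measurable_markovTree ρ k (j + 1) s').comp measurable_snd)
              (fun z => (markovTree_univ ρ k (j + 1) s' z.2).le) hFl
        _ = _ := lintegral_congr fun Tr =>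
            (lintegral_stateBranch_graft ρ k j s' (d, l) Tl Tr
              (f := fun S => f (graft (some (d, l)) Tl Tr, S))
              (hf.comp measurable_prodMk_left)).symm
    · rw [priorMark, lintegral_branch_of_lt_two hq k j s hA hf, ruhwt, if_neg hA]
      refine Finset.sum_congr rfl fun s' _ => ?_
      have hfs : Measurable fun S => f ((blank : Tree D), S) := hf.comp measurable_prodMk_left
      rw [lintegral_dirac' _ (hgm s'), stateBranch, if_neg (by simp [blank]),
        lintegral_dirac' _ hfs]
      congr 2
      refine Prod.ext ?_ rfl
      funext a
      rcases a with _ | ⟨_ | _, a⟩ <;> rfl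

end Prior

/-! ### The likelihood of a tree with states -/

section TreeLik

variable {D K : ℕ}

lemma mem_addrs {k : ℕ} {a : Addr} : a ∈ addrs k ↔ a.length < k := by
  simp [addrs]

@[to_additive]
lemma prod_addrs_succ {R : Type*} [CommMonoid R] (k : ℕ) (f : Addr → R) :
    ∏ a ∈ addrs (k + 1), f a =
      f [] * ((∏ a ∈ addrs k, f (false :: a)) * ∏ a ∈ addrs k, f (true :: a)) := by
  classical
  have hset : addrs (k + 1) = insert [] ((addrs k).image (List.cons false) ∪
      (addrs k).image (List.cons true)) := by
    ext a
    rcases a with _ | ⟨_ | _, a⟩ <;> simp [mem_addrs]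
  rw [hset, Finset.prod_insert (by simp), Finset.prod_union, Finset.prod_image, Finset.prod_image]
  · intro a _ b _ h; exact (List.cons.inj h).2
  · intro a _ b _ h; exact (List.cons.inj h).2
  · rw [Finset.disjoint_left]
    intro a h1 h2
    obtain ⟨a1, -, rfl⟩ := Finset.mem_image.1 h1
    obtain ⟨a2, -, h⟩ := Finset.mem_image.1 h2
    simp at h

/-- The factor contributed to the likelihood by the node at the address `a`. -/
def nodeLik (M : ℕ → Fin K → Box D → Fin D → I → ℝ≥0∞) (j : ℕ) (A : Box D) (c : Config D K)
    (a : Addr) : ℝ≥0∞ :=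
  match c.1 a, c.2 a with
  | some (d, l), some s => M (j + a.length) s (region A c.1 a) d l
  | _, _ => 1

lemma treeLik_eq_prod_nodeLik (k : ℕ) (M : ℕ → Fin K → Box D → Fin D → I → ℝ≥0∞) (j : ℕ)
    (A : Box D) (c : Config D K) : treeLik k M j A c.1 c.2 = ∏ a ∈ addrs k, nodeLik M j A c a :=
  rfl

variable {M : ℕ → Fin K → Box D → Fin D → I → ℝ≥0∞}

lemma nodeLik_of_none {j : ℕ} {A : Box D} {c : Config D K} {a : Addr} (h : c.1 a = none) :
    nodeLik M j A c a = 1 := by simp [nodeLik, h]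

lemma nodeLik_of_some {j : ℕ} {A : Box D} {c : Config D K} {a : Addr} {d : Fin D} {l : I}
    {s : Fin K} (h : c.1 a = some (d, l)) (hs : c.2 a = some s) :
    nodeLik M j A c a = M (j + a.length) s (region A c.1 a) d l := by simp [nodeLik, h, hs]

lemma region_cons {A : Box D} {T : Tree D} {d : Fin D} {l : I} (h : T [] = some (d, l)) (b : Bool)
    (a : Addr) : region A T (b :: a) = region (child A d l b) (sub T b) a := by
  simp [region, h]

lemma nodeLik_cons {j : ℕ} {A : Box D} {c : Config D K} {d : Fin D} {l : I}
    (h : c.1 [] = some (d, l)) (b : Bool) (a : Addr) :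
    nodeLik M j A c (b :: a) = nodeLik M (j + 1) (child A d l b) (csub c b) a := by
  simp only [nodeLik, csub, sub, List.length_cons, region_cons h b a]
  rw [Nat.add_assoc, Nat.add_comm 1]

lemma treeLik_glue_some (k j : ℕ) (A : Box D) (s' : Fin K) (d : Fin D) (l : I)
    (q : Config D K × Config D K) :
    treeLik (k + 1) M j A (glue (s', some (d, l)) q).1 (glue (s', some (d, l)) q).2 =
      M j s' A d l * (treeLik k M (j + 1) (child A d l false) q.1.1 q.1.2 *
        treeLik k M (j + 1) (child A d l true) q.2.1 q.2.2) := by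
  simp only [treeLik_eq_prod_nodeLik]
  rw [prod_addrs_succ]
  simp only [nodeLik_cons (c := glue (s', some (d, l)) q) rfl]
  rfl

lemma treeLik_glue_none (k j : ℕ) (A : Box D) (s' : Fin K) :
    treeLik k M j A (glue ((s', none) : Mark D K) ((blank, blank), (blank, blank))).1
      (glue ((s', none) : Mark D K) ((blank, blank), (blank, blank))).2 = 1 := by
  rw [treeLik_eq_prod_nodeLik]
  refine Finset.prod_eq_one fun a _ => nodeLik_of_none ?_
  rcases a with _ | ⟨_ | _, a⟩ <;> rfl

lemma measurable_treeLik {X : Type*} [MeasurableSpace X]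
    {M : X → ℕ → Fin K → Box D → Fin D → I → ℝ≥0∞}
    (hM : ∀ j s d, Measurable fun z : X × Box D × I => M z.1 j s z.2.1 d z.2.2) (k j : ℕ) :
    Measurable fun z : X × Box D × Config D K => treeLik k (M z.1) j z.2.1 z.2.2.1 z.2.2.2 := by
  simp only [treeLik_eq_prod_nodeLik]
  refine Finset.measurable_fun_prod _ fun a _ => ?_
  have hT : Measurable fun z : X × Box D × Config D K => z.2.2.1 a :=
    (measurable_pi_apply a).comp measurable_snd.snd.fst
  have hS : Measurable fun z : X × Box D × Config D K => z.2.2.2 a :=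
    (measurable_pi_apply a).comp measurable_snd.snd.snd
  refine measurable_option_cases hS (g₀ := fun _ => 1) measurable_const
    (g := fun z s => match z.2.2.1 a with
      | none => 1
      | some e => M z.1 (j + a.length) s (region z.2.1 z.2.2.1 a) e.1 e.2) ?_ ?_ ?_
  · refine measurable_option_cases (hT.comp measurable_fst) (g₀ := fun _ => 1) measurable_const
      (g := fun z e => M z.1.1 (j + a.length) z.2 (region z.1.2.1 z.1.2.2.1 a) e.1 e.2) ?_ ?_ ?_
    · refine measurable_of_countable_fibers
        (g := fun z : ((X × Box D × Config D K) × Fin K) × (Fin D × I) => (z.1.2, z.2.1))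
        (F := fun i z => M z.1.1.1 (j + a.length) i.1 (region z.1.1.2.1 z.1.1.2.2.1 a) i.2 z.2.2)
        (fun i => ?_) fun i => ?_
      · exact (measurable_fst.snd.prodMk measurable_snd.fst) (measurableSet_singleton i)
      · have hr := (measurable_region (D := D) a).comp
          ((measurable_fst.fst.snd.fst.prodMk measurable_fst.fst.snd.snd.fst :
            Measurable fun z : ((X × Box D × Config D K) × Fin K) × (Fin D × I) =>
              (z.1.1.2.1, z.1.1.2.2.1)))
        exact (hM (j + a.length) i.1 i.2).comp
          (measurable_fst.fst.fst.prodMk (hr.prodMk measurable_snd.snd))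
    · intro z h
      have h' : z.1.2.2.1 a = none := h
      simp only [h']
    · intro z e h
      have h' : z.1.2.2.1 a = some e := h
      simp only [h']
  · intro z h
    simp [nodeLik, h]
  · intro z s h
    cases hT : z.2.2.1 a with
    | none => simp only [nodeLik, hT]
    | some e => simp only [nodeLik, hT, h]

/-- `treeLik` is measurable in the configuration. -/
lemma measurable_treeLik_config (hM : ∀ j s d, Measurable fun z : Box D × I => M j s z.1 d z.2)
    (k j : ℕ) (A : Box D) : Measurable fun c : Config D K => treeLik k M j A c.1 c.2 :=
  (measurable_treeLik (X := Unit) (M := fun _ => M)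
    (fun j s d => (hM j s d).comp measurable_snd) k j).comp
    (measurable_const.prodMk (measurable_const.prodMk measurable_id) :
      Measurable fun c : Config D K => ((), A, c))

end TreeLik

/-! ### The prior weighted by the likelihood -/

section WeightedPrior

variable {D n K : ℕ} {x : Fin n → Fin D → ℝ} {lam : Box D → Fin D → ℝ≥0∞}
  {B : Fin D → Kernel (Box D) I} {ρ : ℕ → Fin K → PMF (Fin K)}
  {M : ℕ → Fin K → Box D → Fin D → I → ℝ≥0∞}

lemma IsSplitPrior.ae_numTrain_child (h : IsSplitPrior x lam B) {A : Box D}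
    (hA : 2 ≤ numTrain x A) {d : Fin D} (hd : lam A d ≠ 0) :
    ∀ᵐ l ∂B d A, ∀ b, 0 < numTrain x (child A d l b) ∧
      numTrain x (child A d l b) < numTrain x A := by
  filter_upwards [h.ae_pos A hA d hd] with l hl b
  have hadd := numTrain_child_add x A d l
  have h0 := hl false
  have h1 := hl true
  cases b <;> omega

variable [∀ d, IsMarkovKernel (B d)]

/-- The prior of the subtree and its states below a node, with density the likelihood. -/
def weighted (x : Fin n → Fin D → ℝ) (lam : Box D → Fin D → ℝ≥0∞)
    (B : Fin D → Kernel (Box D) I) (ρ : ℕ → Fin K → PMF (Fin K))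
    (M : ℕ → Fin K → Box D → Fin D → I → ℝ≥0∞) (k j : ℕ) (s : Fin K) (A : Box D) :
    Measure (Config D K) :=
  (branch (priorMark x lam B ρ) k j s A).withDensity fun c => treeLik k M j A c.1 c.2

lemma IsSplitPrior.sFinite_weighted (h : IsSplitPrior x lam B) (k j : ℕ) (s : Fin K)
    (A : Box D) : SFinite (weighted x lam B ρ M k j s A) := by
  have := (h.isMarkLaw ρ).isFiniteMeasure_branch k j s A
  unfold weighted
  infer_instance

lemma IsSplitPrior.lintegral_weighted_of_two_le (h : IsSplitPrior x lam B)
    (hM : ∀ j s d, Measurable fun z : Box D × I => M j s z.1 d z.2) (k j : ℕ) (s : Fin K)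
    {A : Box D} (hA : 2 ≤ numTrain x A) {f : Config D K → ℝ≥0∞} (hf : Measurable f) :
    ∫⁻ c, f c ∂weighted x lam B ρ M (k + 1) j s A =
      ∑ s', ρ j s s' * ∑ d, lam A d * ∫⁻ l, M j s' A d l *
        ∫⁻ cl, ∫⁻ cr, f (glue (s', some (d, l)) (cl, cr))
          ∂weighted x lam B ρ M k (j + 1) s' (child A d l true)
          ∂weighted x lam B ρ M k (j + 1) s' (child A d l false) ∂B d A := by
  have hL := fun k j A => measurable_treeLik_config hM k j A
  rw [weighted, lintegral_withDensity_eq_lintegral_mul _ (hL _ _ _) hf, priorMark,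
    lintegral_branch_of_two_le (h.isMarkLaw ρ) k j s hA ((hL _ _ _).mul hf)]
  refine Finset.sum_congr rfl fun s' _ => ?_
  congr 1
  refine Finset.sum_congr rfl fun d _ => ?_
  congr 1
  refine lintegral_congr fun l => ?_
  have hF : Measurable fun z : Config D K × Config D K => f (glue (s', some (d, l)) z) :=
    hf.comp (measurable_glue_right _)
  have := h.sFinite_weighted (ρ := ρ) (M := M) k (j + 1) s' (child A d l true)
  have hin : ∀ cl, ∫⁻ cr, f (glue (s', some (d, l)) (cl, cr))
        ∂weighted x lam B ρ M k (j + 1) s' (child A d l true) =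
      ∫⁻ cr, treeLik k M (j + 1) (child A d l true) cr.1 cr.2 *
        f (glue (s', some (d, l)) (cl, cr))
        ∂branch (priorMark x lam B ρ) k (j + 1) s' (child A d l true) := fun cl => by
    have hFl : Measurable fun cr => f (glue (s', some (d, l)) (cl, cr)) :=
      hF.comp measurable_prodMk_left
    rw [weighted, lintegral_withDensity_eq_lintegral_mul _ (hL _ _ _) hFl]
    rfl
  have hout : Measurable fun cl => ∫⁻ cr, f (glue (s', some (d, l)) (cl, cr))
      ∂weighted x lam B ρ M k (j + 1) s' (child A d l true) :=
    Measurable.lintegral_prod_right' hF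
  rw [weighted, lintegral_withDensity_eq_lintegral_mul _ (hL _ _ _) hout,
    ← lintegral_const_mul _ ((hL _ _ _).mul hout)]
  refine lintegral_congr fun cl => ?_
  simp only [Pi.mul_apply, hin cl]
  have hm : Measurable fun cr : Config D K => treeLik k M (j + 1) (child A d l true) cr.1 cr.2 *
      f (glue (s', some (d, l)) (cl, cr)) := (hL _ _ _).mul (hF.comp measurable_prodMk_left)
  rw [← lintegral_const_mul _ hm, ← lintegral_const_mul _ (hm.const_mul _)]
  refine lintegral_congr fun cr => ?_
  rw [treeLik_glue_some]
  ring

lemma IsSplitPrior.lintegral_weighted_of_lt_two (h : IsSplitPrior x lam B)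
    (hM : ∀ j s d, Measurable fun z : Box D × I => M j s z.1 d z.2) (k j : ℕ) (s : Fin K)
    {A : Box D} (hA : ¬ 2 ≤ numTrain x A) {f : Config D K → ℝ≥0∞} (hf : Measurable f) :
    ∫⁻ c, f c ∂weighted x lam B ρ M (k + 1) j s A =
      ∑ s', ρ j s s' * f (glue (s', none) ((blank, blank), (blank, blank))) := by
  have hL := measurable_treeLik_config hM (k + 1) j A
  rw [weighted, lintegral_withDensity_eq_lintegral_mul _ hL hf, priorMark,
    lintegral_branch_of_lt_two (h.isMarkLaw ρ) k j s hA (hL.mul hf)]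
  simp only [Pi.mul_apply, treeLik_glue_none, one_mul]

/-- Once the bound on the number of levels reaches the number of training locations, it is not
active. -/
lemma IsSplitPrior.weighted_succ (h : IsSplitPrior x lam B)
    (hM : ∀ j s d, Measurable fun z : Box D × I => M j s z.1 d z.2) {k : ℕ} (hk : 1 ≤ k) (j : ℕ)
    (s : Fin K) {A : Box D} (hA : numTrain x A ≤ k) :
    weighted x lam B ρ M (k + 1) j s A = weighted x lam B ρ M k j s A := by
  induction k generalizing j s A with
  | zero => omega
  | succ k ih =>
    refine Measure.ext_of_lintegral _ fun f hf => ?_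
    by_cases h2 : 2 ≤ numTrain x A
    · rw [h.lintegral_weighted_of_two_le hM _ j s h2 hf,
        h.lintegral_weighted_of_two_le hM _ j s h2 hf]
      refine Finset.sum_congr rfl fun s' _ => ?_
      congr 1
      refine Finset.sum_congr rfl fun d _ => ?_
      rcases eq_or_ne (lam A d) 0 with h0 | h0
      · simp [h0]
      congr 1
      refine lintegral_congr_ae ?_
      filter_upwards [h.ae_numTrain_child h2 h0] with l hl
      rw [ih (by omega) (j + 1) s' (A := child A d l true) (by have := hl true; omega),
        ih (by omega) (j + 1) s' (A := child A d l false) (by have := hl false; omega)]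
    · rw [h.lintegral_weighted_of_lt_two hM _ j s h2 hf,
        h.lintegral_weighted_of_lt_two hM _ j s h2 hf]

lemma IsSplitPrior.weighted_eq_of_le (h : IsSplitPrior x lam B)
    (hM : ∀ j s d, Measurable fun z : Box D × I => M j s z.1 d z.2) {k k' : ℕ} (hk : 1 ≤ k)
    (hkk' : k ≤ k') (j : ℕ) (s : Fin K) {A : Box D} (hA : numTrain x A ≤ k) :
    weighted x lam B ρ M k' j s A = weighted x lam B ρ M k j s A := by
  induction k', hkk' using Nat.le_induction with
  | base => rfl
  | succ m hm ih => rw [h.weighted_succ hM (hk.trans hm) j s (hA.trans hm), ih]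

lemma IsSplitPrior.margLik_eq_weighted (h : IsSplitPrior x lam B) (hn : 0 < n)
    (hM : ∀ j s d, Measurable fun z : Box D × I => M j s z.1 d z.2) {k : ℕ} (hk : 1 ≤ k) (j : ℕ)
    (s : Fin K) {A : Box D} (hA : numTrain x A ≤ k) :
    margLik x lam B ρ M j s A = weighted x lam B ρ M k j s A Set.univ := by
  have hL := measurable_treeLik_config hM n j A
  have h1 : margLik x lam B ρ M j s A = weighted x lam B ρ M n j s A Set.univ := by
    rw [weighted, withDensity_apply _ MeasurableSet.univ, Measure.restrict_univ,
      h.lintegral_branch ρ n j s A hL]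
    rfl
  rw [h1, ← h.weighted_eq_of_le hM hn (le_max_left n k) j s (numTrain_le x A),
    ← h.weighted_eq_of_le hM hk (le_max_right n k) j s hA]

/-- The marginal likelihood of a box that is not split is one. -/
lemma IsSplitPrior.margLik_of_lt_two (h : IsSplitPrior x lam B) (hn : 0 < n)
    (hM : ∀ j s d, Measurable fun z : Box D × I => M j s z.1 d z.2) (j : ℕ) (s : Fin K)
    {A : Box D} (hA : ¬ 2 ≤ numTrain x A) : margLik x lam B ρ M j s A = 1 := by
  rw [h.margLik_eq_weighted hn hM (k := 0 + 1) le_rfl j s (by omega), ← lintegral_one,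
    h.lintegral_weighted_of_lt_two hM 0 j s hA measurable_const]
  simpa using sum_pmf (ρ j s)

/-- The recursion for the marginal likelihoods. -/
lemma IsSplitPrior.margLik_of_two_le (h : IsSplitPrior x lam B) (hn : 0 < n)
    (hM : ∀ j s d, Measurable fun z : Box D × I => M j s z.1 d z.2) (j : ℕ) (s : Fin K)
    {A : Box D} (hA : 2 ≤ numTrain x A) :
    margLik x lam B ρ M j s A = ∑ s', ρ j s s' * ∑ d, lam A d *
      splitMass B M (margLik x lam B ρ M) j s' A d := by
  rw [h.margLik_eq_weighted hn hM (k := n + 1) (by omega) j s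
    ((numTrain_le x A).trans (Nat.le_succ n)), ← lintegral_one,
    h.lintegral_weighted_of_two_le hM n j s hA measurable_const]
  simp only [splitMass, lintegral_one, lintegral_const,
    ← h.margLik_eq_weighted hn hM hn _ _ (numTrain_le x _)]
  refine Finset.sum_congr rfl fun s' _ => ?_
  congr 1
  refine Finset.sum_congr rfl fun d _ => ?_
  congr 1
  refine lintegral_congr fun l => ?_
  ring

lemma measurable_margLik {X : Type*} [MeasurableSpace X] (h : IsSplitPrior x lam B)
    {M : X → ℕ → Fin K → Box D → Fin D → I → ℝ≥0∞}
    (hM : ∀ j s d, Measurable fun z : X × Box D × I => M z.1 j s z.2.1 d z.2.2)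
    (j : ℕ) (s : Fin K) :
    Measurable fun z : X × Box D => margLik x lam B ρ (M z.1) j s z.2 := by
  have h1 : ∀ z : X × Box D, margLik x lam B ρ (M z.1) j s z.2 =
      ∫⁻ c, treeLik n (M z.1) j z.2 c.1 c.2 ∂branch (priorMark x lam B ρ) n j s z.2 := fun z => by
    rw [h.lintegral_branch ρ n j s z.2 (measurable_treeLik_config
      (fun j s d => (hM j s d).comp (measurable_prodMk_left (x := z.1))) n j z.2)]
    rfl
  simp only [h1]
  refine measurable_lintegral_param
    (κ := fun z : X × Box D => branch (priorMark x lam B ρ) n j s z.2)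
    (((h.isMarkLaw ρ).measurable_branch n j s).comp measurable_snd)
    (fun z => (h.isMarkLaw ρ).branch_le_one n j s z.2)
    (f := fun z : (X × Box D) × Config D K => treeLik n (M z.1.1) j z.1.2 z.2.1 z.2.2) ?_
  exact (measurable_treeLik hM n j).comp
    (measurable_fst.fst.prodMk (measurable_fst.snd.prodMk measurable_snd))

end WeightedPrior

/-! ### The posterior as a branching process -/

section Posterior

variable {D n K : ℕ} {x : Fin n → Fin D → ℝ} {lam : Box D → Fin D → ℝ≥0∞}
  {B : Fin D → Kernel (Box D) I} {ρ : ℕ → Fin K → PMF (Fin K)}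
  {M : ℕ → Fin K → Box D → Fin D → I → ℝ≥0∞} {Phi : ℕ → Fin K → Box D → ℝ≥0∞}

/-- The integrand of `splitMass`. -/
def splitDensity (M : ℕ → Fin K → Box D → Fin D → I → ℝ≥0∞) (Phi : ℕ → Fin K → Box D → ℝ≥0∞)
    (j : ℕ) (s' : Fin K) (A : Box D) (d : Fin D) (l : I) : ℝ≥0∞ :=
  M j s' A d l * (Phi (j + 1) s' (child A d l false) * Phi (j + 1) s' (child A d l true))

lemma postLoc_eq (j : ℕ) (s' : Fin K) (A : Box D) (d : Fin D) :
    postLoc B M Phi j s' A d =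
      (splitMass B M Phi j s' A d)⁻¹ • (B d A).withDensity (splitDensity M Phi j s' A d) := rfl

lemma measurable_splitDensity (hM : ∀ j s d, Measurable fun z : Box D × I => M j s z.1 d z.2)
    (hPhi : ∀ j s, Measurable (Phi j s)) (j : ℕ) (s' : Fin K) (d : Fin D) :
    Measurable fun z : Box D × I => splitDensity M Phi j s' z.1 d z.2 :=
  (hM j s' d).mul (((hPhi (j + 1) s').comp (measurable_child d false)).mul
    ((hPhi (j + 1) s').comp (measurable_child d true)))

/-- The division by `Φ_s(A)` can be taken out of the integral, whatever its value. -/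
lemma postState_of_two_le (hM : ∀ j s d, Measurable fun z : Box D × I => M j s z.1 d z.2)
    (hPhi : ∀ j s, Measurable (Phi j s)) (j : ℕ) (s : Fin K) {A : Box D}
    (hA : 2 ≤ numTrain x A) (s' : Fin K) :
    postState x lam B ρ M Phi j s A s' =
      ρ j s s' * (∑ d, lam A d * splitMass B M Phi j s' A d) * (Phi j s A)⁻¹ := by
  rw [postState, if_pos hA, mul_assoc, Finset.sum_mul]
  congr 1
  refine Finset.sum_congr rfl fun d _ => ?_
  have hm : Measurable fun l => splitDensity M Phi j s' A d l :=
    (measurable_splitDensity hM hPhi j s' d).comp (measurable_prodMk_left (x := A))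
  rw [mul_assoc]
  congr 1
  refine Eq.trans (lintegral_congr fun l => ?_) (lintegral_mul_const (Phi j s A)⁻¹ hm)
  simp only [div_eq_mul_inv, mul_assoc]

variable [∀ d, IsMarkovKernel (B d)]

lemma measurable_splitMass (hM : ∀ j s d, Measurable fun z : Box D × I => M j s z.1 d z.2)
    (hPhi : ∀ j s, Measurable (Phi j s)) (j : ℕ) (s' : Fin K) (d : Fin D) :
    Measurable fun A => splitMass B M Phi j s' A d :=
  Measurable.lintegral_kernel_prod_right' (κ := B d) (measurable_splitDensity hM hPhi j s' d)

/-- The law of a node's mark under the posterior. -/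
def postMark (x : Fin n → Fin D → ℝ) (lam : Box D → Fin D → ℝ≥0∞)
    (B : Fin D → Kernel (Box D) I) (ρ : ℕ → Fin K → PMF (Fin K))
    (M : ℕ → Fin K → Box D → Fin D → I → ℝ≥0∞) (Phi : ℕ → Fin K → Box D → ℝ≥0∞) :
    ℕ → Fin K → Box D → Measure (Mark D K) :=
  nodeLaw x (postState x lam B ρ M Phi) (postDim lam B M Phi) (postLoc B M Phi)

lemma IsSplitPrior.isMarkLaw_postMark (h : IsSplitPrior x lam B)
    (hM : ∀ j s d, Measurable fun z : Box D × I => M j s z.1 d z.2)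
    (hPhi : ∀ j s, Measurable (Phi j s))
    (hrec : ∀ j s A, 2 ≤ numTrain x A → Phi j s A = ∑ s', ρ j s s' * ∑ d, lam A d *
      splitMass B M Phi j s' A d) :
    IsMarkLaw (postMark x lam B ρ M Phi) := by
  have hG := fun j s' d => measurable_splitMass (B := B) hM hPhi j s' d
  have hsum : ∀ j s', Measurable fun A => ∑ d, lam A d * splitMass B M Phi j s' A d :=
    fun j s' => Finset.measurable_sum _ fun d _ => (h.measurable d).mul (hG j s' d)
  refine isMarkLaw_nodeLaw (fun j s s' => ?_) (fun j s A => ?_) (fun j s d => ?_)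
    (fun j s A hA => ?_) (fun j s d => ?_) fun j s A d => ?_
  · have heq : (fun A => postState x lam B ρ M Phi j s A s') = fun A =>
        if 2 ≤ numTrain x A then
          ρ j s s' * (∑ d, lam A d * splitMass B M Phi j s' A d) * (Phi j s A)⁻¹
        else ρ j s s' := by
      funext A
      split_ifs with hA
      · exact postState_of_two_le hM hPhi j s hA s'
      · rw [postState, if_neg hA]
    rw [heq]
    exact Measurable.ite (measurableSet_two_le_numTrain x)
      (((hsum j s').const_mul _).mul (hPhi j s).inv) measurable_const
  · by_cases hA : 2 ≤ numTrain x A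
    · simp only [postState_of_two_le hM hPhi j s hA]
      rw [← Finset.sum_mul, ← hrec j s A hA]
      exact ENNReal.mul_inv_le_one _
    · simp only [postState, if_neg hA]
      exact (sum_pmf _).le
  · exact ((h.measurable d).mul (hG j s d)).div (hsum j s)
  · simp only [postDim, div_eq_mul_inv]
    rw [← Finset.sum_mul]
    exact ENNReal.mul_inv_le_one _
  · refine Measure.measurable_of_measurable_coe _ fun t ht => ?_
    simp only [postLoc_eq, Measure.smul_apply, withDensity_apply _ ht, smul_eq_mul,
      ← lintegral_indicator ht]
    refine (hG j s d).inv.mul ?_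
    exact Measurable.lintegral_kernel_prod_right' (κ := B d)
      (f := fun z => t.indicator (splitDensity M Phi j s z.1 d) z.2)
      ((measurable_splitDensity hM hPhi j s d).indicator (measurable_snd ht))
  · rw [postLoc_eq, Measure.smul_apply, withDensity_apply _ MeasurableSet.univ,
      Measure.restrict_univ, smul_eq_mul]
    exact ENNReal.inv_mul_le_one _

/-- Where the marginal likelihood is finite, the prior weighted by the likelihood is the marginal
likelihood times the branching process with the posterior marks. -/
lemma IsSplitPrior.weighted_eq_smul_branch (h : IsSplitPrior x lam B) (hn : 0 < n)
    (hM : ∀ j s d, Measurable fun z : Box D × I => M j s z.1 d z.2) {k : ℕ} (hk : 1 ≤ k) (j : ℕ)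
    (s : Fin K) {A : Box D} (hA : numTrain x A ≤ k)
    (hfin : margLik x lam B ρ M j s A ≠ ∞) :
    weighted x lam B ρ M k j s A = margLik x lam B ρ M j s A •
      branch (postMark x lam B ρ M (margLik x lam B ρ M)) k j s A := by
  set Phi := margLik x lam B ρ M with hPhidef
  have hPhi : ∀ j s, Measurable (Phi j s) := fun j s =>
    (measurable_margLik (X := Unit) (M := fun _ => M) h
      (fun j s d => (hM j s d).comp measurable_snd) j s).comp
      (measurable_prodMk_left (x := ()))
  have hrec := fun j s A (hA : 2 ≤ numTrain x A) => h.margLik_of_two_le (ρ := ρ) hn hM j s hA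
  have hq := h.isMarkLaw_postMark (ρ := ρ) hM hPhi hrec
  have hbfin := fun k j s A => hq.isFiniteMeasure_branch k j s A
  induction k generalizing j s A with
  | zero => omega
  | succ k ih =>
    -- where the marginal likelihood is zero, `weighted` is the zero measure
    rcases eq_or_ne (Phi j s A) 0 with h0 | h0
    · rw [h0, zero_smul, ← Measure.measure_univ_eq_zero,
        ← h.margLik_eq_weighted hn hM hk j s hA]
      exact h0
    refine Measure.ext_of_lintegral _ fun f hf => ?_
    rw [lintegral_smul_measure, smul_eq_mul]
    by_cases h2 : 2 ≤ numTrain x A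
    · rw [h.lintegral_weighted_of_two_le hM k j s h2 hf, postMark,
        lintegral_branch_of_two_le hq k j s h2 hf, Finset.mul_sum]
      refine Finset.sum_congr rfl fun s' _ => ?_
      rw [postState_of_two_le hM hPhi j s h2]
      set tot := ∑ d, lam A d * splitMass B M Phi j s' A d with htot
      rcases eq_or_ne (ρ j s s') 0 with hρ | hρ
      · simp [hρ]
      -- finiteness of `Φ_s(A)` passes to every term of the recursion with nonzero prior weight
      have htot_fin : tot ≠ ∞ := by
        intro htop
        refine hfin ?_
        rw [hPhidef, hrec j s A h2]
        refine ENNReal.sum_eq_top.2 ⟨s', Finset.mem_univ _, ?_⟩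
        rw [← hPhidef, ← htot, htop, ENNReal.mul_top hρ]
      have hcancel : ∀ r, Phi j s A * (ρ j s s' * tot * (Phi j s A)⁻¹ * r) =
          ρ j s s' * (tot * r) := fun r => by
        calc _ = (Phi j s A * (Phi j s A)⁻¹) * (ρ j s s' * (tot * r)) := by ring
          _ = _ := by rw [ENNReal.mul_inv_cancel h0 hfin, one_mul]
      rw [hcancel]
      congr 1
      rw [Finset.mul_sum]
      refine Finset.sum_congr rfl fun d _ => ?_
      rcases eq_or_ne (lam A d) 0 with hd | hd
      · simp [hd, postDim]
      set G := splitMass B M Phi j s' A d with hG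
      have hG_le : lam A d * G ≤ tot :=
        Finset.single_le_sum (f := fun d => lam A d * splitMass B M Phi j s' A d)
          (fun _ _ => zero_le) (Finset.mem_univ d)
      have hG_fin : G ≠ ∞ := fun htop => htot_fin (top_le_iff.1 (by
        rwa [htop, ENNReal.mul_top hd] at hG_le))
      have hdens : Measurable (splitDensity M Phi j s' A d) :=
        (measurable_splitDensity hM hPhi j s' d).comp (measurable_prodMk_left (x := A))
      let H : I → ℝ≥0∞ := fun l => ∫⁻ cl, ∫⁻ cr, f (glue (s', some (d, l)) (cl, cr))
        ∂branch (postMark x lam B ρ M Phi) k (j + 1) s' (child A d l true)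
        ∂branch (postMark x lam B ρ M Phi) k (j + 1) s' (child A d l false)
      have hH : Measurable H := by
        have hb := fun b => (hq.measurable_branch k (j + 1) s').comp
          ((measurable_child d b).comp (measurable_prodMk_left (x := A)))
        refine measurable_lintegral_param (hb false) (fun _ => hq.branch_le_one _ _ _ _)
          (f := fun z : I × Config D K => ∫⁻ cr, f (glue (s', some (d, z.1)) (z.2, cr))
            ∂branch (postMark x lam B ρ M Phi) k (j + 1) s' (child A d z.1 true)) ?_
        refine measurable_lintegral_param ((hb true).comp measurable_fst)
          (fun _ => hq.branch_le_one _ _ _ _)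
          (f := fun w : (I × Config D K) × Config D K =>
            f (glue (s', some (d, w.1.1)) (w.1.2, w.2))) ?_
        exact hf.comp (measurable_glue.comp (((measurable_mark s' d).comp
          measurable_fst.fst).prodMk (measurable_fst.snd.prodMk measurable_snd)))
      -- The induction hypothesis applies only to children of finite marginal likelihood. Almost
      -- everywhere the split density is finite, so an infinite `Φ` at one child forces the local
      -- likelihood, or `Φ` at the other child, to be zero, and then both sides vanish.
      have hpt : ∀ᵐ l ∂B d A, M j s' A d l * ∫⁻ cl, ∫⁻ cr, f (glue (s', some (d, l)) (cl, cr))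
          ∂weighted x lam B ρ M k (j + 1) s' (child A d l true)
          ∂weighted x lam B ρ M k (j + 1) s' (child A d l false) =
          splitDensity M Phi j s' A d l * H l := by
        filter_upwards [h.ae_numTrain_child h2 hd, ae_lt_top hdens hG_fin] with l hl hlfin
        have hk1 : 1 ≤ k := by have := hl true; omega
        have hle : ∀ b, numTrain x (child A d l b) ≤ k := fun b => by have := hl b; omega
        have hzero : ∀ b, Phi (j + 1) s' (child A d l b) = 0 →
            weighted x lam B ρ M k (j + 1) s' (child A d l b) = 0 := fun b hb => by
          rw [← Measure.measure_univ_eq_zero,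
            ← h.margLik_eq_weighted hn hM hk1 (j + 1) s' (hle b)]
          exact hb
        rcases eq_or_ne (M j s' A d l) 0 with hM0 | hM0
        · simp [splitDensity, hM0]
        by_cases hl0 : Phi (j + 1) s' (child A d l false) = 0
        · rw [hzero false hl0]
          simp [splitDensity, hl0]
        by_cases hr0 : Phi (j + 1) s' (child A d l true) = 0
        · rw [hzero true hr0]
          simp [splitDensity, hr0]
        have hprod : Phi (j + 1) s' (child A d l false) * Phi (j + 1) s' (child A d l true) ≠ ∞ :=
          fun htop => hlfin.ne (by rw [splitDensity, htop, ENNReal.mul_top hM0])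
        have hlf : Phi (j + 1) s' (child A d l false) ≠ ∞ := fun htop =>
          hprod (by rw [htop, ENNReal.top_mul hr0])
        have hrf : Phi (j + 1) s' (child A d l true) ≠ ∞ := fun htop =>
          hprod (by rw [htop, ENNReal.mul_top hl0])
        rw [ih hk1 (j + 1) s' (hle true) hrf, ih hk1 (j + 1) s' (hle false) hlf]
        simp only [lintegral_smul_measure, smul_eq_mul]
        have := hbfin k (j + 1) s' (child A d l true)
        have hmeas : Measurable fun cl => ∫⁻ cr, f (glue (s', some (d, l)) (cl, cr))
            ∂branch (postMark x lam B ρ M Phi) k (j + 1) s' (child A d l true) :=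
          Measurable.lintegral_prod_right' (hf.comp (measurable_glue_right _))
        rw [lintegral_const_mul _ hmeas, splitDensity]
        ring
      have hwd : ∫⁻ l, H l ∂(B d A).withDensity (splitDensity M Phi j s' A d) =
          ∫⁻ l, splitDensity M Phi j s' A d l * H l ∂B d A :=
        lintegral_withDensity_eq_lintegral_mul _ hdens hH
      rw [lintegral_congr_ae hpt, postLoc_eq, lintegral_smul_measure, smul_eq_mul]
      change _ = tot * (_ * (_ * ∫⁻ l, H l ∂(B d A).withDensity (splitDensity M Phi j s' A d)))
      rw [hwd, ← hG, postDim, ← htot, ← hG]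
      -- when `G = 0` the normalizing constants are degenerate, but both sides are zero
      rcases eq_or_ne G 0 with hG0 | hG0
      · have hz : ∫⁻ l, splitDensity M Phi j s' A d l * H l ∂B d A = 0 := by
          have h1 : splitDensity M Phi j s' A d =ᵐ[B d A] 0 :=
            (lintegral_eq_zero_iff hdens).1 hG0
          refine (lintegral_congr_ae ?_).trans lintegral_zero
          filter_upwards [h1] with l hl
          simp [hl]
        rw [hz]
        simp
      · have htot0 : tot ≠ 0 := fun h' => by
          have := hG_le.trans h'.le
          simp [hd, hG0] at this
        calc _ = (tot * tot⁻¹) * (G * G⁻¹) *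
              (lam A d * ∫⁻ l, splitDensity M Phi j s' A d l * H l ∂B d A) := by
              rw [ENNReal.mul_inv_cancel htot0 htot_fin, ENNReal.mul_inv_cancel hG0 hG_fin]
              simp
          _ = _ := by rw [div_eq_mul_inv]; ring
    · rw [h.lintegral_weighted_of_lt_two hM k j s h2 hf, postMark,
        lintegral_branch_of_lt_two hq k j s h2 hf, hPhidef, h.margLik_of_lt_two hn hM j s h2,
        one_mul]
      simp only [postState, if_neg h2]

end Posterior

/-! ### Completely grown trees -/

section Full

variable {D n K : ℕ} {x : Fin n → Fin D → ℝ}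

/-- A completely grown tree with root box `A`, with all its states: every node contains a training
location, exactly the non-atomic nodes are split, and exactly the nodes carry a state. -/
def Full (x : Fin n → Fin D → ℝ) (A : Box D) (c : Config D K) : Prop :=
  ∀ a, (IsNode c.1 a → 0 < numTrain x (region A c.1 a)) ∧
    (c.1 a ≠ none ↔ IsNode c.1 a ∧ 2 ≤ numTrain x (region A c.1 a)) ∧
    (c.2 a ≠ none ↔ IsNode c.1 a)

lemma Full.numTrain_pos {A : Box D} {c : Config D K} (h : Full x A c) : 0 < numTrain x A :=
  (h []).1 trivial

lemma Full.of_some {A : Box D} {c : Config D K} (h : Full x A c) {d : Fin D} {l : I}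
    (hc : c.1 [] = some (d, l)) (b : Bool) : Full x (child A d l b) (csub c b) := by
  intro a
  have hne : c.1 [] ≠ none := by simp [hc]
  have hiff : IsNode c.1 (b :: a) ↔ IsNode (csub c b).1 a :=
    ⟨fun h' => h'.2, fun h' => ⟨hne, h'⟩⟩
  have := h (b :: a)
  rw [region_cons hc, hiff] at this
  exact this

lemma Full.eq_none {A : Box D} {c : Config D K} (h : Full x A c) (hc : c.1 [] = none) :
    numTrain x A = 1 ∧ (∀ a, c.1 a = none) ∧ ∀ a, c.2 a ≠ none ↔ a = [] := by
  have hnode : ∀ a, IsNode c.1 a ↔ a = [] := fun a => by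
    cases a with
    | nil => simp [IsNode]
    | cons b a => simp [IsNode, hc]
  have hA : numTrain x A = 1 := by
    have h1 := h.numTrain_pos
    have h2 : ¬ (IsNode c.1 [] ∧ 2 ≤ numTrain x (region A c.1 [])) := fun h' =>
      ((h []).2.1.2 h') hc
    have h3 : ¬ 2 ≤ numTrain x A := fun h' => h2 ⟨trivial, h'⟩
    omega
  refine ⟨hA, fun a => ?_, fun a => (h a).2.2.trans (hnode a)⟩
  by_contra hne
  have := (hnode a).1 ((h a).2.1.1 hne).1
  subst this
  exact hne hc

lemma Full.child_lt {A : Box D} {c : Config D K} (h : Full x A c) {d : Fin D} {l : I}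
    (hc : c.1 [] = some (d, l)) (b : Bool) : numTrain x (child A d l b) < numTrain x A := by
  have h0 := (h.of_some hc false).numTrain_pos
  have h1 := (h.of_some hc true).numTrain_pos
  have hadd := numTrain_child_add x A d l
  cases b <;> omega

/-- Induction along a completely grown tree. -/
lemma Full.induction {motive : Box D → Config D K → Prop}
    (leaf : ∀ A c, numTrain x A = 1 → (∀ a, c.1 a = none) → (∀ a, c.2 a ≠ none ↔ a = []) →
      motive A c)
    (node : ∀ A c d l, Full x A c → c.1 [] = some (d, l) →
      (∀ b, motive (child A d l b) (csub c b)) → motive A c)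
    {A : Box D} {c : Config D K} (h : Full x A c) : motive A c := by
  induction hN : numTrain x A using Nat.strong_induction_on generalizing A c with
  | _ N ih =>
    cases hc : c.1 [] with
    | none =>
      obtain ⟨h1, h2, h3⟩ := h.eq_none hc
      exact leaf A c h1 h2 h3
    | some e =>
      exact node A c e.1 e.2 h hc fun b => ih _ (hN ▸ h.child_lt hc b) (h.of_some hc b) rfl

lemma Full.length_lt {A : Box D} {c : Config D K} (h : Full x A c) :
    ∀ a, c.2 a ≠ none → a.length < numTrain x A := by
  refine Full.induction (motive := fun A c => ∀ a, c.2 a ≠ none → a.length < numTrain x A)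
    ?_ ?_ h
  · intro A c h1 h2 h3 a ha
    simp [(h3 a).1 ha, h1]
  · intro A c d l h hc ih a ha
    cases a with
    | nil => exact h.numTrain_pos
    | cons b a => exact Nat.lt_of_le_of_lt (ih b a ha) (h.child_lt hc b)

lemma Full.state_ne_none {A : Box D} {c : Config D K} (h : Full x A c) {a : Addr}
    (ha : c.1 a ≠ none) : c.2 a ≠ none := (h a).2.2.2 ((h a).2.1.1 ha).1

/-- A tree with `N` leaves has `N - 1` internal nodes. -/
lemma Full.card_internal {A : Box D} {c : Config D K} (h : Full x A c) :
    ∀ k, numTrain x A ≤ k → (internal k c.1).card + 1 = numTrain x A := by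
  have hcard : ∀ k (T : Tree D), (internal k T).card =
      ∑ a ∈ addrs k, if (T a).isSome then 1 else 0 := fun k T => by
    rw [internal, Finset.card_filter]
  simp only [hcard]
  refine Full.induction (motive := fun A c => ∀ k, numTrain x A ≤ k →
    (∑ a ∈ addrs k, if (c.1 a).isSome then 1 else 0) + 1 = numTrain x A) ?_ ?_ h
  · intro A c h1 h2 h3 k _
    simp [h1, h2]
  · intro A c d l h hc ih k hk
    obtain ⟨k, rfl⟩ : ∃ k', k = k' + 1 := ⟨k - 1, by have := h.numTrain_pos; omega⟩
    have h0 : (∑ a ∈ addrs k, if (c.1 (false :: a)).isSome then 1 else 0) + 1 =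
        numTrain x (child A d l false) := ih false k (by have := h.child_lt hc false; omega)
    have h1 : (∑ a ∈ addrs k, if (c.1 (true :: a)).isSome then 1 else 0) + 1 =
        numTrain x (child A d l true) := ih true k (by have := h.child_lt hc true; omega)
    have hadd := numTrain_child_add x A d l
    rw [sum_addrs_succ, hc]
    simp only [Option.isSome_some, if_true]
    omega

/-- A tree with `N` leaves has `2 N - 1` nodes. -/
lemma Full.card_states {A : Box D} {c : Config D K} (h : Full x A c) :
    ∀ k, numTrain x A ≤ k →
      ((addrs k).filter fun a => (c.2 a).isSome).card + 1 = 2 * numTrain x A := by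
  simp only [Finset.card_filter]
  refine Full.induction (motive := fun A c => ∀ k, numTrain x A ≤ k →
    (∑ a ∈ addrs k, if (c.2 a).isSome then 1 else 0) + 1 = 2 * numTrain x A) ?_ ?_ h
  · intro A c h1 h2 h3 k hk
    have : ∀ a, (if (c.2 a).isSome then 1 else 0) = if a = [] then 1 else 0 := fun a => by
      congr 1
      simp [← h3 a, Option.isSome_iff_ne_none]
    simp only [this, h1, Finset.sum_ite_eq']
    rw [if_pos (mem_addrs.2 (by simp; omega))]
  · intro A c d l h hc ih k hk
    obtain ⟨k, rfl⟩ : ∃ k', k = k' + 1 := ⟨k - 1, by have := h.numTrain_pos; omega⟩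
    have h0 : (∑ a ∈ addrs k, if (c.2 (false :: a)).isSome then 1 else 0) + 1 =
        2 * numTrain x (child A d l false) := ih false k (by have := h.child_lt hc false; omega)
    have h1 : (∑ a ∈ addrs k, if (c.2 (true :: a)).isSome then 1 else 0) + 1 =
        2 * numTrain x (child A d l true) := ih true k (by have := h.child_lt hc true; omega)
    have hadd := numTrain_child_add x A d l
    have hs : (c.2 []).isSome := Option.isSome_iff_ne_none.2 (h.state_ne_none (by simp [hc]))
    rw [sum_addrs_succ, hs]
    simp only [if_true]
    omega

lemma full_glue_some {A : Box D} {d : Fin D} {l : I} (hA : 2 ≤ numTrain x A) (s' : Fin K)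
    {cl cr : Config D K} (hl : Full x (child A d l false) cl) (hr : Full x (child A d l true) cr) :
    Full x A (glue (s', some (d, l)) (cl, cr)) := by
  intro a
  have hroot : (glue (s', some (d, l)) (cl, cr)).1 [] = some (d, l) := rfl
  cases a with
  | nil =>
    refine ⟨fun _ => Nat.lt_of_lt_of_le (by norm_num) hA, ⟨fun _ => ⟨trivial, hA⟩, fun _ => ?_⟩,
      ⟨fun _ => trivial, fun _ => ?_⟩⟩ <;> simp
  | cons b a =>
    have hiff : IsNode (glue (s', some (d, l)) (cl, cr)).1 (b :: a) ↔
        IsNode (csub (glue (s', some (d, l)) (cl, cr)) b).1 a :=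
      ⟨fun h' => h'.2, fun h' => ⟨by simp, h'⟩⟩
    rw [region_cons hroot, hiff]
    cases b
    · exact hl a
    · exact hr a

lemma full_glue_none {A : Box D} (hA : numTrain x A = 1) (s' : Fin K) :
    Full x A (glue (s', none) ((blank, blank), (blank, blank))) := by
  intro a
  cases a with
  | nil => simp [IsNode, region, hA]
  | cons b a => cases b <;> simp [glue, graft, IsNode, blank]

lemma measurableSet_full (x : Fin n → Fin D → ℝ) (A : Box D) :
    MeasurableSet {c : Config D K | Full x A c} := by
  have h1 := fun a => (measurableSet_isNode (D := D) a).preimage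
    (measurable_fst : Measurable fun c : Config D K => c.1)
  have hN : ∀ a, Measurable fun c : Config D K => numTrain x (region A c.1 a) := fun a =>
    (measurable_numTrain x).comp ((measurable_region a).comp
      (measurable_const.prodMk measurable_fst))
  have h2 := fun a => measurableSet_eq_none (measurable_tree_apply (D := D) (K := K) a)
  have h3 := fun a => measurableSet_eq_none (measurable_state_apply (D := D) (K := K) a)
  have hpos := fun a => (hN a) (measurableSet_Ioi (a := 0))
  have htwo := fun a => (hN a) (measurableSet_Ici (a := 2))
  have : {c : Config D K | Full x A c} = ⋂ a,
      {c | (IsNode c.1 a → 0 < numTrain x (region A c.1 a)) ∧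
      (c.1 a ≠ none ↔ IsNode c.1 a ∧ 2 ≤ numTrain x (region A c.1 a)) ∧
      (c.2 a ≠ none ↔ IsNode c.1 a)} := by
    ext c; simp [Full]
  rw [this]
  refine MeasurableSet.iInter fun a => ?_
  exact ((h1 a).imp (hpos a)).inter (((h2 a).compl.iff ((h1 a).inter (htwo a))).inter
    ((h3 a).compl.iff (h1 a)))

variable {lam : Box D → Fin D → ℝ≥0∞} {B : Fin D → Kernel (Box D) I}
  [∀ d, IsMarkovKernel (B d)] {ρ : ℕ → Fin K → PMF (Fin K)}

/-- Under the prior the tree is completely grown almost surely. -/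
lemma IsSplitPrior.ae_full (h : IsSplitPrior x lam B) (k j : ℕ) (s : Fin K) {A : Box D}
    (hA : 0 < numTrain x A) (hk : numTrain x A ≤ k) :
    ∀ᵐ c ∂branch (priorMark x lam B ρ) k j s A, Full x A c := by
  induction k generalizing j s A with
  | zero => omega
  | succ k ih =>
    have hset := (measurableSet_full (K := K) x A).compl
    rw [ae_iff, ← Set.compl_ofPred, ← lintegral_indicator_one hset, priorMark]
    have hf : Measurable (({c : Config D K | Full x A c}ᶜ).indicator (1 : Config D K → ℝ≥0∞)) :=
      measurable_one.indicator hset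
    by_cases h2 : 2 ≤ numTrain x A
    · rw [lintegral_branch_of_two_le (h.isMarkLaw ρ) k j s h2 hf]
      refine Finset.sum_eq_zero fun s' _ => mul_eq_zero_of_right _ ?_
      refine Finset.sum_eq_zero fun d _ => ?_
      rcases eq_or_ne (lam A d) 0 with hd | hd
      · rw [hd, zero_mul]
      refine mul_eq_zero_of_right _ ((lintegral_congr_ae ?_).trans lintegral_zero)
      filter_upwards [h.ae_numTrain_child h2 hd] with l hl
      have hb := fun b => ih (j + 1) s' (A := child A d l b) (hl b).1
        (by have := (hl b).2; omega)
      refine (lintegral_congr_ae ?_).trans lintegral_zero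
      filter_upwards [hb false] with cl hcl
      refine (lintegral_congr_ae ?_).trans lintegral_zero
      filter_upwards [hb true] with cr hcr
      exact Set.indicator_of_notMem (Set.notMem_compl_iff.2 (full_glue_some h2 s' hcl hcr)) _
    · rw [lintegral_branch_of_lt_two (h.isMarkLaw ρ) k j s h2 hf]
      refine Finset.sum_eq_zero fun s' _ => mul_eq_zero_of_right _ ?_
      exact Set.indicator_of_notMem (Set.notMem_compl_iff.2 (full_glue_none (by omega) s')) _

end Full

/-! ### Revealing a completely grown tree terminates -/

section Termination

variable {D n K : ℕ} {x : Fin n → Fin D → ℝ} {next : Config D K → Option Addr}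

/-- What has been revealed of a tree agrees with it. -/
lemma reveal_agrees (next : Config D K → Option Addr) (c : Config D K) (k : ℕ) (a : Addr) :
    ((reveal next c k).1 a = none ∧ (reveal next c k).2 a = none) ∨
      ((reveal next c k).1 a = c.1 a ∧ (reveal next c k).2 a = c.2 a) := by
  induction k with
  | zero => exact Or.inl ⟨rfl, rfl⟩
  | succ k ih =>
    rw [reveal_succ, revealStep]
    split
    · exact ih
    · rename_i a' _
      by_cases ha : a = a'
      · subst ha
        exact Or.inr (by simp)
      · simpa [Function.update_apply, ha] using ih

lemma isNode_of_agrees {T R : Tree D} (h : ∀ a, IsNode R a → R a = T a) {a : Addr}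
    (ha : IsNode T a) : IsNode R a := by
  induction a generalizing T R with
  | nil => trivial
  | cons b a ih =>
    have hroot : R [] = T [] := h [] trivial
    have hne : R [] ≠ none := hroot ▸ ha.1
    exact ⟨hne, ih (fun a' ha' => h (b :: a') ⟨hne, ha'⟩) ha.2⟩

lemma isNode_reveal {c : Config D K} {k : ℕ} {a : Addr} (ha : IsNode (reveal next c k).1 a) :
    IsNode c.1 a := by
  refine isNode_mono (fun a' ha' => ?_) ha
  rcases reveal_agrees next c k a' with h' | h'
  · exact absurd h'.1 ha'
  · exact h'.1 ▸ ha'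

lemma reveal_eq_of_next_none (hnext : IsSchedule next) {A : Box D} {c : Config D K}
    (h : Full x A c) {k : ℕ} (hk : next (reveal next c k) = none) : reveal next c k = c := by
  have hdone : ∀ a, IsNode (reveal next c k).1 a → (reveal next c k).1 a = c.1 a ∧
      (reveal next c k).2 a = c.2 a := fun a ha => by
    rcases reveal_agrees next c k a with h' | h'
    · exact absurd ⟨ha, h'.2⟩ (hnext.exhausted _ hk a)
    · exact h'
  have hall : ∀ a, (reveal next c k).1 a = c.1 a ∧ (reveal next c k).2 a = c.2 a := fun a => by
    by_cases ha : IsNode c.1 a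
    · exact hdone a (isNode_of_agrees (fun a ha => (hdone a ha).1) ha)
    · have h1 : c.1 a = none := by
        by_contra h'
        exact ha ((h a).2.1.1 h').1
      have h2 : c.2 a = none := by
        by_contra h'
        exact ha ((h a).2.2.1 h')
      rcases reveal_agrees next c k a with h' | h'
      · exact ⟨h'.1.trans h1.symm, h'.2.trans h2.symm⟩
      · exact h'
  exact Prod.ext (funext fun a => (hall a).1) (funext fun a => (hall a).2)

lemma next_eq_none_of_full (hnext : IsSchedule next) {A : Box D} {c : Config D K}
    (h : Full x A c) : next c = none := by
  by_contra hne
  obtain ⟨a, ha⟩ := Option.ne_none_iff_exists'.1 hne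
  obtain ⟨h1, h2⟩ := hnext.pending _ _ ha
  exact (h a).2.2.2 h1 h2

/-- As long as the tree is not completely revealed, every step reveals one more node. -/
lemma reveal_eq_or_le_card (hnext : IsSchedule next) {A : Box D} {c : Config D K}
    (h : Full x A c) (k : ℕ) :
    reveal next c k = c ∨
      k ≤ ((addrs n).filter fun a => ((reveal next c k).2 a).isSome).card := by
  induction k with
  | zero => exact Or.inr (Nat.zero_le _)
  | succ k ih =>
    rcases ih with ih | ih
    · left
      rw [reveal_succ, ih, revealStep, next_eq_none_of_full hnext h]
    · cases hk : next (reveal next c k) with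
      | none =>
        left
        rw [reveal_succ, revealStep, hk]
        exact reveal_eq_of_next_none hnext h hk
      | some a =>
        right
        obtain ⟨h1, h2⟩ := hnext.pending _ _ hk
        have hca : c.2 a ≠ none := (h a).2.2.2 (isNode_reveal h1)
        have hlen : a.length < n := (h.length_lt a hca).trans_le (numTrain_le x A)
        rw [reveal_succ, revealStep, hk]
        refine Nat.succ_le_of_lt (ih.trans_lt (Finset.card_lt_card ?_))
        rw [Finset.ssubset_iff_of_subset]
        · refine ⟨a, ?_, ?_⟩
          · simpa [mem_addrs, hlen, Option.isSome_iff_ne_none] using hca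
          · simp [h2]
        · intro a' ha'
          have hne : a' ≠ a := by
            rintro rfl
            simp [h2] at ha'
          simpa [Function.update_apply, hne] using ha'

/-- A completely grown tree is revealed after `2 n - 1` steps. -/
lemma reveal_eq_self (hnext : IsSchedule next) {A : Box D} {c : Config D K}
    (h : Full x A c) {N : ℕ} (hN : 2 * n - 1 ≤ N) : reveal next c N = c := by
  rcases reveal_eq_or_le_card hnext h N with h' | h'
  · exact h'
  have hcard := h.card_states n (numTrain_le x A)
  have hsub : ((addrs n).filter fun a => ((reveal next c N).2 a).isSome) ⊆
      (addrs n).filter fun a => (c.2 a).isSome := fun a ha => by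
    simp only [Finset.mem_filter] at ha ⊢
    refine ⟨ha.1, ?_⟩
    rcases reveal_agrees next c N a with h'' | h''
    · simp [h''.2] at ha
    · exact h''.2 ▸ ha.2
  have hle := numTrain_le x A
  have heq := Finset.eq_of_subset_of_card_le hsub (by omega)
  have hall : ∀ a, (reveal next c N).1 a = c.1 a ∧ (reveal next c N).2 a = c.2 a := fun a => by
    rcases reveal_agrees next c N a with h'' | h''
    · have h2 : c.2 a = none := by
        by_contra hne
        have hmem : a ∈ (addrs n).filter fun a => (c.2 a).isSome := by
          simp only [Finset.mem_filter, mem_addrs, Option.isSome_iff_ne_none]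
          exact ⟨(h.length_lt a hne).trans_le hle, hne⟩
        rw [← heq] at hmem
        simp [h''.2] at hmem
      have h1 : c.1 a = none := by
        by_contra hne
        exact h.state_ne_none hne h2
      exact ⟨h''.1.trans h1.symm, h''.2.trans h2.symm⟩
    · exact h''
  exact Prod.ext (funext fun a => (hall a).1) (funext fun a => (hall a).2)

end Termination

/-! ### Parseval's identity for unbalanced Haar wavelets -/

section Parseval

variable {D n K : ℕ} {x : Fin n → Fin D → ℝ} {m : Fin n → ℝ}

open Classical in
/-- The sum of `f` over the training locations in a box. -/
def boxSum (x : Fin n → Fin D → ℝ) (A : Box D) (f : Fin n → ℝ) : ℝ :=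
  ∑ i, if InBox A (x i) then f i else 0

lemma mass_eq_boxSum (x : Fin n → Fin D → ℝ) (m : Fin n → ℝ) (A : Box D) :
    mass x m A = boxSum x A m := rfl

lemma boxSum_child_add (x : Fin n → Fin D → ℝ) (A : Box D) (d : Fin D) (l : I)
    (f : Fin n → ℝ) :
    boxSum x (child A d l false) f + boxSum x (child A d l true) f = boxSum x A f := by
  classical
  simp only [boxSum, ← Finset.sum_add_distrib]
  exact Finset.sum_congr rfl fun i _ => ite_inBox_child_add A d l (x i) (f i)

lemma mass_pos (hm : ∀ i, 0 < m i) {A : Box D} (hA : 0 < numTrain x A) : 0 < mass x m A := by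
  classical
  obtain ⟨i, hi⟩ := Finset.card_pos.1 hA
  refine Finset.sum_pos' (fun j _ => ?_) ⟨i, Finset.mem_univ i, ?_⟩
  · split_ifs
    exacts [(hm j).le, le_rfl]
  · rw [if_pos (Finset.mem_filter.1 hi).2]
    exact hm i

lemma coef_eq (x : Fin n → Fin D → ℝ) (m : Fin n → ℝ) (A : Box D) (d : Fin D) (l : I)
    (y : Fin n → ℝ) :
    coef x m A d l y =
      Real.sqrt (mass x m (child A d l false) * mass x m (child A d l true) / mass x m A) *
        (boxSum x (child A d l false) (fun i => m i * y i) / mass x m (child A d l false) -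
          boxSum x (child A d l true) (fun i => m i * y i) / mass x m (child A d l true)) := by
  classical
  simp only [coef, psi, boxSum, Finset.sum_div, ← Finset.sum_sub_distrib, Finset.mul_sum]
  refine Finset.sum_congr rfl fun i _ => ?_
  by_cases h1 : InBox (child A d l false) (x i) <;> by_cases h2 : InBox (child A d l true) (x i) <;>
    simp [h1, h2] <;> ring

/-- The wavelet coefficient carries exactly what is lost in passing from the averages over the two
children to the average over their parent. -/
lemma coef_sq (hm : ∀ i, 0 < m i) {A : Box D} {d : Fin D} {l : I}
    (h : ∀ b, 0 < numTrain x (child A d l b)) (y : Fin n → ℝ) :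
    boxSum x A (fun i => m i * y i) ^ 2 / mass x m A + coef x m A d l y ^ 2 =
      boxSum x (child A d l false) (fun i => m i * y i) ^ 2 / mass x m (child A d l false) +
        boxSum x (child A d l true) (fun i => m i * y i) ^ 2 / mass x m (child A d l true) := by
  have hl := mass_pos (x := x) hm (h false)
  have hr := mass_pos (x := x) hm (h true)
  have hM : mass x m (child A d l false) + mass x m (child A d l true) = mass x m A :=
    boxSum_child_add x A d l m
  have hS := boxSum_child_add x A d l fun i => m i * y i
  rw [coef_eq, mul_pow, Real.sq_sqrt (by rw [← hM]; positivity), ← hM, ← hS]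
  have hlr := (add_pos hl hr).ne'
  field_simp
  ring

lemma coefAt_of_none {A : Box D} {T : Tree D} {a : Addr} (h : T a = none) (y : Fin n → ℝ) :
    coefAt x m A T y a = 0 := by
  rw [coefAt, h]

lemma coefAt_of_some {A : Box D} {T : Tree D} {a : Addr} {d : Fin D} {l : I}
    (h : T a = some (d, l)) (y : Fin n → ℝ) :
    coefAt x m A T y a = coef x m (region A T a) d l y := by
  rw [coefAt, h]

lemma coefAt_cons {A : Box D} {T : Tree D} {d : Fin D} {l : I} (h : T [] = some (d, l)) (b : Bool)
    (y : Fin n → ℝ) (a : Addr) :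
    coefAt x m A T y (b :: a) = coefAt x m (child A d l b) (sub T b) y a := by
  simp only [coefAt, region_cons h, sub]

/-- The wavelets of a completely grown tree, together with the constants, satisfy Parseval's
identity. -/
lemma Full.parseval (hm : ∀ i, 0 < m i) (y : Fin n → ℝ) {A : Box D} {c : Config D K}
    (h : Full x A c) : ∀ k, numTrain x A ≤ k →
      boxSum x A (fun i => m i * y i ^ 2) = boxSum x A (fun i => m i * y i) ^ 2 / mass x m A +
        ∑ a ∈ addrs k, coefAt x m A c.1 y a ^ 2 := by
  classical
  refine Full.induction (motive := fun A c => ∀ k, numTrain x A ≤ k →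
    boxSum x A (fun i => m i * y i ^ 2) = boxSum x A (fun i => m i * y i) ^ 2 / mass x m A +
      ∑ a ∈ addrs k, coefAt x m A c.1 y a ^ 2) ?_ ?_ h
  · intro A c h1 h2 _ k _
    obtain ⟨i, hi⟩ := Finset.card_eq_one.1 h1
    have hsum : ∀ f : Fin n → ℝ, boxSum x A f = f i := fun f => by
      rw [boxSum, ← Finset.sum_filter]
      have : (Finset.univ.filter fun i => InBox A (x i)) = {i} := by rw [← hi]
      rw [this, Finset.sum_singleton]
    rw [mass_eq_boxSum, hsum, hsum, hsum, Finset.sum_eq_zero fun a _ => by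
      rw [coefAt_of_none (h2 a)]; norm_num]
    have := (hm i).ne'
    field_simp
    ring
  · intro A c d l h hc ih k hk
    obtain ⟨k, rfl⟩ : ∃ k', k = k' + 1 := ⟨k - 1, by have := h.numTrain_pos; omega⟩
    have h0 := ih false k (by have := h.child_lt hc false; omega)
    have h1 := ih true k (by have := h.child_lt hc true; omega)
    have hsq := coef_sq (x := x) hm (fun b => (h.of_some hc b).numTrain_pos) y
    rw [sum_addrs_succ, coefAt_of_some hc, region]
    simp only [coefAt_cons hc]
    rw [← boxSum_child_add x A d l fun i => m i * y i ^ 2, h0, h1]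
    simp only [csub]
    linear_combination -hsq

lemma boxSum_root {Om : Box D} (hxOm : ∀ i, InBox Om (x i)) (f : Fin n → ℝ) :
    boxSum x Om f = ∑ i, f i := by
  simp [boxSum, hxOm]

lemma numTrain_root {Om : Box D} (hxOm : ∀ i, InBox Om (x i)) : numTrain x Om = n := by
  simp [numTrain_eq_sum, hxOm]

lemma coefAt_add (x : Fin n → Fin D → ℝ) (m : Fin n → ℝ) (A : Box D) (T : Tree D)
    (y y' : Fin n → ℝ) (a : Addr) :
    coefAt x m A T (y + y') a = coefAt x m A T y a + coefAt x m A T y' a := by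
  unfold coefAt
  split
  · simp
  · simp only [coef, ← Finset.sum_add_distrib, Pi.add_apply]
    exact Finset.sum_congr rfl fun i _ => by ring

lemma coefAt_smul (x : Fin n → Fin D → ℝ) (m : Fin n → ℝ) (A : Box D) (T : Tree D)
    (r : ℝ) (y : Fin n → ℝ) (a : Addr) :
    coefAt x m A T (r • y) a = r * coefAt x m A T y a := by
  unfold coefAt
  split
  · simp
  · simp only [coef, Finset.mul_sum, Pi.smul_apply, smul_eq_mul]
    exact Finset.sum_congr rfl fun i _ => by ring

/-- The wavelet coefficients of a constant vanish. -/
lemma Full.coefAt_const (hm : ∀ i, 0 < m i) {Om : Box D} (hxOm : ∀ i, InBox Om (x i))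
    {c : Config D K} (h : Full x Om c) (r : ℝ) {a : Addr} (ha : a.length < n) :
    coefAt x m Om c.1 (fun _ => r) a = 0 := by
  have hp := h.parseval hm (fun _ => r) n (numTrain_root hxOm).le
  have hM := mass_pos hm h.numTrain_pos
  rw [mass_eq_boxSum] at hp hM
  simp only [boxSum_root hxOm, ← Finset.sum_mul] at hp hM
  have h0 : ∑ a ∈ addrs n, coefAt x m Om c.1 (fun _ => r) a ^ 2 = 0 := by
    have : (∑ i, m i) * r ^ 2 = ((∑ i, m i) * r) ^ 2 / ∑ i, m i := by field_simp
    linarith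
  rw [Finset.sum_eq_zero_iff_of_nonneg fun _ _ => sq_nonneg _] at h0
  exact pow_eq_zero_iff two_ne_zero |>.1 (h0 a (mem_addrs.2 ha))

end Parseval

/-! ### Products of densities -/

section PiDensity

variable {ι E : Type*} [Fintype ι] [MeasurableSpace E]

lemma lintegral_fin_prod_eq_prod {n : ℕ} (μ : Measure E) [SigmaFinite μ] {f : Fin n → E → ℝ≥0∞}
    (hf : ∀ i, Measurable (f i)) :
    ∫⁻ w : Fin n → E, ∏ i, f i (w i) ∂Measure.pi (fun _ => μ) = ∏ i, ∫⁻ w, f i w ∂μ := by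
  induction n with
  | zero => simp
  | succ n ih =>
    have hg : Measurable fun w : Fin n → E => ∏ i : Fin n, f i.succ (w i) :=
      Finset.measurable_fun_prod _ fun i _ => (hf i.succ).comp (measurable_pi_apply i)
    have hF : Measurable fun w : Fin (n + 1) → E => ∏ i, f i (w i) :=
      Finset.measurable_fun_prod _ fun i _ => (hf i).comp (measurable_pi_apply i)
    rw [← ((measurePreserving_piFinSuccAbove (fun _ => μ) 0).symm).lintegral_comp hF,
      Fin.prod_univ_succ, ← ih fun i => hf i.succ, ← lintegral_prod_mul (hf 0).aemeasurable
      hg.aemeasurable]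
    refine lintegral_congr fun w => ?_
    rw [Fin.prod_univ_succ]
    rfl

lemma lintegral_fintype_prod_eq_prod (μ : Measure E) [SigmaFinite μ] {f : ι → E → ℝ≥0∞}
    (hf : ∀ i, Measurable (f i)) :
    ∫⁻ w : ι → E, ∏ i, f i (w i) ∂Measure.pi (fun _ => μ) = ∏ i, ∫⁻ w, f i w ∂μ := by
  let e := (Fintype.equivFin ι).symm
  have hF : Measurable fun w : ι → E => ∏ i, f i (w i) :=
    Finset.measurable_fun_prod _ fun i _ => (hf i).comp (measurable_pi_apply i)
  rw [← (measurePreserving_piCongrLeft (fun _ => μ) e).lintegral_comp hF,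
    ← e.prod_comp, ← lintegral_fin_prod_eq_prod μ fun i => hf (e i)]
  refine lintegral_congr fun w => ?_
  rw [← e.prod_comp]
  refine Finset.prod_congr rfl fun i _ => ?_
  rw [MeasurableEquiv.coe_piCongrLeft, Equiv.piCongrLeft_apply_apply]

/-- Independent coordinates with densities have the product density. -/
lemma pi_withDensity (μ : Measure E) [SigmaFinite μ] {f : ι → E → ℝ≥0∞}
    (hf : ∀ i, Measurable (f i)) [∀ i, SigmaFinite (μ.withDensity (f i))] :
    Measure.pi (fun i => μ.withDensity (f i)) =
      (Measure.pi fun _ => μ).withDensity fun w => ∏ i, f i (w i) := by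
  classical
  refine Measure.pi_eq fun s hs => ?_
  rw [withDensity_apply _ (MeasurableSet.univ_pi hs),
    ← lintegral_indicator (MeasurableSet.univ_pi hs)]
  simp only [withDensity_apply _ (hs _), ← lintegral_indicator (hs _)]
  rw [← lintegral_fintype_prod_eq_prod μ fun i => (hf i).indicator (hs i)]
  refine lintegral_congr fun w => ?_
  by_cases hw : w ∈ Set.univ.pi s
  · rw [Set.indicator_of_mem hw]
    exact Finset.prod_congr rfl fun i _ => (Set.indicator_of_mem (hw i trivial) _).symm
  · rw [Set.indicator_of_notMem hw]
    obtain ⟨i, hi⟩ : ∃ i, w i ∉ s i := by simpa [Set.mem_pi] using hw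
    exact (Finset.prod_eq_zero (Finset.mem_univ i) (Set.indicator_of_notMem hi _)).symm

lemma withDensity_map {α β : Type*} [MeasurableSpace α] [MeasurableSpace β] (μ : Measure α)
    {f : α → β} (hf : Measurable f) {g : β → ℝ≥0∞} (hg : Measurable g) :
    (μ.map f).withDensity g = (μ.withDensity fun a => g (f a)).map f := by
  ext s hs
  rw [withDensity_apply _ hs, Measure.map_apply hf hs, withDensity_apply _ (hf hs),
    setLIntegral_map hs hg hf]

end PiDensity

/-! ### The law of the data given the tree and the states -/

section Reference

variable {D n K : ℕ} {x : Fin n → Fin D → ℝ} {m : Fin n → ℝ}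

/-- The vector corresponding to the constant function `1` when `L²(μ)` is identified with Euclidean
space by `y ↦ (√(m i) * y i)`. -/
def sqrtMass (m : Fin n → ℝ) : EuclideanSpace ℝ (Fin n) := WithLp.toLp 2 fun i => Real.sqrt (m i)

/-- The space of functions of `μ`-average zero, under the identification of `L²(μ)` with Euclidean
space. -/
abbrev MeanZero (m : Fin n → ℝ) : Submodule ℝ (EuclideanSpace ℝ (Fin n)) := (ℝ ∙ sqrtMass m)ᗮ

/-- The data vector with average `r` and mean-zero part `h`. -/
def synth (m : Fin n → ℝ) (q : ℝ × MeanZero m) : Fin n → ℝ :=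
  fun i => q.1 + (q.2 : EuclideanSpace ℝ (Fin n)) i / Real.sqrt (m i)

/-- The reference measure on the data space: the average has law `ν`, and the mean-zero part is
Lebesgue measure of the Euclidean structure of `L²(μ)`. It does not refer to any tree. -/
def refMeasure (m : Fin n → ℝ) (ν : Measure ℝ) : Measure (Fin n → ℝ) :=
  (ν.prod volume).map (synth m)

/-- Average and wavelet coefficients of the data. -/
def coeffs (x : Fin n → Fin D → ℝ) (m : Fin n → ℝ) (Om : Box D) (T : Tree D) (y : Fin n → ℝ) :
    ℝ × ({a // a ∈ internal n T} → ℝ) :=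
  (average m y, fun a => coefAt x m Om T y a)

lemma measurable_average (m : Fin n → ℝ) : Measurable (average m) := by
  unfold average
  fun_prop

lemma measurable_coefAt (x : Fin n → Fin D → ℝ) (m : Fin n → ℝ) (Om : Box D) (T : Tree D)
    (a : Addr) : Measurable fun y => coefAt x m Om T y a := by
  unfold coefAt coef
  split <;> fun_prop

lemma measurable_coeffs (x : Fin n → Fin D → ℝ) (m : Fin n → ℝ) (Om : Box D) (T : Tree D) :
    Measurable (coeffs x m Om T) :=
  (measurable_average m).prodMk (measurable_pi_lambda _ fun a => measurable_coefAt x m Om T a)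

lemma measurable_synth (m : Fin n → ℝ) : Measurable (synth m) := by
  refine measurable_pi_lambda _ fun i => ?_
  have h₀ : Measurable fun v : EuclideanSpace ℝ (Fin n) => v i :=
    (PiLp.continuous_apply 2 (fun _ : Fin n => ℝ) i).measurable
  have h₁ : Measurable (Subtype.val : MeanZero m → EuclideanSpace ℝ (Fin n)) :=
    measurable_subtype_coe
  have h : Measurable fun q : ℝ × MeanZero m => (q.2 : EuclideanSpace ℝ (Fin n)) i :=
    (h₀.comp h₁).comp measurable_snd
  exact measurable_fst.add (h.div_const _)

lemma sum_sqrtMass_mul (h : MeanZero m) :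
    ∑ i, Real.sqrt (m i) * (h : EuclideanSpace ℝ (Fin n)) i = 0 := by
  have h' := Submodule.mem_orthogonal_singleton_iff_inner_right.1 h.2
  rw [PiLp.inner_apply] at h'
  rw [← h']
  exact Finset.sum_congr rfl fun i _ => by simp [sqrtMass, mul_comm]

lemma mul_div_sqrt {r : ℝ} (hr : 0 < r) (t : ℝ) : r * (t / Real.sqrt r) = Real.sqrt r * t := by
  have h0 := (Real.sqrt_pos.2 hr).ne'
  field_simp
  rw [Real.sq_sqrt hr.le, mul_comm]

lemma average_synth (hn : 0 < n) (hm : ∀ i, 0 < m i) (q : ℝ × MeanZero m) :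
    average m (synth m q) = q.1 := by
  have : Nonempty (Fin n) := ⟨⟨0, hn⟩⟩
  have hM : 0 < ∑ i, m i := Finset.sum_pos (fun i _ => hm i) Finset.univ_nonempty
  simp only [average, synth, mul_add, Finset.sum_add_distrib, mul_div_sqrt (hm _),
    sum_sqrtMass_mul, add_zero, ← Finset.sum_mul]
  field_simp

/-- Every data vector is the sum of its average and a mean-zero part. -/
lemma exists_synth_eq (hn : 0 < n) (hm : ∀ i, 0 < m i) (y : Fin n → ℝ) :
    ∃ h : MeanZero m, synth m (average m y, h) = y := by
  have : Nonempty (Fin n) := ⟨⟨0, hn⟩⟩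
  have hM : 0 < ∑ i, m i := Finset.sum_pos (fun i _ => hm i) Finset.univ_nonempty
  refine ⟨⟨WithLp.toLp 2 fun i => Real.sqrt (m i) * (y i - average m y), ?_⟩, ?_⟩
  · rw [Submodule.mem_orthogonal_singleton_iff_inner_right, PiLp.inner_apply]
    have : ∀ i, inner ℝ ((sqrtMass m) i) (Real.sqrt (m i) * (y i - average m y)) =
        m i * y i - m i * average m y := fun i => by
      simp only [sqrtMass, RCLike.inner_apply, conj_trivial]
      linear_combination (y i - average m y) * Real.mul_self_sqrt (hm i).le
    refine (Finset.sum_congr rfl fun i _ => this i).trans ?_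
    rw [Finset.sum_sub_distrib, ← Finset.sum_mul, average]
    field_simp
    ring
  · funext i
    have h0 := (Real.sqrt_pos.2 (hm i)).ne'
    simp only [synth]
    field_simp
    ring

/-- On the mean-zero functions, taking wavelet coefficients is a linear isometry. -/
def coefIsometry (hm : ∀ i, 0 < m i) {Om : Box D} (hxOm : ∀ i, InBox Om (x i)) {c : Config D K}
    (h : Full x Om c) : MeanZero m →ₗᵢ[ℝ] EuclideanSpace ℝ {a // a ∈ internal n c.1} where
  toFun v := WithLp.toLp 2 fun a => coefAt x m Om c.1 (synth m (0, v)) a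
  map_add' v w := by
    ext a
    have : synth m (0, v + w) = synth m (0, v) + synth m (0, w) := by
      funext i; simp [synth, add_div]
    simp only [this, coefAt_add]
    rfl
  map_smul' r v := by
    ext a
    have : synth m (0, r • v) = r • synth m (0, v) := by
      funext i; simp [synth, mul_div_assoc]
    simp only [this, coefAt_smul]
    rfl
  norm_map' v := by
    have hp := h.parseval hm (synth m (0, v)) n (numTrain_root hxOm).le
    simp only [boxSum_root hxOm] at hp
    have h0 : ∑ i, m i * synth m (0, v) i = 0 := by
      simp only [synth, zero_add, mul_div_sqrt (hm _)]
      exact sum_sqrtMass_mul v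
    have h2 : ∑ i, m i * synth m (0, v) i ^ 2 = ∑ i, (v : EuclideanSpace ℝ (Fin n)) i ^ 2 := by
      refine Finset.sum_congr rfl fun i _ => ?_
      have hs := (Real.sqrt_pos.2 (hm i)).ne'
      simp only [synth, zero_add]
      rw [div_pow, Real.sq_sqrt (hm i).le]
      have := (hm i).ne'
      field_simp
    have hint : ∑ a ∈ addrs n, coefAt x m Om c.1 (synth m (0, v)) a ^ 2 =
        ∑ a : {a // a ∈ internal n c.1}, coefAt x m Om c.1 (synth m (0, v)) a ^ 2 := by
      rw [Finset.sum_coe_sort (internal n c.1) fun a => coefAt x m Om c.1 (synth m (0, v)) a ^ 2,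
        internal, Finset.sum_filter]
      refine Finset.sum_congr rfl fun a _ => ?_
      split_ifs with ha
      · rfl
      · rw [coefAt_of_none (by simpa using ha)]; norm_num
    rw [h0, h2, hint] at hp
    rw [LinearMap.coe_mk, AddHom.coe_mk, EuclideanSpace.norm_eq, Submodule.coe_norm,
      EuclideanSpace.norm_eq]
    simp only [Real.norm_eq_abs, sq_abs]
    rw [hp]
    simp

lemma finrank_meanZero (hn : 0 < n) (hm : ∀ i, 0 < m i) :
    Module.finrank ℝ (MeanZero m) = n - 1 := by
  refine Submodule.finrank_add_finrank_orthogonal' ?_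
  have hne : sqrtMass m ≠ 0 := fun h => by
    have h1 : sqrtMass m ⟨0, hn⟩ = 0 := by rw [h]; rfl
    exact (Real.sqrt_pos.2 (hm ⟨0, hn⟩)).ne' h1
  rw [finrank_span_singleton hne, finrank_euclideanSpace_fin]
  omega

/-- Average and wavelet coefficients determine the data, and they map the reference measure to the
product of `ν` and Lebesgue measure, whatever the tree. -/
lemma coeffs_refMeasure (hn : 0 < n) (hm : ∀ i, 0 < m i) (ν : Measure ℝ) [SFinite ν]
    {Om : Box D} (hxOm : ∀ i, InBox Om (x i)) {c : Config D K} (h : Full x Om c) :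
    (refMeasure m ν).map (coeffs x m Om c.1) = ν.prod (Measure.pi fun _ => volume) ∧
      ∃ g : ℝ × ({a // a ∈ internal n c.1} → ℝ) → Fin n → ℝ, Measurable g ∧
        ∀ y, g (coeffs x m Om c.1 y) = y := by
  have hcard : Module.finrank ℝ (MeanZero m) =
      Module.finrank ℝ (EuclideanSpace ℝ {a // a ∈ internal n c.1}) := by
    have := h.card_internal n (numTrain_root hxOm).le
    rw [numTrain_root hxOm] at this
    rw [finrank_meanZero hn hm, finrank_euclideanSpace, Fintype.card_coe]
    omega
  -- both spaces have dimension `n - 1`, so the isometry is onto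
  let L := (coefIsometry hm hxOm h).toLinearIsometryEquiv hcard
  have hsynth : ∀ q : ℝ × MeanZero m,
      coeffs x m Om c.1 (synth m q) = (q.1, WithLp.ofLp (L q.2)) := fun q => by
    refine Prod.ext (average_synth hn hm q) (funext fun a => ?_)
    have hsplit : synth m q = (fun _ => q.1) + synth m (0, q.2) := by
      funext i; simp [synth]
    have ha : a.1.length < n := mem_addrs.1 (Finset.mem_filter.1 a.2).1
    change coefAt x m Om c.1 (synth m q) a = coefAt x m Om c.1 (synth m (0, q.2)) a
    rw [hsplit, coefAt_add, h.coefAt_const hm hxOm q.1 ha, zero_add]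
  constructor
  · have hmp : MeasurePreserving (fun q : ℝ × MeanZero m => (q.1, WithLp.ofLp (L q.2)))
        (ν.prod volume) (ν.prod volume) :=
      (MeasurePreserving.id ν).prod ((PiLp.volume_preserving_ofLp _).comp L.measurePreserving)
    rw [refMeasure, Measure.map_map (measurable_coeffs x m Om c.1) (measurable_synth m)]
    have : coeffs x m Om c.1 ∘ synth m = fun q => (q.1, WithLp.ofLp (L q.2)) := funext hsynth
    rw [this, hmp.map_eq]
    rfl
  · refine ⟨fun w => synth m (w.1, L.symm (WithLp.toLp 2 w.2)), ?_, fun y => ?_⟩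
    · refine (measurable_synth m).comp (measurable_fst.prodMk ?_)
      exact L.symm.continuous.measurable.comp
        ((PiLp.continuous_toLp 2 _).measurable.comp measurable_snd)
    · obtain ⟨v, hv⟩ := exists_synth_eq hn hm y
      have h1 := hsynth (average m y, v)
      rw [hv] at h1
      rw [h1]
      change synth m (average m y, L.symm (L v)) = y
      rw [LinearIsometryEquiv.symm_apply_apply, hv]

variable {Z : Type*} [MeasurableSpace Z] {ζ : Measure Z} [SigmaFinite ζ]
  {p : ℕ → Fin K → Box D → ℝ → Z → ℝ≥0∞}

/-- Integrating out the local latent variables. -/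
lemma coefLaw_map (hp : ∀ j s, Measurable fun q : Box D × ℝ × Z => p j s q.1 q.2.1 q.2.2)
    (hp_one : ∀ j s A, 2 ≤ numTrain x A → ∫⁻ q : ℝ × Z, p j s A q.1 q.2 ∂(volume.prod ζ) = 1)
    (ν : Measure ℝ) [SFinite ν] (s₀ : Fin K) {Om : Box D} {c : Config D K} (h : Full x Om c) :
    (coefLaw n Om ν ζ p s₀ c.1 c.2).map (fun q => (q.1, fun a => (q.2 a).1)) =
      (ν.prod (Measure.pi fun _ => volume)).withDensity fun w =>
        ∏ a : {a // a ∈ internal n c.1}, ∫⁻ z, p a.1.length ((c.2 a.1).getD s₀)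
          (region Om c.1 a.1) (w.2 a) z ∂ζ := by
  have hpa : ∀ j s A, Measurable fun q : ℝ × Z => p j s A q.1 q.2 := fun j s A =>
    (hp j s).comp (measurable_prodMk_left (x := A))
  let J := {a // a ∈ internal n c.1}
  let f : J → ℝ × Z → ℝ≥0∞ := fun a q =>
    p a.1.length ((c.2 a.1).getD s₀) (region Om c.1 a.1) q.1 q.2
  let g : J → ℝ → ℝ≥0∞ := fun a w => ∫⁻ z, f a (w, z) ∂ζ
  have hf : ∀ a, Measurable (f a) := fun a => hpa _ _ _
  have hg : ∀ a, Measurable (g a) := fun a => (hf a).lintegral_prod_right'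
  have hprob : ∀ a : J, IsProbabilityMeasure ((volume.prod ζ).withDensity (f a)) := fun a => by
    have ha : c.1 a.1 ≠ none := Option.isSome_iff_ne_none.1 (Finset.mem_filter.1 a.2).2
    refine ⟨?_⟩
    rw [withDensity_apply _ MeasurableSet.univ, Measure.restrict_univ]
    exact hp_one _ _ _ ((h a.1).2.1.1 ha).2
  have hmarg : ∀ a : J, ((volume.prod ζ).withDensity (f a)).map Prod.fst =
      volume.withDensity (g a) := fun a => by
    ext s hs
    rw [Measure.map_apply measurable_fst hs, withDensity_apply _ (measurable_fst hs),
      withDensity_apply _ hs, ← lintegral_indicator (measurable_fst hs), ← lintegral_indicator hs,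
      lintegral_prod _ ((hf a).indicator (measurable_fst hs)).aemeasurable]
    refine lintegral_congr fun w => ?_
    by_cases hw : w ∈ s
    · rw [Set.indicator_of_mem hw]
      exact lintegral_congr fun z => Set.indicator_of_mem (show (w, z) ∈ Prod.fst ⁻¹' s from hw) _
    · rw [Set.indicator_of_notMem hw]
      refine (lintegral_congr fun z => ?_).trans lintegral_zero
      exact Set.indicator_of_notMem (show (w, z) ∉ Prod.fst ⁻¹' s from hw) _
  have hprob' : ∀ a : J, IsProbabilityMeasure (volume.withDensity (g a)) := fun a => by
    rw [← hmarg a]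
    exact Measure.isProbabilityMeasure_map measurable_fst.aemeasurable
  have hmapσ : ∀ a : J, SigmaFinite (((volume.prod ζ).withDensity (f a)).map Prod.fst) :=
    fun a => by rw [hmarg a]; infer_instance
  have hpi : (Measure.pi fun a : J => (volume.prod ζ).withDensity (f a)).map
      (fun q a => (q a).1) =
      (Measure.pi fun _ => volume).withDensity fun w => ∏ a, g a (w a) := by
    rw [Measure.pi_map_pi (f := fun _ : J => (Prod.fst : ℝ × Z → ℝ))
      fun a => measurable_fst.aemeasurable]
    simp only [hmarg]
    exact pi_withDensity volume hg
  have hfst : Measurable fun (q : J → ℝ × Z) (a : J) => (q a).1 :=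
    measurable_pi_lambda _ fun a => measurable_fst.comp (measurable_pi_apply a)
  have hprodg : Measurable fun w : J → ℝ => ∏ a, g a (w a) :=
    Finset.measurable_fun_prod _ fun a _ => (hg a).comp (measurable_pi_apply a)
  have hcl : (coefLaw n Om ν ζ p s₀ c.1 c.2).map (fun q => (q.1, fun a => (q.2 a).1)) =
      ν.prod ((Measure.pi fun a : J => (volume.prod ζ).withDensity (f a)).map
        fun q a => (q a).1) := by
    have := Measure.map_prod_map ν (Measure.pi fun a : J => (volume.prod ζ).withDensity (f a))
      measurable_id hfst
    rw [Measure.map_id] at this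
    rw [this]
    rfl
  rw [hcl, hpi, prod_withDensity_right hprodg]

/-- Given a completely grown tree with its states, the data have the likelihood of the tree as
density with respect to the reference measure. -/
lemma data_law_eq (hn : 0 < n) (hm : ∀ i, 0 < m i) {Om : Box D} (hxOm : ∀ i, InBox Om (x i))
    (hp : ∀ j s, Measurable fun q : Box D × ℝ × Z => p j s q.1 q.2.1 q.2.2)
    (hp_one : ∀ j s A, 2 ≤ numTrain x A → ∫⁻ q : ℝ × Z, p j s A q.1 q.2 ∂(volume.prod ζ) = 1)
    (ν : Measure ℝ) [SFinite ν] (s₀ : Fin K) {c : Config D K} (h : Full x Om c)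
    {θ : Measure ((Fin n → ℝ) × (Addr → Z))}
    (hθ : θ.map (analysis x m Om c.1) = coefLaw n Om ν ζ p s₀ c.1 c.2) :
    θ.map Prod.fst = (refMeasure m ν).withDensity fun y =>
      treeLik n (localLik x m ζ p y) 0 Om c.1 c.2 := by
  obtain ⟨hR, G, hG, hGinv⟩ := coeffs_refMeasure hn hm ν hxOm h
  have hC := measurable_coeffs x m Om c.1
  have han : Measurable (analysis (Z := Z) x m Om c.1) :=
    ((measurable_average m).comp measurable_fst).prodMk (measurable_pi_lambda _ fun a =>
      ((measurable_coefAt x m Om c.1 a).comp measurable_fst).prodMk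
        ((measurable_pi_apply a.1).comp measurable_snd))
  have hproj : Measurable fun (q : ℝ × ({a // a ∈ internal n c.1} → ℝ × Z)) =>
      (q.1, fun a => (q.2 a).1) :=
    measurable_fst.prodMk (measurable_pi_lambda _ fun a =>
      measurable_fst.comp ((measurable_pi_apply a).comp measurable_snd))
  have hdens : Measurable fun w : ℝ × ({a // a ∈ internal n c.1} → ℝ) =>
      ∏ a : {a // a ∈ internal n c.1}, ∫⁻ z, p a.1.length ((c.2 a.1).getD s₀)
        (region Om c.1 a.1) (w.2 a) z ∂ζ := by
    refine Finset.measurable_fun_prod _ fun a _ => ?_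
    have hpa : Measurable fun q : ℝ × Z =>
        p a.1.length ((c.2 a.1).getD s₀) (region Om c.1 a.1) q.1 q.2 :=
      (hp _ _).comp (measurable_prodMk_left (x := region Om c.1 a.1))
    exact hpa.lintegral_prod_right'.comp ((measurable_pi_apply a).comp measurable_snd)
  have hlik : ∀ y, treeLik n (localLik x m ζ p y) 0 Om c.1 c.2 =
      ∏ a : {a // a ∈ internal n c.1}, ∫⁻ z, p a.1.length ((c.2 a.1).getD s₀)
        (region Om c.1 a.1) ((coeffs x m Om c.1 y).2 a) z ∂ζ := fun y => by
    change _ = ∏ a : {a // a ∈ internal n c.1}, ∫⁻ z, p a.1.length ((c.2 a.1).getD s₀)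
      (region Om c.1 a.1) (coefAt x m Om c.1 y a.1) z ∂ζ
    rw [treeLik_eq_prod_nodeLik, Finset.prod_coe_sort (internal n c.1) fun a =>
      ∫⁻ z, p a.length ((c.2 a).getD s₀) (region Om c.1 a) (coefAt x m Om c.1 y a) z ∂ζ,
      internal, Finset.prod_filter]
    refine Finset.prod_congr rfl fun a _ => ?_
    split_ifs with ha
    · have hne := Option.isSome_iff_ne_none.1 ha
      obtain ⟨⟨d, l⟩, hdl⟩ := Option.ne_none_iff_exists'.1 hne
      obtain ⟨s, hs⟩ := Option.ne_none_iff_exists'.1 (h.state_ne_none hne)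
      rw [nodeLik_of_some hdl hs, coefAt_of_some hdl, hs, Option.getD_some, Nat.zero_add, localLik]
    · exact nodeLik_of_none (by simpa using ha)
  have hmap : (θ.map Prod.fst).map (coeffs x m Om c.1) =
      ((refMeasure m ν).withDensity fun y =>
        treeLik n (localLik x m ζ p y) 0 Om c.1 c.2).map (coeffs x m Om c.1) := by
    simp only [hlik]
    rw [← withDensity_map _ hC hdens, hR, ← coefLaw_map hp hp_one ν s₀ h, ← hθ,
      Measure.map_map hproj han, Measure.map_map hC measurable_fst]
    rfl
  have hinv : ∀ μ : Measure (Fin n → ℝ), (μ.map (coeffs x m Om c.1)).map G = μ := fun μ => by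
    rw [Measure.map_map hG hC]
    have : G ∘ coeffs x m Om c.1 = id := funext hGinv
    rw [this, Measure.map_id]
  -- the data are a function of their coefficients, so it is enough to compare laws of the latter
  rw [← hinv (θ.map Prod.fst), hmap, hinv]

end Reference

/-! ### Bayes' theorem for dominated conditional laws -/

section Bayes

variable {α E W : Type*} [MeasurableSpace α] [MeasurableSpace E] [MeasurableSpace W]

open Classical in
/-- The density of the posterior with respect to the prior `π`, when `L (y, c)` is the likelihood of
the parameter `c` given the data `y`. When the evidence is zero or infinite, the posterior is taken
to be the prior. -/
def bayesDensity (π : Measure α) (L : E × α → ℝ≥0∞) (y : E) (c : α) : ℝ≥0∞ :=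
  if 0 < ∫⁻ c, L (y, c) ∂π ∧ ∫⁻ c, L (y, c) ∂π < ∞ then L (y, c) / ∫⁻ c, L (y, c) ∂π else 1

lemma measurable_bayesDensity (π : Measure α) [SFinite π] {L : E × α → ℝ≥0∞} (hL : Measurable L) :
    Measurable (Function.uncurry (bayesDensity π L)) := by
  have hΦ : Measurable fun z : E × α => ∫⁻ c, L (z.1, c) ∂π :=
    hL.lintegral_prod_right'.comp measurable_fst
  exact Measurable.ite ((measurableSet_lt measurable_const hΦ).inter
    (measurableSet_lt hΦ measurable_const)) (hL.div hΦ) measurable_const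

/-- The posterior distribution. -/
def bayesKernel (π : Measure α) [SFinite π] (L : E × α → ℝ≥0∞) : Kernel E α :=
  Kernel.withDensity (Kernel.const E π) (bayesDensity π L)

lemma bayesKernel_apply (π : Measure α) [SFinite π] {L : E × α → ℝ≥0∞} (hL : Measurable L)
    (y : E) : bayesKernel π L y = π.withDensity (bayesDensity π L y) := by
  rw [bayesKernel, Kernel.withDensity_apply _ (measurable_bayesDensity π hL), Kernel.const_apply]

lemma bayesKernel_of_pos (π : Measure α) [SFinite π] {L : E × α → ℝ≥0∞} (hL : Measurable L)
    {y : E} (h0 : 0 < ∫⁻ c, L (y, c) ∂π) (h1 : ∫⁻ c, L (y, c) ∂π < ∞) :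
    bayesKernel π L y = (∫⁻ c, L (y, c) ∂π)⁻¹ • π.withDensity fun c => L (y, c) := by
  have hLy : Measurable fun c => L (y, c) := hL.comp measurable_prodMk_left
  rw [bayesKernel_apply π hL, ← withDensity_smul _ hLy]
  congr 1
  funext c
  rw [bayesDensity, if_pos ⟨h0, h1⟩, Pi.smul_apply, smul_eq_mul, mul_comm, ENNReal.div_eq_inv_mul,
    mul_comm]

lemma isMarkovKernel_bayesKernel (π : Measure α) [IsProbabilityMeasure π] {L : E × α → ℝ≥0∞}
    (hL : Measurable L) : IsMarkovKernel (bayesKernel π L) := by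
  refine ⟨fun y => ⟨?_⟩⟩
  by_cases h : 0 < ∫⁻ c, L (y, c) ∂π ∧ ∫⁻ c, L (y, c) ∂π < ∞
  · rw [bayesKernel_of_pos π hL h.1 h.2, Measure.smul_apply, withDensity_apply _ MeasurableSet.univ,
      Measure.restrict_univ, smul_eq_mul, ENNReal.inv_mul_cancel h.1.ne' h.2.ne]
  · rw [bayesKernel_apply π hL, withDensity_apply _ MeasurableSet.univ, Measure.restrict_univ]
    simp [bayesDensity, h]

variable {P : Measure W} [IsProbabilityMeasure P] {X : W → α} {Y : W → E} {θ : Kernel α E}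
  [IsMarkovKernel θ] {Q : Measure E} [SFinite Q] {L : E × α → ℝ≥0∞}

/-- The joint law of data and parameter has density `L` with respect to `Q.prod π`, where `π` is the
law of the parameter. -/
lemma lintegral_joint (h : HasCondDistrib Y X θ P) (hL : Measurable L)
    (hθ : ∀ᵐ c ∂P.map X, θ c = Q.withDensity fun y => L (y, c)) {f : E × α → ℝ≥0∞}
    (hf : Measurable f) :
    ∫⁻ ω, f (Y ω, X ω) ∂P = ∫⁻ y, ∫⁻ c, L (y, c) * f (y, c) ∂P.map X ∂Q := by
  have hX := h.aemeasurable_fst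
  have hXp := Measure.isProbabilityMeasure_map (μ := P) hX
  have hswap : Measurable fun z : α × E => f (z.2, z.1) := hf.comp measurable_swap
  calc ∫⁻ ω, f (Y ω, X ω) ∂P
      = ∫⁻ z, f (z.2, z.1) ∂P.map fun ω => (X ω, Y ω) :=
        (lintegral_map' hswap.aemeasurable h.aemeasurable).symm
    _ = ∫⁻ c, ∫⁻ y, f (y, c) ∂θ c ∂P.map X := by
        rw [HasLaw.map_eq h, Measure.lintegral_compProd hswap]
    _ = ∫⁻ c, ∫⁻ y, L (y, c) * f (y, c) ∂Q ∂P.map X := by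
        refine lintegral_congr_ae ?_
        filter_upwards [hθ] with c hc
        rw [hc]
        exact lintegral_withDensity_eq_lintegral_mul _ (hL.comp measurable_prodMk_right)
          (hf.comp measurable_prodMk_right)
    _ = ∫⁻ y, ∫⁻ c, L (y, c) * f (y, c) ∂P.map X ∂Q :=
        lintegral_lintegral_swap (hL.mul hf |>.comp measurable_swap).aemeasurable

lemma map_eq_withDensity_evidence (h : HasCondDistrib Y X θ P) (hL : Measurable L)
    (hθ : ∀ᵐ c ∂P.map X, θ c = Q.withDensity fun y => L (y, c)) :
    P.map Y = Q.withDensity fun y => ∫⁻ c, L (y, c) ∂P.map X := by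
  have hX := h.aemeasurable_fst
  have hXp := Measure.isProbabilityMeasure_map (μ := P) hX
  refine Measure.ext_of_lintegral _ fun f hf => ?_
  rw [lintegral_map' hf.aemeasurable h.aemeasurable_snd,
    lintegral_withDensity_eq_lintegral_mul _ hL.lintegral_prod_right' hf,
    lintegral_joint h hL hθ (f := fun z => f z.1) (hf.comp measurable_fst)]
  refine lintegral_congr fun y => ?_
  exact lintegral_mul_const (f y) (f := fun c => L (y, c)) (hL.comp measurable_prodMk_left)

lemma ae_evidence_lt_top (h : HasCondDistrib Y X θ P) (hL : Measurable L)
    (hθ : ∀ᵐ c ∂P.map X, θ c = Q.withDensity fun y => L (y, c)) :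
    ∀ᵐ y ∂Q, ∫⁻ c, L (y, c) ∂P.map X < ∞ := by
  have hX := h.aemeasurable_fst
  have hXp := Measure.isProbabilityMeasure_map (μ := P) hX
  have hYp := Measure.isProbabilityMeasure_map (μ := P) h.aemeasurable_snd
  refine ae_lt_top hL.lintegral_prod_right' ?_
  have h1 : P.map Y Set.univ = 1 := measure_univ
  rw [map_eq_withDensity_evidence h hL hθ, withDensity_apply _ MeasurableSet.univ,
    Measure.restrict_univ] at h1
  rw [h1]
  exact ENNReal.one_ne_top

/-- The evidence is positive and finite for almost all data. -/
lemma ae_evidence_pos_lt_top (h : HasCondDistrib Y X θ P) (hL : Measurable L)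
    (hθ : ∀ᵐ c ∂P.map X, θ c = Q.withDensity fun y => L (y, c)) :
    ∀ᵐ y ∂P.map Y, 0 < ∫⁻ c, L (y, c) ∂P.map X ∧ ∫⁻ c, L (y, c) ∂P.map X < ∞ := by
  have hX := h.aemeasurable_fst
  have hXp := Measure.isProbabilityMeasure_map (μ := P) hX
  rw [map_eq_withDensity_evidence h hL hθ, ae_withDensity_iff hL.lintegral_prod_right']
  filter_upwards [ae_evidence_lt_top h hL hθ] with y hy h0
  exact ⟨pos_iff_ne_zero.2 h0, hy⟩

/-- Bayes' theorem. -/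
lemma hasCondDistrib_bayesKernel (h : HasCondDistrib Y X θ P) (hL : Measurable L)
    (hθ : ∀ᵐ c ∂P.map X, θ c = Q.withDensity fun y => L (y, c)) [IsProbabilityMeasure (P.map X)] :
    HasCondDistrib X Y (bayesKernel (P.map X) L) P := by
  have hK := isMarkovKernel_bayesKernel (P.map X) hL
  refine ⟨h.aemeasurable_snd.prodMk h.aemeasurable_fst, ?_⟩
  have hYp := Measure.isProbabilityMeasure_map (μ := P) h.aemeasurable_snd
  refine Measure.ext_of_lintegral _ fun f hf => ?_
  have hI : Measurable fun y => ∫⁻ c, f (y, c) ∂bayesKernel (P.map X) L y :=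
    hf.lintegral_kernel_prod_right'
  rw [lintegral_map' hf.aemeasurable (h.aemeasurable_snd.prodMk h.aemeasurable_fst),
    Measure.lintegral_compProd hf, lintegral_joint h hL hθ hf]
  conv_rhs => rw [map_eq_withDensity_evidence h hL hθ]
  rw [lintegral_withDensity_eq_lintegral_mul _ hL.lintegral_prod_right' hI]
  refine lintegral_congr_ae ?_
  filter_upwards [ae_evidence_lt_top h hL hθ] with y hy
  have hLy : Measurable fun c => L (y, c) := hL.comp measurable_prodMk_left
  have hfy : Measurable fun c => f (y, c) := hf.comp measurable_prodMk_left
  rw [Pi.mul_apply]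
  rcases eq_or_ne (∫⁻ c, L (y, c) ∂P.map X) 0 with h0 | h0
  · -- With zero evidence the likelihood vanishes almost everywhere, and both sides are zero.
    rw [h0, zero_mul]
    refine (lintegral_eq_zero_iff (hLy.mul hfy)).2 ?_
    filter_upwards [(lintegral_eq_zero_iff hLy).1 h0] with c hc
    simp [hc]
  · rw [bayesKernel_of_pos _ hL (pos_iff_ne_zero.2 h0) hy, lintegral_smul_measure, smul_eq_mul,
      ← mul_assoc, ENNReal.mul_inv_cancel h0 hy.ne, one_mul,
      lintegral_withDensity_eq_lintegral_mul _ hLy hfy]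
    rfl

end Bayes

/-! ### The posterior of tree and states -/

section Posterior

variable {D n K : ℕ} {x : Fin n → Fin D → ℝ} {m : Fin n → ℝ}

lemma measurable_boxSum {X : Type*} [MeasurableSpace X] (x : Fin n → Fin D → ℝ) {A : X → Box D}
    (hA : Measurable A) {f : X → Fin n → ℝ} (hf : ∀ i, Measurable fun z => f z i) :
    Measurable fun z => boxSum x (A z) (f z) :=
  Finset.measurable_sum _ fun i _ =>
    Measurable.ite (hA (measurableSet_inBox (x i))) (hf i) measurable_const

lemma measurable_coef (x : Fin n → Fin D → ℝ) (m : Fin n → ℝ) (d : Fin D) :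
    Measurable fun z : (Fin n → ℝ) × Box D × I => coef x m z.2.1 d z.2.2 z.1 := by
  have hc : ∀ b, Measurable fun z : (Fin n → ℝ) × Box D × I => child z.2.1 d z.2.2 b := fun b =>
    (measurable_child d b).comp measurable_snd
  have hmass : ∀ b, Measurable fun z : (Fin n → ℝ) × Box D × I =>
      mass x m (child z.2.1 d z.2.2 b) := fun b =>
    measurable_boxSum x (hc b) (f := fun _ => m) fun _ => measurable_const
  have hmass' : Measurable fun z : (Fin n → ℝ) × Box D × I => mass x m z.2.1 :=
    measurable_boxSum x measurable_snd.fst (f := fun _ => m) fun _ => measurable_const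
  have hsum : ∀ b, Measurable fun z : (Fin n → ℝ) × Box D × I =>
      boxSum x (child z.2.1 d z.2.2 b) fun i => m i * z.1 i := fun b =>
    measurable_boxSum x (hc b) fun i => by fun_prop
  simp only [coef_eq]
  exact (((hmass false).mul (hmass true)).div hmass').sqrt.mul
    (((hsum false).div (hmass false)).sub ((hsum true).div (hmass true)))

variable {Z : Type*} [MeasurableSpace Z] {ζ : Measure Z} [SigmaFinite ζ]
  {p : ℕ → Fin K → Box D → ℝ → Z → ℝ≥0∞}

lemma measurable_localLik (x : Fin n → Fin D → ℝ) (m : Fin n → ℝ)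
    (hp : ∀ j s, Measurable fun q : Box D × ℝ × Z => p j s q.1 q.2.1 q.2.2) (j : ℕ) (s : Fin K)
    (d : Fin D) :
    Measurable fun z : (Fin n → ℝ) × Box D × I => localLik x m ζ p z.1 j s z.2.1 d z.2.2 := by
  have h1 : Measurable fun z : Box D × ℝ => ∫⁻ v, p j s z.1 z.2 v ∂ζ :=
    Measurable.lintegral_prod_right' (f := fun q : (Box D × ℝ) × Z => p j s q.1.1 q.1.2 q.2)
      ((hp j s).comp (measurable_fst.fst.prodMk (measurable_fst.snd.prodMk measurable_snd)))
  exact h1.comp (measurable_snd.fst.prodMk (measurable_coef x m d))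

variable {lam : Box D → Fin D → ℝ≥0∞} {B : Fin D → Kernel (Box D) I} [∀ d, IsMarkovKernel (B d)]
  {ρ : ℕ → Fin K → PMF (Fin K)} {s₀ : Fin K} {Om : Box D}

/-- The joint law of a random tree and of its Markov states is that of the branching process of
marks. -/
lemma IsSplitPrior.map_eq_branch (h : IsSplitPrior x lam B) {W : Type*} [MeasurableSpace W]
    {P : Measure W} [IsProbabilityMeasure P] {T : W → Tree D} {S : W → States K}
    (hT : HasLaw T (ruhwt x lam B n Om) P) {κ : Kernel (Tree D) (States K)} [IsMarkovKernel κ]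
    (hS : HasCondDistrib S T κ P) (hκ : ∀ᵐ t ∂P.map T, κ t = markovTree ρ n 0 s₀ t) :
    (P.map fun ω => (T ω, S ω)) = branch (priorMark x lam B ρ) n 0 s₀ Om := by
  refine Measure.ext_of_lintegral _ fun f hf => ?_
  rw [HasLaw.map_eq hS, Measure.lintegral_compProd hf, h.lintegral_branch ρ n 0 s₀ Om hf,
    ← hT.map_eq]
  refine lintegral_congr_ae ?_
  filter_upwards [hκ] with t ht
  rw [ht]

/-- For data with nondegenerate evidence, the prior reweighted by the likelihood is the branching
process with the posterior node laws, whatever the bound on the number of levels. -/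
lemma IsSplitPrior.smul_weighted_eq_branch (h : IsSplitPrior x lam B) (hn : 0 < n)
    {M : ℕ → Fin K → Box D → Fin D → I → ℝ≥0∞}
    (hM : ∀ j s d, Measurable fun z : Box D × I => M j s z.1 d z.2)
    (h0 : 0 < margLik x lam B ρ M 0 s₀ Om) (h1 : margLik x lam B ρ M 0 s₀ Om < ∞) {N : ℕ}
    (hN : n ≤ N) :
    (margLik x lam B ρ M 0 s₀ Om)⁻¹ • weighted x lam B ρ M n 0 s₀ Om =
      branch (postMark x lam B ρ M (margLik x lam B ρ M)) N 0 s₀ Om := by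
  rw [← h.weighted_eq_of_le hM hn hN 0 s₀ (numTrain_le x Om),
    h.weighted_eq_smul_branch hn hM (hn.trans_le hN) 0 s₀ ((numTrain_le x Om).trans hN) h1.ne,
    smul_smul, ENNReal.inv_mul_cancel h0.ne' h1.ne, one_smul]

end Posterior

end UHWT

end

/-! ### The posterior with latent states -/

theorem theoremE1 {D n K : ℕ} (hn : 0 < n)
    -- the domain (root box), distinct training locations, positive weights of the base measure
    (Om : UHWT.Box D) (x : Fin n → Fin D → ℝ) (hx : Function.Injective x)
    (hxOm : ∀ i, UHWT.InBox Om (x i)) (m : Fin n → ℝ) (hm : ∀ i, 0 < m i)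
    -- split dimension probabilities and split location distributions
    (lam : UHWT.Box D → Fin D → ℝ≥0∞) (hlam : ∀ d, Measurable fun A => lam A d)
    (hlam_sum : ∀ A, 2 ≤ UHWT.numTrain x A → ∑ d, lam A d = 1)
    (B : Fin D → Kernel (UHWT.Box D) I) [∀ d, IsMarkovKernel (B d)]
    -- zero probability of creating a child with no training locations
    (hB : ∀ A, 2 ≤ UHWT.numTrain x A → ∀ d, lam A d ≠ 0 →
      B d A {l | ∃ b, UHWT.numTrain x (UHWT.child A d l b) = 0} = 0)
    -- transition kernels of the states; `ρ 0 s₀` is the initial distribution, at the root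
    (ρ : ℕ → Fin K → PMF (Fin K)) (s₀ : Fin K)
    -- the densities `p_A^{(s)}(w, z)` with respect to `dw dz`
    {Z : Type*} [MeasurableSpace Z] (ζ : Measure Z) [SigmaFinite ζ]
    (p : ℕ → Fin K → UHWT.Box D → ℝ → Z → ℝ≥0∞)
    (hp : ∀ j s, Measurable fun q : UHWT.Box D × ℝ × Z => p j s q.1 q.2.1 q.2.2)
    (hp_one : ∀ j s A, 2 ≤ UHWT.numTrain x A →
      ∫⁻ q : ℝ × Z, p j s A q.1 q.2 ∂(volume.prod ζ) = 1)
    -- the law of the scaling coefficient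
    (ν : Measure ℝ) [IsProbabilityMeasure ν]
    -- the random tree, states, data and local latent variables
    {W : Type*} [MeasurableSpace W] (P : Measure W) [IsProbabilityMeasure P]
    (T : W → UHWT.Tree D) (S : W → UHWT.States K) (Y : W → Fin n → ℝ) (V : W → UHWT.Addr → Z)
    -- `T` has the random UHWT prior
    (hT : HasLaw T (UHWT.ruhwt x lam B n Om) P)
    -- given `T`, the states follow the top-down Markov tree
    (κ : Kernel (UHWT.Tree D) (UHWT.States K)) [IsMarkovKernel κ] (hS : HasCondDistrib S T κ P)
    (hκ : ∀ᵐ t ∂(P.map T), κ t = UHWT.markovTree ρ n 0 s₀ t)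
    -- given `T` and `S`, the coefficients and local latent variables are independent across nodes,
    -- with the densities given by the states
    (η : Kernel (UHWT.Tree D × UHWT.States K) ((Fin n → ℝ) × (UHWT.Addr → Z))) [IsMarkovKernel η]
    (hY : HasCondDistrib (fun ω => (Y ω, V ω)) (fun ω => (T ω, S ω)) η P)
    (hη : ∀ᵐ c ∂(P.map fun ω => (T ω, S ω)),
      (η c).map (UHWT.analysis x m Om c.1) = UHWT.coefLaw n Om ν ζ p s₀ c.1 c.2) :
    -- `Φ = 1` at atomic nodes, and the recursion at the other nodes
    (∀ y j s A, UHWT.numTrain x A = 1 →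
      UHWT.margLik x lam B ρ (UHWT.localLik x m ζ p y) j s A = 1) ∧
    (∀ y j s A, 2 ≤ UHWT.numTrain x A →
      UHWT.margLik x lam B ρ (UHWT.localLik x m ζ p y) j s A =
        ∑ s', ρ j s s' * ∑ d, lam A d * ∫⁻ l, UHWT.localLik x m ζ p y j s' A d l *
          (UHWT.margLik x lam B ρ (UHWT.localLik x m ζ p y) (j + 1) s' (UHWT.child A d l false) *
           UHWT.margLik x lam B ρ (UHWT.localLik x m ζ p y) (j + 1) s' (UHWT.child A d l true))
          ∂(B d A)) ∧
    -- the posterior of `(T, S)` given the data, and its sequential generative description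
    ∃ post : Kernel (Fin n → ℝ) (UHWT.Tree D × UHWT.States K), IsMarkovKernel post ∧
      HasCondDistrib (fun ω => (T ω, S ω)) Y post P ∧
      ∀ᵐ y ∂(P.map Y),
        (0 < UHWT.margLik x lam B ρ (UHWT.localLik x m ζ p y) 0 s₀ Om ∧
          UHWT.margLik x lam B ρ (UHWT.localLik x m ζ p y) 0 s₀ Om < ∞) ∧
        ∀ next : UHWT.Tree D × UHWT.States K → Option UHWT.Addr, UHWT.IsSchedule next →
          -- given the part of the tree revealed after `k` steps, the next node is drawn by the step
          (∀ k, (post y).map (fun c => (UHWT.reveal next c k, UHWT.reveal next c (k + 1))) =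
            ((post y).map fun c => UHWT.reveal next c k).bind fun c =>
              (UHWT.postStep x m Om lam B ρ s₀ ζ p next y c).map (Prod.mk c)) ∧
          -- after `2 n - 1` steps the whole tree with its states has been generated
          (∀ N, 2 * n - 1 ≤ N →
            UHWT.growLaw (UHWT.postStep x m Om lam B ρ s₀ ζ p next y) N = post y) := by
  have h : UHWT.IsSplitPrior x lam B := by
    refine ⟨hlam, hlam_sum, fun A hA d hd => ?_⟩
    have h0 : ∀ᵐ l ∂B d A, ¬ ∃ b, UHWT.numTrain x (UHWT.child A d l b) = 0 :=
      measure_eq_zero_iff_ae_notMem.1 (hB A hA d hd)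
    filter_upwards [h0] with l hl b
    exact Nat.pos_of_ne_zero fun hb => hl ⟨b, hb⟩
  have hM := UHWT.measurable_localLik x m hp (ζ := ζ)
  have hMy : ∀ y j s d, Measurable fun z : UHWT.Box D × I =>
      UHWT.localLik x m ζ p y j s z.1 d z.2 := fun y j s d =>
    (hM j s d).comp (measurable_prodMk_left (x := y))
  refine ⟨fun y j s A hA => h.margLik_of_lt_two hn (hMy y) j s (by omega),
    fun y j s A hA => h.margLik_of_two_le hn (hMy y) j s hA, ?_⟩
  -- the prior of tree and states is a branching process of marks
  have hprior := h.map_eq_branch hT hS hκ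
  have hXprob := Measure.isProbabilityMeasure_map (μ := P) hY.aemeasurable_fst
  -- given tree and states, the data have density `L` with respect to a common reference measure
  let L : (Fin n → ℝ) × UHWT.Config D K → ℝ≥0∞ := fun z =>
    UHWT.treeLik n (UHWT.localLik x m ζ p z.1) 0 Om z.2.1 z.2.2
  have hL : Measurable L := (UHWT.measurable_treeLik hM n 0).comp
    (measurable_fst.prodMk (measurable_const.prodMk measurable_snd))
  have hfull : ∀ᵐ c ∂P.map fun ω => (T ω, S ω), UHWT.Full x Om c := by
    rw [hprior]
    have hroot := UHWT.numTrain_root hxOm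
    exact h.ae_full n 0 s₀ (hroot.symm ▸ hn) hroot.le
  have hdata : ∀ᵐ c ∂P.map fun ω => (T ω, S ω),
      η.fst c = (UHWT.refMeasure m ν).withDensity fun y => L (y, c) := by
    filter_upwards [hη, hfull] with c hc hcf
    rw [Kernel.fst_apply]
    exact UHWT.data_law_eq hn hm hxOm hp hp_one ν s₀ hcf hc
  have hevid : ∀ y, ∫⁻ c, L (y, c) ∂P.map (fun ω => (T ω, S ω)) =
      UHWT.margLik x lam B ρ (UHWT.localLik x m ζ p y) 0 s₀ Om := fun y => by
    rw [hprior]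
    exact h.lintegral_branch ρ n 0 s₀ Om (f := fun c => L (y, c))
      (hL.comp measurable_prodMk_left)
  have : SFinite (UHWT.refMeasure m ν) := by unfold UHWT.refMeasure; infer_instance
  have hpostM := UHWT.isMarkovKernel_bayesKernel (P.map fun ω => (T ω, S ω)) hL
  refine ⟨UHWT.bayesKernel (P.map fun ω => (T ω, S ω)) L, hpostM,
    UHWT.hasCondDistrib_bayesKernel hY.fst hL hdata, ?_⟩
  filter_upwards [UHWT.ae_evidence_pos_lt_top hY.fst hL hdata] with y hy
  -- for good data, the posterior is the branching process with the posterior node laws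
  have hpost : UHWT.bayesKernel (P.map fun ω => (T ω, S ω)) L y =
      (UHWT.margLik x lam B ρ (UHWT.localLik x m ζ p y) 0 s₀ Om)⁻¹ •
        UHWT.weighted x lam B ρ (UHWT.localLik x m ζ p y) n 0 s₀ Om := by
    rw [UHWT.bayesKernel_of_pos _ hL hy.1 hy.2, hevid, hprior]
    rfl
  have hpostfull : ∀ᵐ c ∂UHWT.bayesKernel (P.map fun ω => (T ω, S ω)) L y,
      UHWT.Full x Om c := by
    rw [UHWT.bayesKernel_apply _ hL]
    exact (withDensity_absolutelyContinuous _ _).ae_le hfull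
  rw [hevid] at hy
  refine ⟨hy, fun next hnext => ?_⟩
  have hPhi : ∀ j s, Measurable (UHWT.margLik x lam B ρ (UHWT.localLik x m ζ p y) j s) :=
    fun j s => (UHWT.measurable_margLik h hM j s).comp (measurable_prodMk_left (x := y))
  have hq := h.isMarkLaw_postMark (hMy y) hPhi fun j s A hA =>
    h.margLik_of_two_le (ρ := ρ) hn (hMy y) j s hA
  have hreveal := UHWT.reveal_law_of_fill_eq (s₀ := s₀) (Om := Om) hq hnext (N₀ := n)
    (μ := UHWT.bayesKernel (P.map fun ω => (T ω, S ω)) L y) fun N hN => by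
      rw [hpost]
      exact (h.smul_weighted_eq_branch hn (hMy y) hy.1 hy.2 hN).symm
  refine ⟨fun k => (hreveal k).1, fun N hN => ?_⟩
  refine (hreveal N).2.trans ?_
  -- all nodes are revealed after `2 n - 1` steps
  have hself : (fun c => UHWT.reveal next c N)
      =ᵐ[UHWT.bayesKernel (P.map fun ω => (T ω, S ω)) L y] id := by
    filter_upwards [hpostfull] with c hc
    exact UHWT.reveal_eq_self hnext hc hN
  rw [Measure.map_congr hself, Measure.map_id]
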